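/- **Setting.** Let $\Omega=\mathbb T\times\mathbb R$ with $\mathbb T=[0,1]$ (periodic), $\bar u(y)=\int_{\mathbb T}u(x',y)\,dx'$ and $\widetilde u=u-\bar u$. Let $\chi,\varphi:\mathbb R^2\to\mathbb R$ be smooth and even, $\chi$ supported in $\{|\zeta|\le\frac43\}$, $\varphi$ supported in $\{\frac34\le|\zeta|\le\frac83\}$, with $\chi(\zeta)+\sum_{q\ge0}\varphi(2^{-q}\zeta)=1$ for all $\zeta\in\mathbb R^2$ and $\sum_{q\in\mathbb Z}\varphi(2^{-q}\zeta)=1$ for $\zeta\ne0$. Put $\Delta_q=0$ for $q\le-2$, $\Delta_{-1}=\chi(D)$, $\Delta_q=\varphi(2^{-q}D)$ for $q\ge0$ (Fourier multipliers on $\Omega$, i.e. convolutions over $\Omega$ with the kernels $\frac1{2\pi}\sum_{k\in\mathbb Z}\int_{\mathbb R}m(2\pi k,\xi)e^{i(2\pi kx+\xi y)}\,d\xi$, where $m$ is the symbol $\chi$ or $\varphi(2^{-q}\,\cdot)$), $S_q=\sum_{j=-1}^{q-1}\Delta_j$, and $\|u\|_{H^s}^2=\sum_{q\ge-1}2^{2qs}\|\Delta_qu\|_{L^2(\Omega)}^2$.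 **Lemma 4.2.** Let $s>0$. There are a constant $C_0>0$ and, for each $\varepsilon_0>0$, a constant $C_{\varepsilon_0}>0$, depending only on $s,\chi,\varphi$ (and $C_{\varepsilon_0}$ on $\varepsilon_0$), such that the following holds. Let $f,g,h$ be smooth real vector fields $\Omega\to\mathbb R^2$ with $\nabla\cdot f=0$, such that $f,g,h,\partial_1f,\partial_1g,\partial_1h\in H^s(\Omega)$ and $\partial_2f,\partial_2g,\partial_1\partial_2f,\partial_1\partial_2g\in L^2(\Omega)$ (for $s\ge1$ the second condition follows from the first). Then there is a sequence $b_q\ge0$ with $\sum_qb_q\le1$ such that for every $q\in\mathbb Z$ and every $\varepsilon_0>0$ (both integrals being absolutely convergent) $$\begin{aligned} -\int_\Omega\Delta_q(f\cdot\nabla g)\cdot\Delta_qh\,dxdy \le\;& C_{\varepsilon_0}2^{-2qs}b_q\Big(\|\partial_1f\|_{L^2}\|\partial_1\partial_2f\|_{L^2}+\|f\|_{L^2}^2\|\partial_1f\|_{L^2}^2+\|f\|_{L^2}^2\|\partial_1\partial_2f\|_{L^2}^2\\ &\qquad+\|\partial_1g\|_{L^2}\|\partial_1\partial_2g\|_{L^2}+\|\partial_1\partial_2g\|_{L^2}^2\Big)\big(\|f\|_{H^s}^2+\|g\|_{H^s}^2+\|h\|_{H^s}^2\big)\\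 &+C_02^{-2qs}b_q\Big(\|f\|_{L^2}^{\frac12}\|\partial_2f\|_{L^2}^{\frac12}+\|\partial_2g\|_{L^2}\Big)\big(\|\partial_1f\|_{H^s}^2+\|\partial_1g\|_{H^s}^2+\|\partial_1h\|_{H^s}^2\big)\\ &+C_0\varepsilon_02^{-2qs}b_q\big(\|\partial_1f\|_{H^s}^2+\|\partial_1g\|_{H^s}^2+\|\partial_1h\|_{H^s}^2\big) -\int_\Omega S_q\widetilde f^{\,2}\,\partial_2\Delta_qg\cdot\Delta_qh\,dxdy , \end{aligned}$$ where $\widetilde f^{\,2}$ is the second component of $\widetilde f$. -/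

import Mathlib

open MeasureTheory
open scoped ContDiff

noncomputable section

namespace TorusLine

/-- The values of a planar vector field, with the Euclidean norm.
The components `v¹, v²` are `v 0, v 1`. -/
abbrev Vec := EuclideanSpace ℝ (Fin 2)

/-- Lebesgue measure on one period cell of `Ω = 𝕋 × ℝ`, where `𝕋 = [0,1]` with its ends identified.
Functions on `Ω` are functions of `p = (x, y) ∈ ℝ × ℝ` that are `1`-periodic in `x`. -/
def muOmega : Measure (ℝ × ℝ) := volume.restrict (Set.Ioc (0 : ℝ) 1 ×ˢ Set.univ)

/-- A smooth vector field on `Ω`. -/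
structure IsSmoothField (f : ℝ × ℝ → Vec) : Prop where
  smooth : ContDiff ℝ ∞ f
  periodic : ∀ x y : ℝ, f (x + 1, y) = f (x, y)

section Operators

variable {E : Type*} [NormedAddCommGroup E] [NormedSpace ℝ E]

/-- The horizontal derivative `∂₁ = ∂/∂x`. -/
def d1 (u : ℝ × ℝ → E) (p : ℝ × ℝ) : E := fderiv ℝ u p (1, 0)

/-- The vertical derivative `∂₂ = ∂/∂y`. -/
def d2 (u : ℝ × ℝ → E) (p : ℝ × ℝ) : E := fderiv ℝ u p (0, 1)

/-- The average in `x`, `ū(y) = ∫_𝕋 u(x', y) dx'`, as a function on `Ω`. -/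
def bar (u : ℝ × ℝ → E) (p : ℝ × ℝ) : E := ∫ x in (0 : ℝ)..1, u (x, p.2)

/-- The remainder `ũ = u - ū`. -/
def til (u : ℝ × ℝ → E) (p : ℝ × ℝ) : E := u p - bar u p

/-- The convolution kernel on `Ω` of the Fourier multiplier with symbol `m`,
`(1/2π) ∑_{k ∈ ℤ} ∫_ℝ m(2πk, ξ) e^{i(2πkx + ξy)} dξ`.
The frequencies dual to `𝕋 = [0,1]` are `2πk`. For a real and even symbol, as below, the
expression in brackets is a real number, so that taking its real part changes nothing. -/
def kernel (m : ℝ × ℝ → ℝ) (p : ℝ × ℝ) : ℝ :=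
  (1 / (2 * Real.pi)) *
    (∑' k : ℤ, ∫ ξ : ℝ, (m (2 * Real.pi * k, ξ) : ℂ) *
      Complex.exp (Complex.I * ((2 * Real.pi * k * p.1 + ξ * p.2 : ℝ) : ℂ))).re

/-- The Fourier multiplier `m(D)`, as convolution over `Ω` with its kernel. -/
def multiplier (m : ℝ × ℝ → ℝ) (u : ℝ × ℝ → E) (p : ℝ × ℝ) : E :=
  ∫ z, kernel m z • u (p - z) ∂muOmega

/-- The symbol of `Δ_q`: zero for `q ≤ -2`, `χ` for `q = -1` and `φ(2^{-q} ·)` for `q ≥ 0`. -/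
def lpSymbol (χ φ : ℝ × ℝ → ℝ) (q : ℤ) (ζ : ℝ × ℝ) : ℝ :=
  if q ≤ -2 then 0 else if q = -1 then χ ζ else φ ((2 : ℝ) ^ (-q) • ζ)

/-- The non-homogeneous dyadic block `Δ_q u`. -/
def lpBlock (χ φ : ℝ × ℝ → ℝ) (q : ℤ) (u : ℝ × ℝ → E) : ℝ × ℝ → E :=
  multiplier (lpSymbol χ φ q) u

/-- The low frequency cut-off `S_q u = ∑_{j = -1}^{q - 1} Δ_j u`. -/
def lpLow (χ φ : ℝ × ℝ → ℝ) (q : ℤ) (u : ℝ × ℝ → E) (p : ℝ × ℝ) : E :=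
  ∑ j ∈ Finset.Ico (-1 : ℤ) q, lpBlock χ φ j u p

/-- `u ∈ L²(Ω)`. -/
def MemL2 (u : ℝ × ℝ → E) : Prop := MemLp u 2 muOmega

/-- The norm of `L²(Ω)`. -/
def normL2 (u : ℝ × ℝ → E) : ℝ := (eLpNorm u 2 muOmega).toReal

/-- The norm of `H^s(Ω) = B^s_{2,2}(Ω)`, `(∑_{q ≥ -1} 2^{2qs} ‖Δ_q u‖²_{L²})^{1/2}`, possibly
infinite. The terms with `q ≤ -2` vanish. -/
def eNormHs (χ φ : ℝ × ℝ → ℝ) (s : ℝ) (u : ℝ × ℝ → E) : ENNReal :=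
  (∑' q : ℤ, ENNReal.ofReal ((2 : ℝ) ^ (2 * (q : ℝ) * s)) *
    eLpNorm (lpBlock χ φ q u) 2 muOmega ^ 2) ^ (1 / 2 : ℝ)

/-- `u ∈ H^s(Ω)`, for `s ≥ 0`, where `H^s(Ω) ⊆ L²(Ω)`. -/
def MemHs (χ φ : ℝ × ℝ → ℝ) (s : ℝ) (u : ℝ × ℝ → E) : Prop :=
  MemL2 u ∧ eNormHs χ φ s u < ⊤

/-- The norm of `H^s(Ω)` as a real number. -/
def normHs (χ φ : ℝ × ℝ → ℝ) (s : ℝ) (u : ℝ × ℝ → E) : ℝ := (eNormHs χ φ s u).toReal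

end Operators

/-- A pair of cut-off functions for the Littlewood-Paley decomposition. Evenness (which holds for
the usual radial choice) makes the dyadic blocks of real functions real. -/
structure IsDyadicPartition (χ φ : ℝ × ℝ → ℝ) : Prop where
  smooth_low : ContDiff ℝ ∞ χ
  smooth_ring : ContDiff ℝ ∞ φ
  even_low : ∀ ζ, χ (-ζ) = χ ζ
  even_ring : ∀ ζ, φ (-ζ) = φ ζ
  support_low : Function.support χ ⊆ {ζ | √(ζ.1 ^ 2 + ζ.2 ^ 2) ≤ 4 / 3}
  support_ring : Function.support φ ⊆
    {ζ | 3 / 4 ≤ √(ζ.1 ^ 2 + ζ.2 ^ 2) ∧ √(ζ.1 ^ 2 + ζ.2 ^ 2) ≤ 8 / 3}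
  sum_inhomogeneous : ∀ ζ, χ ζ + ∑' q : ℕ, φ ((2 : ℝ) ^ (-(q : ℤ)) • ζ) = 1
  sum_homogeneous : ∀ ζ, ζ ≠ 0 → ∑' q : ℤ, φ ((2 : ℝ) ^ (-q) • ζ) = 1

/-- The divergence `∇ · f = ∂₁ f¹ + ∂₂ f²`. -/
def divergence (f : ℝ × ℝ → Vec) (p : ℝ × ℝ) : ℝ := d1 f p 0 + d2 f p 1

/-- The convection term `f · ∇ g = f¹ ∂₁ g + f² ∂₂ g`. -/
def convect (f g : ℝ × ℝ → Vec) (p : ℝ × ℝ) : Vec := f p 0 • d1 g p + f p 1 • d2 g p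

/-- The integrand `Δ_q(f · ∇ g) · Δ_q h` of the trilinear term. -/
def trilinear (χ φ : ℝ × ℝ → ℝ) (q : ℤ) (f g h : ℝ × ℝ → Vec) (p : ℝ × ℝ) : ℝ :=
  inner ℝ (lpBlock χ φ q (convect f g) p) (lpBlock χ φ q h p)

/-- The integrand `S_q f̃² ∂₂ Δ_q g · Δ_q h` of the remainder, where `f̃²` is the second component
of `f̃`. -/
def remainder (χ φ : ℝ × ℝ → ℝ) (q : ℤ) (f g h : ℝ × ℝ → Vec) (p : ℝ × ℝ) : ℝ :=
  lpLow χ φ q (til (fun p' => f p' 1)) p *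
    inner ℝ (d2 (lpBlock χ φ q g) p) (lpBlock χ φ q h p)

end TorusLine

end

open TorusLine MeasureTheory

noncomputable section

namespace TorusLine

open Filter Topology
open scoped FourierTransform SchwartzMap ENNReal ComplexConjugate

/-! Write `T` for the integral of `Δ_q(f · ∇g) · Δ_q h` and `R` for the remainder integral; the
proof bounds `|T - R|` and uses `-T ≤ |T - R| - R`. By Plancherel, `T - R` is a double integral over
a frequency `ν` of `f` and a frequency `κ` of `g`, with `h` taken at `κ + ν`. No paraproduct
decomposition is needed, since the integrand can be estimated pointwise.

The symbol of `Δ_q` at `κ + ν` vanishes unless `κ` or `ν` is at least of order `2^q`. In the part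
with `f² ∂₂g` the integrand contains the commutator symbol `m_q(κ + ν) - S_q(ν) m_q(κ)`. If `ν` is
well below `2^q`, then `S_q(ν) = 1`, and the Lipschitz bound `2^{-q}|ν|` cancels `∂₂ ~ 2^q` on `g`
and puts a derivative on `f` (`exists_commutator_bound`). As `∇ · f = 0`, `∂₂f² = -∂₁f¹`, so only
horizontal derivatives of `f` remain. If `ν` is of order `2^q` or more, boundedness of the symbols
suffices. This gives the five terms of `exists_difKernel_bound`.

Each term is a trilinear convolution, estimated anisotropically: one factor in `L²_x L^∞_y` (Agmon's
inequality `nrm21_le`), one in `L^∞_x L²_y`, one in `L²`. Some factor always lacks the zero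
horizontal mode: it carries `∂₁`, or it is `f²`, whose mean in `x` vanishes by incompressibility. Of
the other two factors, each either is itself oscillating in `x`, so that `∂₁` controls it, or is a
mean, which forces the remaining one to oscillate (`tri_le_nrm21`, `tri_le_sup`). Hence every
product contains at least one norm of `∂₁f`, `∂₁g` or `∂₁h`.

As `s > 0`, the high-frequency pieces weighted by `2^{2qs}` are summable by the `H^s` norm
(`exists_weight_bound`), which produces `b_q`. Young's inequality then sends the products with one
`∂₁` norm to the `ε₀` and `C_{ε₀}` terms, and those with two to the middle term. -/

instance isFiniteMeasureOnCompacts_count_int :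
    IsFiniteMeasureOnCompacts (Measure.count : Measure ℤ) :=
  ⟨fun _ hK => by rw [Measure.count_apply_lt_top]; exact hK.finite_of_discrete⟩

/-! ### Frequencies, the Plancherel measure and the characters of `Ω`. -/

/-- Frequencies of `Ω`: the integer `k` and the real `η` stand for the wave vector `2π(k, η)`. -/
abbrev Freq := ℤ × ℝ

/-- The Plancherel measure of `Ω`. -/
def gam : Measure Freq := (Measure.count : Measure ℤ).prod volume

instance : SigmaFinite gam := by unfold gam; infer_instance
instance : IsFiniteMeasureOnCompacts gam := by unfold gam; infer_instance
instance : gam.IsAddRightInvariant := by unfold gam; infer_instance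
instance : gam.IsNegInvariant := by
  refine ⟨?_⟩
  exact ((Measure.measurePreserving_neg (Measure.count : Measure ℤ)).prod
    (Measure.measurePreserving_neg (volume : Measure ℝ))).map_eq
instance : SigmaFinite muOmega := by unfold muOmega; infer_instance

/-- The character `e^{2πi(kx + ηy)}` of `Ω`. -/
def wave (κ : Freq) (p : ℝ × ℝ) : ℂ :=
  Complex.exp ((2 * Real.pi * (κ.1 * p.1 + κ.2 * p.2) : ℝ) * Complex.I)

/-- The inverse Fourier transform on `Ω`. -/
def synth (W : Freq → ℂ) (p : ℝ × ℝ) : ℂ := ∫ κ, W κ * wave κ p ∂gam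

theorem norm_wave (κ : Freq) (p : ℝ × ℝ) : ‖wave κ p‖ = 1 :=
  Complex.norm_exp_ofReal_mul_I _

theorem wave_add_left (κ ν : Freq) (p : ℝ × ℝ) : wave (κ + ν) p = wave κ p * wave ν p := by
  simp only [wave, ← Complex.exp_add, Prod.fst_add, Prod.snd_add]
  congr 1; push_cast; ring

theorem wave_add_right (κ : Freq) (p z : ℝ × ℝ) : wave κ (p + z) = wave κ p * wave κ z := by
  simp only [wave, ← Complex.exp_add, Prod.fst_add, Prod.snd_add]
  congr 1; push_cast; ring

theorem conj_wave (κ : Freq) (p : ℝ × ℝ) : conj (wave κ p) = wave κ (-p) := by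
  simp only [wave, ← Complex.exp_conj, map_mul, Complex.conj_ofReal, Complex.conj_I,
    Prod.fst_neg, Prod.snd_neg]
  congr 1; push_cast; ring

theorem wave_neg_left (κ : Freq) (p : ℝ × ℝ) : wave (-κ) p = wave κ (-p) := by
  simp only [wave, Prod.fst_neg, Prod.snd_neg]
  congr 1; push_cast; ring

theorem continuous_wave : Continuous fun q : Freq × (ℝ × ℝ) => wave q.1 q.2 := by
  unfold wave
  have : Continuous fun k : ℤ => (k : ℝ) := continuous_of_discreteTopology
  fun_prop

theorem wave_periodic (κ : Freq) (x y : ℝ) : wave κ (x + 1, y) = wave κ (x, y) := by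
  have h : ((x + 1, y) : ℝ × ℝ) = (x, y) + (1, 0) := by simp
  rw [h, wave_add_right]
  have : wave κ (1, 0) = 1 := by
    rw [wave, Complex.exp_eq_one_iff]
    exact ⟨κ.1, by push_cast; ring⟩
  rw [this, mul_one]

theorem wave_split (κ : Freq) (x y : ℝ) : wave κ (x, y) = wave (κ.1, 0) (x, 0) * wave (0, κ.2) (0, y) := by
  simp only [wave, ← Complex.exp_add]
  congr 1; push_cast; ring

/-! ### Plancherel on the line and Parseval on the circle. -/

theorem fourierInv_toLp_ae_eq {w : ℝ → ℂ} (h1 : Integrable w) (h2 : MemLp w 2 volume) :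
    𝓕⁻ w =ᵐ[volume] (𝓕⁻ (h2.toLp w) : Lp ℂ 2 (volume : Measure ℝ)) := by
  have hcont : Continuous (𝓕⁻ w) :=
    VectorFourier.fourierIntegral_continuous Real.continuous_fourierChar
      (by simp only [LinearMap.neg_apply, innerₗ_apply_apply]; exact continuous_inner.neg) h1
  -- Both transforms are tested against smooth functions of compact support. As a tempered
  -- distribution the `L²` transform moves onto the test function, and so does the integral
  -- transform by Fubini.
  refine ae_eq_of_integral_contDiff_smul_eq hcont.locallyIntegrable
    ((Lp.memLp _).locallyIntegrable (by norm_num)) fun g hg hgc => ?_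
  let φ : 𝓢(ℝ, ℂ) := HasCompactSupport.toSchwartzMap (f := fun x => (g x : ℂ))
    (hgc.comp_left (g := fun x : ℝ => (x : ℂ)) (by simp)) (Complex.ofRealCLM.contDiff.comp hg)
  have hφ : ∀ x, φ x = g x := fun _ => rfl
  have e1 := congrArg (fun T => T φ) (Lp.fourierInv_toTemperedDistribution_eq (h2.toLp w))
  simp only [TemperedDistribution.fourierInv_apply, Lp.toTemperedDistribution_apply] at e1
  have e2 : ∫ x, g x • (𝓕⁻ (h2.toLp w) : Lp ℂ 2 (volume : Measure ℝ)) x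
      = ∫ x, φ x • (𝓕⁻ (h2.toLp w) : Lp ℂ 2 (volume : Measure ℝ)) x := by
    simp [hφ]
  rw [e2, ← e1]
  have e3 := VectorFourier.integral_fourierIntegral_smul_eq_flip (e := Real.fourierChar)
    (μ := (volume : Measure ℝ)) (ν := (volume : Measure ℝ)) (L := -innerₗ ℝ) (f := w) (g := φ)
    Real.continuous_fourierChar (by simp only [LinearMap.neg_apply, innerₗ_apply_apply]; exact continuous_inner.neg) h1
    φ.integrable
  have e4 : ∫ x, (𝓕⁻ φ) x • (h2.toLp w : ℝ → ℂ) x = ∫ x, w x • (𝓕⁻ φ) x := by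
    refine integral_congr_ae ?_
    filter_upwards [h2.coeFn_toLp] with x hx
    rw [hx, smul_eq_mul, smul_eq_mul, mul_comm]
  rw [e4]
  have e5 : (-innerₗ ℝ : ℝ →ₗ[ℝ] ℝ →ₗ[ℝ] ℝ).flip = -innerₗ ℝ := by
    ext; simp
  rw [e5] at e3
  have e6 : ∀ x, (𝓕⁻ φ) x = VectorFourier.fourierIntegral Real.fourierChar volume (-innerₗ ℝ) φ x := by
    intro x; rw [SchwartzMap.fourierInv_coe]; rfl
  simp only [e6]
  rw [← e3]
  refine integral_congr_ae (Filter.Eventually.of_forall fun x => ?_)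
  simp only [hφ, smul_eq_mul, Complex.real_smul]
  exact mul_comm _ _

theorem eLpNorm_fourierInv {w : ℝ → ℂ} (h1 : Integrable w) (h2 : MemLp w 2 volume) :
    eLpNorm (𝓕⁻ w) 2 volume = eLpNorm w 2 volume := by
  rw [eLpNorm_congr_ae (fourierInv_toLp_ae_eq h1 h2), ← eLpNorm_congr_ae h2.coeFn_toLp,
    ← ENNReal.toReal_eq_toReal_iff' (Lp.eLpNorm_ne_top _) (Lp.eLpNorm_ne_top _),
    ← Lp.norm_def, ← Lp.norm_def]
  exact (Lp.fourierTransformₗᵢ ℝ ℂ).symm.norm_map _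

theorem fourierCoeffOn_eq_integral_wave (f : ℝ → ℂ) (k : ℤ) :
    fourierCoeffOn (zero_lt_one' ℝ) f k = ∫ x in (0 : ℝ)..1, conj (wave (k, 0) (x, 0)) * f x := by
  rw [fourierCoeffOn_eq_integral]
  simp only [sub_zero, div_one, one_smul]
  refine intervalIntegral.integral_congr fun x _ => ?_
  simp only [smul_eq_mul, conj_wave]
  rw [fourier_coe_apply, wave]
  congr 2; push_cast; simp; ring

theorem lintegral_enorm_sq_unit {f : ℝ → ℂ} (hf : MemLp f 2 (volume.restrict (Set.Ioc 0 1))) :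
    ∫⁻ x in Set.Ioc (0 : ℝ) 1, ‖f x‖ₑ ^ 2 =
      ∑' k : ℤ, ‖∫ x in (0 : ℝ)..1, conj (wave (k, 0) (x, 0)) * f x‖ₑ ^ 2 := by
  have h := hasSum_sq_fourierCoeffOn (zero_lt_one' ℝ) hf
  simp only [fourierCoeffOn_eq_integral_wave, sub_zero, inv_one, one_smul] at h
  rw [intervalIntegral.integral_of_le zero_le_one] at h
  have h2 : Integrable (fun x => ‖f x‖ ^ 2) (volume.restrict (Set.Ioc (0 : ℝ) 1)) := by
    simpa using hf.integrable_norm_pow (by norm_num)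
  have e1 : ∫⁻ x in Set.Ioc (0 : ℝ) 1, ‖f x‖ₑ ^ 2
      = ENNReal.ofReal (∫ x in Set.Ioc (0 : ℝ) 1, ‖f x‖ ^ 2) := by
    rw [ofReal_integral_eq_lintegral_ofReal h2 (Eventually.of_forall fun x => by positivity)]
    refine lintegral_congr fun x => ?_
    rw [ENNReal.ofReal_pow (norm_nonneg _), ofReal_norm]
  rw [e1, ← h.tsum_eq, ENNReal.ofReal_tsum_of_nonneg (fun k => by positivity) h.summable]
  refine tsum_congr fun k => ?_
  rw [ENNReal.ofReal_pow (norm_nonneg _), ofReal_norm]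

theorem continuous_wave_right (κ : Freq) : Continuous (wave κ) :=
  continuous_wave.comp (by fun_prop : Continuous fun p : ℝ × ℝ => (κ, p))

theorem continuous_wave_left (p : ℝ × ℝ) : Continuous fun κ => wave κ p :=
  continuous_wave.comp (by fun_prop : Continuous fun κ : Freq => (κ, p))

theorem integral_conj_wave_mul_wave (j k : ℤ) :
    ∫ x in (0 : ℝ)..1, conj (wave (k, 0) (x, 0)) * wave (j, 0) (x, 0) = if k = j then 1 else 0 := by
  have e : ∀ x : ℝ, conj (wave (k, 0) (x, 0)) * wave (j, 0) (x, 0)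
      = Complex.exp ((2 * Real.pi * ((j - k : ℤ) : ℂ) * Complex.I) * x) := fun x => by
    rw [conj_wave]
    simp only [wave, ← Complex.exp_add]
    congr 1; push_cast; simp; ring
  simp only [e]
  split_ifs with h
  · simp [h]
  · have h0 : (2 * Real.pi * ((j - k : ℤ) : ℂ) * Complex.I) ≠ 0 := by
      have : ((j - k : ℤ) : ℂ) ≠ 0 := by
        rw [Int.cast_ne_zero]; omega
      simpa only [ne_eq, mul_eq_zero, this, or_false, Complex.I_ne_zero, OfNat.ofNat_ne_zero,
        false_or, Complex.ofReal_eq_zero] using Real.pi_ne_zero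
    rw [integral_exp_mul_complex h0]
    have : Complex.exp ((2 * Real.pi * ((j - k : ℤ) : ℂ) * Complex.I) * (1 : ℝ)) = 1 := by
      rw [Complex.exp_eq_one_iff]; exact ⟨j - k, by push_cast; ring⟩
    rw [this]; simp

/-- Absolute summability makes the series continuous and allows termwise integration, so its Fourier
coefficients are the `c k` and Parseval applies. -/
theorem lintegral_enorm_sq_tsum_wave {c : ℤ → ℂ} (hc : Summable fun k => ‖c k‖) :
    ∫⁻ x in Set.Ioc (0 : ℝ) 1, ‖∑' k, c k * wave (k, 0) (x, 0)‖ₑ ^ 2 = ∑' k, ‖c k‖ₑ ^ 2 := by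
  have hcont : Continuous fun x : ℝ => ∑' k, c k * wave (k, 0) (x, 0) := by
    refine continuous_tsum (u := fun k => ‖c k‖) (fun k => ?_) hc fun k x => ?_
    · exact continuous_const.mul ((continuous_wave_right _).comp (by fun_prop))
    · rw [norm_mul, norm_wave, mul_one]
  have hb : ∀ x : ℝ, ‖∑' k, c k * wave (k, 0) (x, 0)‖ ≤ ∑' k, ‖c k‖ := fun x =>
    tsum_of_norm_bounded hc.hasSum fun k => by rw [norm_mul, norm_wave, mul_one]
  have hm : MemLp (fun x : ℝ => ∑' k, c k * wave (k, 0) (x, 0)) 2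
      (volume.restrict (Set.Ioc (0 : ℝ) 1)) :=
    MemLp.of_bound hcont.aestronglyMeasurable _ (Eventually.of_forall hb)
  rw [lintegral_enorm_sq_unit hm]
  refine tsum_congr fun k => ?_
  congr 2
  have := intervalIntegral.hasSum_integral_of_dominated_convergence (μ := volume)
    (a := (0 : ℝ)) (b := 1) (F := fun j x => conj (wave (k, 0) (x, 0)) * (c j * wave (j, 0) (x, 0)))
    (f := fun x => conj (wave (k, 0) (x, 0)) * ∑' j, c j * wave (j, 0) (x, 0))
    (fun j _ => ‖c j‖) (fun j => ?_) (fun j => ?_) ?_ ?_ ?_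
  · rw [← this.tsum_eq]
    have e : ∀ j, ∫ x in (0 : ℝ)..1, conj (wave (k, 0) (x, 0)) * (c j * wave (j, 0) (x, 0))
        = if j = k then c k else 0 := fun j => by
      have : ∀ x : ℝ, conj (wave (k, 0) (x, 0)) * (c j * wave (j, 0) (x, 0))
        = c j * (conj (wave (k, 0) (x, 0)) * wave (j, 0) (x, 0)) := fun x => by ring
      simp only [this, intervalIntegral.integral_const_mul, integral_conj_wave_mul_wave]
      by_cases h : j = k
      · simp [h]
      · simp [h, Ne.symm h]
    simp only [e, tsum_ite_eq]
  · refine Continuous.aestronglyMeasurable ?_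
    exact (Complex.continuous_conj.comp ((continuous_wave_right _).comp (by fun_prop))).mul
      (continuous_const.mul ((continuous_wave_right _).comp (by fun_prop)))
  · refine Eventually.of_forall fun x _ => ?_
    rw [norm_mul, norm_mul, RCLike.norm_conj, norm_wave, norm_wave, one_mul, mul_one]
  · exact Eventually.of_forall fun x _ => hc
  · simp
  · refine Eventually.of_forall fun x _ => ?_
    refine HasSum.mul_left _ (Summable.hasSum ?_)
    exact Summable.of_norm (by simpa [norm_wave] using hc)

theorem eLpNorm_two_sq {α E : Type*} [MeasurableSpace α] [NormedAddCommGroup E] (μ : Measure α)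
    (f : α → E) : eLpNorm f 2 μ ^ 2 = ∫⁻ x, ‖f x‖ₑ ^ 2 ∂μ := by
  have := eLpNorm_nnreal_pow_eq_lintegral (μ := μ) (f := f) (p := 2) (by norm_num)
  simpa using this

theorem forall_of_ae_count {P : ℤ → Prop} (h : ∀ᵐ k ∂(Measure.count : Measure ℤ), P k) (k : ℤ) :
    P k := by
  rw [ae_iff, Measure.count_eq_zero_iff] at h
  by_contra hk
  exact (h ▸ hk : k ∈ (∅ : Set ℤ))

theorem lintegral_gam {a : Freq → ℝ≥0∞} (ha : AEMeasurable a gam) :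
    ∫⁻ κ, a κ ∂gam = ∑' k : ℤ, ∫⁻ η, a (k, η) := by
  unfold gam at ha ⊢
  rw [lintegral_prod _ ha, lintegral_count]

theorem lintegral_muOmega {a : ℝ × ℝ → ℝ≥0∞} (ha : AEMeasurable a muOmega) :
    ∫⁻ p, a p ∂muOmega = ∫⁻ y, ∫⁻ x in Set.Ioc (0 : ℝ) 1, a (x, y) := by
  have h : muOmega = (volume.restrict (Set.Ioc (0 : ℝ) 1)).prod volume := by
    rw [muOmega, Measure.volume_eq_prod, ← Measure.prod_restrict, Measure.restrict_univ]
  rw [h] at ha ⊢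
  rw [lintegral_prod_symm _ ha]

theorem muOmega_eq_prod : muOmega = (volume.restrict (Set.Ioc (0 : ℝ) 1)).prod volume := by
  rw [muOmega, Measure.volume_eq_prod, ← Measure.prod_restrict, Measure.restrict_univ]

/-! ### Slices in the horizontal mode and the inverse transform on `Ω`. -/

section slices

variable {W : Freq → ℂ}

theorem integrable_slice (hW : Integrable W gam) (k : ℤ) : Integrable fun η => W (k, η) :=
  forall_of_ae_count (Integrable.prod_right_ae (by simpa only [gam] using hW)) k

theorem summable_slice (hW : Integrable W gam) : Summable fun k : ℤ => ∫ η, ‖W (k, η)‖ := by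
  have h : Integrable W ((Measure.count : Measure ℤ).prod volume) := by simpa only [gam] using hW
  have := h.integral_norm_prod_left
  rw [integrable_count_iff] at this
  exact this.of_norm

theorem memLp_slice (hW : MemLp W 2 gam) (k : ℤ) : MemLp (fun η => W (k, η)) 2 volume := by
  have hm : AEStronglyMeasurable W ((Measure.count : Measure ℤ).prod volume) := by
    simpa only [gam] using hW.aestronglyMeasurable
  refine ⟨forall_of_ae_count hm.prodMk_left k, ?_⟩
  have h1 : ∫⁻ η, ‖W (k, η)‖ₑ ^ 2 ≤ ∫⁻ κ, ‖W κ‖ₑ ^ 2 ∂gam := by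
    rw [lintegral_gam (hW.aestronglyMeasurable.enorm.pow_const 2)]
    exact ENNReal.le_tsum (f := fun k : ℤ => ∫⁻ η, ‖W (k, η)‖ₑ ^ 2) k
  rw [← eLpNorm_two_sq, ← eLpNorm_two_sq] at h1
  have h2 : eLpNorm W 2 gam ^ 2 < ⊤ := ENNReal.pow_lt_top hW.eLpNorm_lt_top
  have := h1.trans_lt h2
  rwa [ENNReal.pow_lt_top_iff, or_iff_left (by norm_num)] at this

end slices

theorem fourierInv_eq_integral_wave (w : ℝ → ℂ) (y : ℝ) :
    𝓕⁻ w y = ∫ η, w η * wave (0, η) (0, y) := by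
  rw [Real.fourierInv_eq]
  refine integral_congr_ae (Eventually.of_forall fun η => ?_)
  simp only [Circle.smul_def, Real.fourierChar_apply, smul_eq_mul, wave]
  rw [mul_comm]
  congr 2
  simp; ring

section synth

variable {W : Freq → ℂ}

theorem integrable_mul_wave (hW : Integrable W gam) (p : ℝ × ℝ) :
    Integrable (fun κ => W κ * wave κ p) gam := by
  refine hW.mul_bdd (c := 1) (continuous_wave_left p).aestronglyMeasurable ?_
  exact Eventually.of_forall fun κ => (norm_wave κ p).le

theorem norm_synth_le (W : Freq → ℂ) (p : ℝ × ℝ) : ‖synth W p‖ ≤ ∫ κ, ‖W κ‖ ∂gam := by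
  refine (norm_integral_le_integral_norm _).trans_eq ?_
  simp only [norm_mul, norm_wave, mul_one]

theorem continuous_synth (hW : Integrable W gam) : Continuous (synth W) := by
  refine continuous_of_dominated (bound := fun κ => ‖W κ‖)
    (fun p => (integrable_mul_wave hW p).aestronglyMeasurable) (fun p => ?_) hW.norm ?_
  · exact Eventually.of_forall fun κ => by rw [norm_mul, norm_wave, mul_one]
  · exact Eventually.of_forall fun κ => continuous_const.mul (continuous_wave_right κ)

theorem synth_periodic (W : Freq → ℂ) (x y : ℝ) : synth W (x + 1, y) = synth W (x, y) := by
  simp only [synth, wave_periodic]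

theorem synth_eq_tsum (hW : Integrable W gam) (x y : ℝ) :
    synth W (x, y) = ∑' k : ℤ, 𝓕⁻ (fun η => W (k, η)) y * wave (k, 0) (x, 0) := by
  have h := integrable_mul_wave hW (x, y)
  rw [synth]
  unfold gam at h ⊢
  rw [integral_prod _ h, integral_countable h.integral_prod_left]
  refine tsum_congr fun k => ?_
  simp only [Measure.real, Measure.count_singleton, ENNReal.toReal_one, one_smul]
  rw [fourierInv_eq_integral_wave, ← integral_mul_const]
  refine integral_congr_ae (Eventually.of_forall fun η => ?_)
  simp only [wave_split (k, η) x y]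
  ring

theorem summable_norm_fourierInv_slice (hW : Integrable W gam) (y : ℝ) :
    Summable fun k : ℤ => ‖𝓕⁻ (fun η => W (k, η)) y‖ := by
  refine (summable_slice hW).of_nonneg_of_le (fun k => norm_nonneg _) fun k => ?_
  rw [fourierInv_eq_integral_wave]
  refine (norm_integral_le_integral_norm _).trans_eq ?_
  simp only [norm_mul, norm_wave, mul_one]

theorem continuous_fourierInv {w : ℝ → ℂ} (h1 : Integrable w) : Continuous (𝓕⁻ w) :=
    VectorFourier.fourierIntegral_continuous Real.continuous_fourierChar
      (by simp only [LinearMap.neg_apply, innerₗ_apply_apply]; exact continuous_inner.neg) h1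

/-- Plancherel's theorem on `Ω`. -/
theorem eLpNorm_synth (h1 : Integrable W gam) (h2 : MemLp W 2 gam) :
    eLpNorm (synth W) 2 muOmega = eLpNorm W 2 gam := by
  have key : ∫⁻ p, ‖synth W p‖ₑ ^ 2 ∂muOmega = ∫⁻ κ, ‖W κ‖ₑ ^ 2 ∂gam := by
    rw [lintegral_gam (h2.aestronglyMeasurable.enorm.pow_const 2),
      lintegral_muOmega ((continuous_synth h1).enorm.measurable.pow_const 2).aemeasurable]
    -- Parseval in `x` is applied on every horizontal line, then Plancherel in `y` to every
    -- horizontal mode.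
    simp only [synth_eq_tsum h1]
    simp only [lintegral_enorm_sq_tsum_wave (summable_norm_fourierInv_slice h1 _)]
    rw [lintegral_tsum fun k => ((continuous_fourierInv
      (integrable_slice h1 k)).enorm.measurable.pow_const 2).aemeasurable]
    refine tsum_congr fun k => ?_
    rw [← eLpNorm_two_sq, ← eLpNorm_two_sq,
      eLpNorm_fourierInv (integrable_slice h1 k) (memLp_slice h2 k)]
  rw [← eLpNorm_two_sq, ← eLpNorm_two_sq] at key
  rw [← ENNReal.rpow_natCast, ← ENNReal.rpow_natCast] at key
  exact ENNReal.rpow_left_injective (by norm_num) key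

theorem memLp_synth (h1 : Integrable W gam) (h2 : MemLp W 2 gam) : MemLp (synth W) 2 muOmega :=
  ⟨(continuous_synth h1).aestronglyMeasurable, by
    rw [eLpNorm_synth h1 h2]; exact h2.eLpNorm_lt_top⟩

theorem synth_congr {W' : Freq → ℂ} (h : W =ᵐ[gam] W') : synth W = synth W' := by
  funext p
  refine integral_congr_ae ?_
  filter_upwards [h] with κ hκ
  rw [hκ]

theorem synth_add {W' : Freq → ℂ} (h : Integrable W gam) (h' : Integrable W' gam) (p : ℝ × ℝ) :
    synth (fun κ => W κ + W' κ) p = synth W p + synth W' p := by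
  simp only [synth, add_mul]
  exact integral_add (integrable_mul_wave h p) (integrable_mul_wave h' p)

theorem synth_const_mul (c : ℂ) (W : Freq → ℂ) (p : ℝ × ℝ) :
    synth (fun κ => c * W κ) p = c * synth W p := by
  simp only [synth, mul_assoc]
  exact integral_const_mul _ _

end synth

/-! ### The Fourier transform on `L²(Ω)`, defined by duality. -/

/-- The square integrable classes that are also integrable. -/
def lpIntegrable : Submodule ℂ (Lp ℂ 2 gam) where
  carrier := {W | Integrable W gam}
  add_mem' {a b} ha hb := (Integrable.add ha hb).congr (Lp.coeFn_add a b).symm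
  zero_mem' := (integrable_zero _ _ _).congr (Lp.coeFn_zero _ _ _).symm
  smul_mem' c a ha := (Integrable.smul c ha).congr (Lp.coeFn_smul c a).symm

/-- Simple functions in `L²` live on sets of finite measure, so they are integrable, and they are
dense. -/
theorem denseRange_lpIntegrable : DenseRange lpIntegrable.subtype := by
  have h : Dense {W : Lp ℂ 2 gam | Integrable W gam} := by
    refine (Lp.simpleFunc.dense (E := ℂ) (p := 2) (μ := gam) (by norm_num)).mono ?_
    intro W hW
    have h2 := (SimpleFunc.memLp_iff_integrable (by norm_num) (by norm_num)).1
      (Lp.simpleFunc.memLp (⟨W, hW⟩ : Lp.simpleFunc ℂ 2 gam))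
    exact h2.congr (Lp.simpleFunc.toSimpleFunc_eq_toFun (⟨W, hW⟩ : Lp.simpleFunc ℂ 2 gam))
  rw [DenseRange]
  convert! h
  exact Subtype.range_coe

/-- The inverse Fourier transform, as a linear map into `L²(Ω)`. -/
def synthLinear : lpIntegrable →ₗ[ℂ] Lp ℂ 2 muOmega where
  toFun W := (memLp_synth W.2 (Lp.memLp W.1)).toLp
  map_add' a b := by
    rw [← MemLp.toLp_add]
    refine MemLp.toLp_congr _ _ (Eventually.of_forall fun p => ?_)
    rw [Pi.add_apply, ← synth_add a.2 b.2]
    exact congrFun (synth_congr (Lp.coeFn_add a.1 b.1)) p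
  map_smul' c a := by
    rw [RingHom.id_apply, ← MemLp.toLp_const_smul]
    refine MemLp.toLp_congr _ _ (Eventually.of_forall fun p => ?_)
    rw [Pi.smul_apply, smul_eq_mul, ← synth_const_mul]
    exact congrFun (synth_congr (Lp.coeFn_smul c a.1)) p

theorem norm_synthLinear (W : lpIntegrable) : ‖synthLinear W‖ = ‖W.1‖ := by
  rw [synthLinear, LinearMap.coe_mk, AddHom.coe_mk, Lp.norm_toLp,
    eLpNorm_synth W.2 (Lp.memLp W.1), Lp.norm_def]

/-- `U` is the Fourier transform of the square integrable function `u` on `Ω`. -/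
structure IsFT (u : ℝ × ℝ → ℂ) (U : Freq → ℂ) : Prop where
  memLp_left : MemLp u 2 muOmega
  measurable : Measurable U
  memLp_right : MemLp U 2 gam
  pairing : ∀ W : Freq → ℂ, Integrable W gam → MemLp W 2 gam →
    ∫ p, conj (synth W p) * u p ∂muOmega = ∫ κ, conj (W κ) * U κ ∂gam

/-- Synthesis is a linear isometry by Plancherel, hence preserves inner products, which is the
pairing identity. -/
theorem isFT_synth {W : Freq → ℂ} (hm : Measurable W) (h1 : Integrable W gam)
    (h2 : MemLp W 2 gam) : IsFT (synth W) W := by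
  refine ⟨memLp_synth h1 h2, hm, h2, fun V hV1 hV2 => ?_⟩
  let L : lpIntegrable →ₗᵢ[ℂ] Lp ℂ 2 muOmega := ⟨synthLinear, norm_synthLinear⟩
  let V' : lpIntegrable := ⟨hV2.toLp, hV1.congr hV2.coeFn_toLp.symm⟩
  let W' : lpIntegrable := ⟨h2.toLp, h1.congr h2.coeFn_toLp.symm⟩
  have h := L.inner_map_map V' W'
  rw [Submodule.coe_inner, L2.inner_def, L2.inner_def] at h
  have e1 : ∫ p, inner ℂ (L V' p) (L W' p) ∂muOmega
      = ∫ p, conj (synth V p) * synth W p ∂muOmega := by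
    refine integral_congr_ae ?_
    filter_upwards [(memLp_synth V'.2 (Lp.memLp V'.1)).coeFn_toLp,
      (memLp_synth W'.2 (Lp.memLp W'.1)).coeFn_toLp] with p hp hp'
    have a1 : L V' p = synth V p := by
      rw [← synth_congr hV2.coeFn_toLp]; exact hp
    have a2 : L W' p = synth W p := by
      rw [← synth_congr h2.coeFn_toLp]; exact hp'
    rw [a1, a2, RCLike.inner_apply, mul_comm]
  have e2 : ∫ κ, inner ℂ (V'.1 κ) (W'.1 κ) ∂gam = ∫ κ, conj (V κ) * W κ ∂gam := by
    refine integral_congr_ae ?_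
    filter_upwards [hV2.coeFn_toLp, h2.coeFn_toLp] with κ hκ hκ'
    have a1 : V'.1 κ = V κ := hκ
    have a2 : W'.1 κ = W κ := hκ'
    rw [a1, a2, RCLike.inner_apply, mul_comm]
  rw [← e1, ← e2, h]

/-- Every square integrable function has a Fourier transform. -/
theorem exists_isFT {u : ℝ × ℝ → ℂ} (hu : MemLp u 2 muOmega) :
    ∃ U, IsFT u U ∧ eLpNorm U 2 gam ≤ eLpNorm u 2 muOmega := by
  let T : Lp ℂ 2 gam →L[ℂ] Lp ℂ 2 muOmega := synthLinear.extendOfNorm lpIntegrable.subtype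
  have hb : ∀ W : lpIntegrable, ‖synthLinear W‖ ≤ 1 * ‖lpIntegrable.subtype W‖ := fun W => by
    rw [one_mul, norm_synthLinear]; rfl
  have hT : ‖T‖ ≤ 1 :=
    LinearMap.opNorm_extendOfNorm_le denseRange_lpIntegrable zero_le_one hb
  -- The Fourier transform is the adjoint of synthesis extended by density. The pairing identity is
  -- then the definition of the adjoint, and the norm bound is `‖T‖ ≤ 1`.
  let A := ContinuousLinearMap.adjoint T
  have hA : ‖A hu.toLp‖ ≤ ‖hu.toLp‖ := by
    refine (A.le_opNorm _).trans ?_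
    rw [LinearIsometryEquiv.norm_map]
    exact mul_le_of_le_one_left (norm_nonneg _) hT
  refine ⟨A hu.toLp, ⟨hu, (Lp.stronglyMeasurable _).measurable, Lp.memLp _, fun W h1 h2 => ?_⟩, ?_⟩
  · let W' : lpIntegrable := ⟨h2.toLp, h1.congr h2.coeFn_toLp.symm⟩
    have h := ContinuousLinearMap.adjoint_inner_right T W'.1 hu.toLp
    have hTW : T W'.1 = synthLinear W' :=
      LinearMap.extendOfNorm_eq denseRange_lpIntegrable ⟨1, hb⟩ W'
    rw [hTW, L2.inner_def, L2.inner_def] at h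
    have e1 : ∫ p, inner ℂ (synthLinear W' p) ((hu.toLp u : Lp ℂ 2 muOmega) p) ∂muOmega
        = ∫ p, conj (synth W p) * u p ∂muOmega := by
      refine integral_congr_ae ?_
      filter_upwards [(memLp_synth W'.2 (Lp.memLp W'.1)).coeFn_toLp, hu.coeFn_toLp] with p hp hp'
      have a2 : synthLinear W' p = synth W p := by
        rw [← synth_congr h2.coeFn_toLp]; exact hp
      rw [a2, hp', RCLike.inner_apply, mul_comm]
    have e2 : ∫ κ, inner ℂ (W'.1 κ) (A (hu.toLp u) κ) ∂gam = ∫ κ, conj (W κ) * A (hu.toLp u) κ ∂gam := by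
      refine integral_congr_ae ?_
      filter_upwards [h2.coeFn_toLp] with κ hκ
      have a2 : W'.1 κ = W κ := hκ
      rw [a2, RCLike.inner_apply, mul_comm]
    rw [← e1, ← e2]; exact h.symm
  · rw [Lp.norm_def, Lp.norm_toLp] at hA
    exact (ENNReal.toReal_le_toReal (Lp.eLpNorm_ne_top _) hu.eLpNorm_ne_top).1 hA

/-- Indicators of sets of finite measure are admissible test functions and determine a function on a
σ-finite space. -/
theorem ae_eq_of_pairing_eq {D D' : Freq → ℂ} (hD : MemLp D 2 gam) (hD' : MemLp D' 2 gam)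
    (h : ∀ W : Freq → ℂ, Integrable W gam → MemLp W 2 gam →
      ∫ κ, conj (W κ) * D κ ∂gam = ∫ κ, conj (W κ) * D' κ ∂gam) : D =ᵐ[gam] D' := by
  have hloc : ∀ {G : Freq → ℂ}, MemLp G 2 gam → ∀ s, gam s < ⊤ → IntegrableOn G s gam := by
    intro G hG s hs
    have : IsFiniteMeasure (gam.restrict s) := ⟨by simpa using hs⟩
    exact (hG.restrict s).integrable (by norm_num)
  have h0 : D - D' =ᵐ[gam] 0 := by
    refine ae_eq_zero_of_forall_setIntegral_eq_of_sigmaFinite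
      (fun s _ hs => hloc (hD.sub hD') s hs) fun s hm hs => ?_
    have := h (s.indicator fun _ => 1) ((integrable_indicator_iff hm).2
      (integrableOn_const hs.ne)) (memLp_indicator_const 2 hm 1 (Or.inr hs.ne))
    have e : ∀ G : Freq → ℂ, ∫ κ, conj (s.indicator (fun _ => (1 : ℂ)) κ) * G κ ∂gam
        = ∫ κ in s, G κ ∂gam := fun G => by
      rw [← integral_indicator hm]
      congr 1; funext κ
      by_cases hκ : κ ∈ s <;> simp [hκ]
    rw [e, e] at this
    simp only [Pi.sub_apply]
    rw [integral_sub (hloc hD s hs) (hloc hD' s hs), this, sub_self]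
  filter_upwards [h0] with κ hκ
  simpa [sub_eq_zero] using hκ

theorem integrable_conj_mul {α : Type*} [MeasurableSpace α] {μ : Measure α} {f g : α → ℂ}
    (hf : MemLp f 2 μ) (hg : MemLp g 2 μ) : Integrable (fun x => conj (f x) * g x) μ :=
  hf.star.integrable_mul hg

namespace IsFT

variable {u v : ℝ × ℝ → ℂ} {U V : Freq → ℂ}

theorem ae_unique (hU : IsFT u U) (hV : IsFT u V) : U =ᵐ[gam] V :=
  ae_eq_of_pairing_eq hU.memLp_right hV.memLp_right fun W h1 h2 => by
    rw [← hU.pairing W h1 h2, hV.pairing W h1 h2]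

theorem eLpNorm_le (hU : IsFT u U) : eLpNorm U 2 gam ≤ eLpNorm u 2 muOmega := by
  obtain ⟨V, hV, hle⟩ := exists_isFT hU.memLp_left
  rwa [eLpNorm_congr_ae (hU.ae_unique hV)]

theorem congr_right (hU : IsFT u U) (hV : Measurable V) (h : U =ᵐ[gam] V) : IsFT u V := by
  refine ⟨hU.memLp_left, hV, (memLp_congr_ae h).1 hU.memLp_right, fun W h1 h2 => ?_⟩
  rw [hU.pairing W h1 h2]
  refine integral_congr_ae ?_
  filter_upwards [h] with p hp
  rw [hp]

theorem sub (hU : IsFT u U) (hV : IsFT v V) :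
    IsFT (fun p => u p - v p) (fun κ => U κ - V κ) := by
  refine ⟨hU.memLp_left.sub hV.memLp_left, hU.measurable.sub hV.measurable,
    hU.memLp_right.sub hV.memLp_right, fun W h1 h2 => ?_⟩
  have hW := memLp_synth h1 h2
  simp only [mul_sub]
  rw [integral_sub (integrable_conj_mul hW hU.memLp_left) (integrable_conj_mul hW hV.memLp_left),
    integral_sub (integrable_conj_mul h2 hU.memLp_right) (integrable_conj_mul h2 hV.memLp_right),
    hU.pairing W h1 h2, hV.pairing W h1 h2]

end IsFT

theorem integrable_slab {u : ℝ × ℝ → ℂ} (hu : MemLp u 2 muOmega) {K : Set ℝ} (hK : IsCompact K) :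
    Integrable u ((volume.restrict (Set.Ioc (0 : ℝ) 1)).prod (volume.restrict K)) := by
  have h : (volume.restrict (Set.Ioc (0 : ℝ) 1)).prod (volume.restrict K)
      = muOmega.restrict (Set.univ ×ˢ K) := by
    rw [muOmega_eq_prod, ← Measure.prod_restrict, Measure.restrict_univ]
  have : IsFiniteMeasure (volume.restrict K) := ⟨by simpa using hK.measure_lt_top⟩
  have h2 : MemLp u 2 ((volume.restrict (Set.Ioc (0 : ℝ) 1)).prod (volume.restrict K)) := by
    rw [h]; exact hu.restrict _
  exact h2.integrable (by norm_num)

/-- The function `δ_k ⊗ w` of the frequency. -/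
def deltaMul (k : ℤ) (w : ℝ → ℂ) (κ : Freq) : ℂ := if κ.1 = k then w κ.2 else 0

theorem integrable_deltaMul (k : ℤ) {w : ℝ → ℂ} (hm : Measurable w) (hw : Integrable w) :
    Integrable (deltaMul k w) gam := by
  have hmeas : Measurable (deltaMul k w) :=
    Measurable.ite (measurable_fst (measurableSet_singleton k)) (hm.comp measurable_snd)
      measurable_const
  refine ⟨hmeas.aestronglyMeasurable, ?_⟩
  rw [HasFiniteIntegral, lintegral_gam hmeas.enorm.aemeasurable,
    tsum_eq_single k fun j hj => by simp [deltaMul, hj]]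
  simpa [deltaMul, HasFiniteIntegral] using hw.2

theorem memLp_deltaMul (k : ℤ) {w : ℝ → ℂ} (hm : Measurable w) (hw : MemLp w 2 volume) :
    MemLp (deltaMul k w) 2 gam := by
  have hmeas : Measurable (deltaMul k w) :=
    Measurable.ite (measurable_fst (measurableSet_singleton k)) (hm.comp measurable_snd)
      measurable_const
  refine ⟨hmeas.aestronglyMeasurable, ?_⟩
  rw [← or_iff_left (a := eLpNorm (deltaMul k w) 2 gam < ⊤) (b := (2 = 0)) (by norm_num),
    ← ENNReal.pow_lt_top_iff, eLpNorm_two_sq,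
    lintegral_gam (hmeas.enorm.pow_const 2).aemeasurable,
    tsum_eq_single k fun j hj => by simp [deltaMul, hj]]
  simp only [deltaMul, if_true]
  rw [← eLpNorm_two_sq]
  exact ENNReal.pow_lt_top hw.2

theorem synth_deltaMul (k : ℤ) {w : ℝ → ℂ} (hm : Measurable w) (hw : Integrable w) (x y : ℝ) :
    synth (deltaMul k w) (x, y) = 𝓕⁻ w y * wave (k, 0) (x, 0) := by
  rw [synth_eq_tsum (integrable_deltaMul k hm hw), tsum_eq_single k]
  · simp [deltaMul]
  · intro j hj
    have : (fun η : ℝ => deltaMul k w (j, η)) = fun _ => 0 := by funext η; simp [deltaMul, hj]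
    rw [this, fourierInv_eq_integral_wave]
    simp

/-- If the Fourier transform vanishes on `{k} × ℝ`, so does the `k`-th Fourier coefficient in `x`. -/
theorem IsFT.coeff_eq_zero {u : ℝ × ℝ → ℂ} {U : Freq → ℂ} (hU : IsFT u U) (k : ℤ)
    (hk : ∀ᵐ κ ∂gam, κ.1 = k → U κ = 0) :
    ∀ᵐ y, ∫ x in (0 : ℝ)..1, conj (wave (k, 0) (x, 0)) * u (x, y) = 0 := by
  simp only [intervalIntegral.integral_of_le zero_le_one]
  have hwc : Continuous fun p : ℝ × ℝ => conj (wave (k, 0) (p.1, 0)) :=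
    Complex.continuous_conj.comp ((continuous_wave_right _).comp (by fun_prop))
  refine ae_eq_zero_of_integral_contDiff_smul_eq_zero ?_ fun g hg hgc => ?_
  · rw [locallyIntegrable_iff]
    intro K hK
    have h1 := integrable_slab hU.memLp_left hK
    have h2 := h1.bdd_mul (c := 1) hwc.aestronglyMeasurable
      (Eventually.of_forall fun p => by rw [RCLike.norm_conj, norm_wave])
    exact h2.integral_prod_right
  · let φ : 𝓢(ℝ, ℂ) := HasCompactSupport.toSchwartzMap (f := fun x => (g x : ℂ))
      (hgc.comp_left (g := fun x : ℝ => (x : ℂ)) (by simp)) (Complex.ofRealCLM.contDiff.comp hg)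
    have hφ : ∀ x, φ x = g x := fun _ => rfl
    -- With this `w`, synthesis of `deltaMul k w` is `g(y) e^{2πikx}`, whose pairing with `u` is the
    -- integral of `g` against the `k`-th coefficient.
    let w : 𝓢(ℝ, ℂ) := 𝓕 φ
    have hw1 : Integrable w := w.integrable
    have hw2 : MemLp w 2 volume := w.memLp 2
    have hwm : Measurable w := w.continuous.measurable
    have hwφ : 𝓕⁻ (w : ℝ → ℂ) = φ := by
      rw [← SchwartzMap.fourierInv_coe]
      congr 1
      exact FourierTransform.fourierInv_fourier_eq φ
    have hi1 := integrable_deltaMul k hwm hw1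
    have hi2 := memLp_deltaMul k hwm hw2
    have hp := hU.pairing _ hi1 hi2
    have hz : ∫ κ, conj (deltaMul k w κ) * U κ ∂gam = 0 := by
      refine integral_eq_zero_of_ae ?_
      filter_upwards [hk] with κ hκ
      by_cases h : κ.1 = k
      · simp [hκ h]
      · simp [deltaMul, h]
    have hint := integrable_conj_mul (memLp_synth hi1 hi2) hU.memLp_left
    rw [hz] at hp
    rw [muOmega_eq_prod] at hp hint
    rw [integral_prod_symm _ hint] at hp
    rw [← hp]
    refine integral_congr_ae (Eventually.of_forall fun y => ?_)
    simp only [Complex.real_smul, ← integral_const_mul]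
    refine integral_congr_ae (Eventually.of_forall fun x => ?_)
    simp only [synth_deltaMul k hwm hw1, hwφ, hφ, map_mul, Complex.conj_ofReal]
    ring

theorem memLp_two_of_lintegral {α : Type*} [MeasurableSpace α] {μ : Measure α} {f : α → ℂ}
    (hf : AEStronglyMeasurable f μ) (h : ∫⁻ x, ‖f x‖ₑ ^ 2 ∂μ < ⊤) : MemLp f 2 μ := by
  refine ⟨hf, ?_⟩
  rw [← eLpNorm_two_sq, ENNReal.pow_lt_top_iff] at h
  exact h.resolve_right (by norm_num)

theorem lintegral_enorm_sq_lt_top {α E : Type*} [MeasurableSpace α] [NormedAddCommGroup E]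
    {μ : Measure α} {f : α → E} (hf : MemLp f 2 μ) : ∫⁻ x, ‖f x‖ₑ ^ 2 ∂μ < ⊤ := by
  rw [← eLpNorm_two_sq]; exact ENNReal.pow_lt_top hf.2

/-- A function whose Fourier transform vanishes is zero. -/
theorem IsFT.ae_eq_zero {u : ℝ × ℝ → ℂ} {U : Freq → ℂ} (hU : IsFT u U) (h0 : U =ᵐ[gam] 0) :
    u =ᵐ[muOmega] 0 := by
  -- There are countably many modes, so on almost every horizontal line all Fourier coefficients of
  -- `u` vanish, and Parseval on that line gives `u = 0`.
  have hc : ∀ᵐ y, ∀ k : ℤ, ∫ x in (0 : ℝ)..1, conj (wave (k, 0) (x, 0)) * u (x, y) = 0 :=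
    ae_all_iff.2 fun k => hU.coeff_eq_zero k (by filter_upwards [h0] with κ hκ _; exact hκ)
  have hu := hU.memLp_left
  have hfin := lintegral_enorm_sq_lt_top hu
  have hum : AEStronglyMeasurable u ((volume.restrict (Set.Ioc (0 : ℝ) 1)).prod volume) := by
    rw [← muOmega_eq_prod]; exact hu.1
  have hsw : AEStronglyMeasurable (fun q : ℝ × ℝ => u q.swap)
      (volume.prod (volume.restrict (Set.Ioc (0 : ℝ) 1))) := hum.prod_swap
  rw [lintegral_muOmega (hu.1.enorm.pow_const 2)] at hfin
  have hmeas : AEMeasurable (fun y => ∫⁻ x in Set.Ioc (0 : ℝ) 1, ‖u (x, y)‖ₑ ^ 2) volume :=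
    (hsw.enorm.pow_const 2).lintegral_prod_right'
  have hae := ae_lt_top' hmeas hfin.ne
  have hz : ∀ᵐ y, ∫⁻ x in Set.Ioc (0 : ℝ) 1, ‖u (x, y)‖ₑ ^ 2 = 0 := by
    filter_upwards [hc, hae, hsw.prodMk_left] with y hy hy' hy2
    have hm : MemLp (fun x => u (x, y)) 2 (volume.restrict (Set.Ioc 0 1)) :=
      memLp_two_of_lintegral hy2 hy'
    rw [lintegral_enorm_sq_unit hm]
    simp [hy]
  have : ∫⁻ p, ‖u p‖ₑ ^ 2 ∂muOmega = 0 := by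
    rw [lintegral_muOmega (hu.1.enorm.pow_const 2), lintegral_congr_ae hz, lintegral_zero]
  rw [lintegral_eq_zero_iff' (hu.1.enorm.pow_const 2)] at this
  filter_upwards [this] with p hp
  simpa using hp

/-- Fourier inversion. -/
theorem IsFT.ae_eq_synth {u : ℝ × ℝ → ℂ} {U : Freq → ℂ} (hU : IsFT u U) (h1 : Integrable U gam) :
    u =ᵐ[muOmega] synth U := by
  have := (hU.sub (isFT_synth hU.measurable h1 hU.memLp_right)).ae_eq_zero
    (Eventually.of_forall fun κ => by simp)
  filter_upwards [this] with p hp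
  simpa [sub_eq_zero] using hp

/-! ### Derivatives as multiplication by `dsym`. -/

section derivative

/-- The exponent of `wave κ`, as a linear map. -/
def waveExponent (κ : Freq) : ℝ × ℝ →L[ℝ] ℂ :=
  (ContinuousLinearMap.fst ℝ ℝ ℝ).smulRight (2 * Real.pi * Complex.I * κ.1 : ℂ) +
    (ContinuousLinearMap.snd ℝ ℝ ℝ).smulRight (2 * Real.pi * Complex.I * κ.2 : ℂ)

theorem waveExponent_apply (κ : Freq) (p : ℝ × ℝ) : waveExponent κ p =
    p.1 * (2 * Real.pi * Complex.I * κ.1 : ℂ) + p.2 * (2 * Real.pi * Complex.I * κ.2 : ℂ) := by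
  simp [waveExponent]

theorem wave_eq_exp (κ : Freq) (p : ℝ × ℝ) : wave κ p = Complex.exp (waveExponent κ p) := by
  rw [waveExponent_apply, wave]
  congr 1; push_cast; ring

theorem hasFDerivAt_wave (κ : Freq) (p : ℝ × ℝ) :
    HasFDerivAt (wave κ) (wave κ p • waveExponent κ) p := by
  have h : wave κ = fun p => Complex.exp (waveExponent κ p) := funext (wave_eq_exp κ)
  rw [wave_eq_exp, h]
  exact (waveExponent κ).hasFDerivAt.cexp

theorem norm_waveExponent_le (κ : Freq) :
    ‖waveExponent κ‖ ≤ 2 * Real.pi * (‖(κ.1 : ℂ)‖ + ‖(κ.2 : ℂ)‖) := by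
  have h0 := Real.pi_pos
  refine ContinuousLinearMap.opNorm_le_bound _ (by positivity) fun p => ?_
  rw [waveExponent_apply]
  refine (norm_add_le _ _).trans ?_
  simp only [norm_mul, Complex.norm_I, Complex.norm_real, RCLike.norm_ofNat, mul_one,
    Real.norm_of_nonneg h0.le]
  have h1 : ‖p.1‖ ≤ ‖p‖ := norm_fst_le p
  have h2 : ‖p.2‖ ≤ ‖p‖ := norm_snd_le p
  calc _ ≤ ‖p‖ * (2 * Real.pi * ‖(κ.1 : ℂ)‖) + ‖p‖ * (2 * Real.pi * ‖κ.2‖) := by gcongr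
    _ = _ := by ring

theorem measurable_freq_fst : Measurable fun κ : Freq => (κ.1 : ℂ) :=
  (measurable_from_top (f := fun k : ℤ => (k : ℂ))).comp measurable_fst

theorem measurable_freq_snd : Measurable fun κ : Freq => (κ.2 : ℂ) :=
  Complex.measurable_ofReal.comp measurable_snd

/-- The Fourier symbols of the two partial derivatives. -/
def dsym (i : Fin 2) (κ : Freq) : ℂ :=
  if i = 0 then 2 * Real.pi * Complex.I * κ.1 else 2 * Real.pi * Complex.I * κ.2

theorem dsym_zero (κ : Freq) : dsym 0 κ = 2 * Real.pi * Complex.I * κ.1 := by simp [dsym]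

theorem dsym_one (κ : Freq) : dsym 1 κ = 2 * Real.pi * Complex.I * κ.2 := by simp [dsym]

theorem measurable_dsym (i : Fin 2) : Measurable (dsym i) := by
  unfold dsym
  split_ifs
  · exact measurable_const.mul measurable_freq_fst
  · exact measurable_const.mul measurable_freq_snd

theorem conj_dsym (i : Fin 2) (κ : Freq) : conj (dsym i κ) = -dsym i κ := by
  have h2 : conj (2 : ℂ) = 2 := map_ofNat _ 2
  unfold dsym
  split_ifs <;> simp [h2]

variable {W : Freq → ℂ}

theorem hasFDerivAt_synth (hW : Integrable W gam)
    (h : ∀ i, Integrable (fun κ => dsym i κ * W κ) gam) (p : ℝ × ℝ) :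
    HasFDerivAt (synth W)
      ((ContinuousLinearMap.fst ℝ ℝ ℝ).smulRight (synth (fun κ => dsym 0 κ * W κ) p) +
        (ContinuousLinearMap.snd ℝ ℝ ℝ).smulRight (synth (fun κ => dsym 1 κ * W κ) p)) p := by
  have hpi := Real.pi_pos
  have hexp : ∀ κ, waveExponent κ = (ContinuousLinearMap.fst ℝ ℝ ℝ).smulRight (dsym 0 κ) +
      (ContinuousLinearMap.snd ℝ ℝ ℝ).smulRight (dsym 1 κ) := fun κ => by
    rw [dsym_zero, dsym_one]; rfl
  have hb : Integrable (fun κ => ‖dsym 0 κ * W κ‖ + ‖dsym 1 κ * W κ‖) gam :=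
    (h 0).norm.add (h 1).norm
  have hF' : ∀ κ p, (W κ * wave κ p) • waveExponent κ =
      (ContinuousLinearMap.fst ℝ ℝ ℝ).smulRight (dsym 0 κ * W κ * wave κ p) +
        (ContinuousLinearMap.snd ℝ ℝ ℝ).smulRight (dsym 1 κ * W κ * wave κ p) := fun κ p => by
    rw [hexp]
    ext <;> simp <;> ring
  have hi0 := integrable_mul_wave (h 0) p
  have hi1 := integrable_mul_wave (h 1) p
  have hm : ∀ (L : ℝ × ℝ →L[ℝ] ℝ) (g : Freq → ℂ), Integrable g gam →
      AEStronglyMeasurable (fun κ => L.smulRight (g κ)) gam := fun L g hg =>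
    ((ContinuousLinearMap.smulRightL ℝ (ℝ × ℝ) ℂ L).integrable_comp hg).aestronglyMeasurable
  have hn : ∀ κ q, ‖(W κ * wave κ q) • waveExponent κ‖ ≤ ‖dsym 0 κ * W κ‖ + ‖dsym 1 κ * W κ‖ :=
    fun κ q => by
    rw [norm_smul, norm_mul, norm_wave, mul_one]
    refine (mul_le_mul_of_nonneg_left (norm_waveExponent_le κ) (norm_nonneg _)).trans_eq ?_
    rw [dsym_zero, dsym_one]
    simp only [norm_mul, Complex.norm_I, Complex.norm_real, RCLike.norm_ofNat, mul_one,
      Real.norm_of_nonneg hpi.le]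
    ring
  have hint : Integrable (fun κ => (W κ * wave κ p) • waveExponent κ) gam := by
    refine hb.mono' ?_ (Eventually.of_forall fun κ => hn κ p)
    simp only [hF']
    exact (hm _ _ hi0).add (hm _ _ hi1)
  have hval : ∫ κ, (W κ * wave κ p) • waveExponent κ ∂gam =
      (ContinuousLinearMap.fst ℝ ℝ ℝ).smulRight (synth (fun κ => dsym 0 κ * W κ) p) +
        (ContinuousLinearMap.snd ℝ ℝ ℝ).smulRight (synth (fun κ => dsym 1 κ * W κ) p) := by
    refine ContinuousLinearMap.ext fun v => ?_
    rw [ContinuousLinearMap.integral_apply hint]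
    simp only [hF', _root_.add_apply, ContinuousLinearMap.smulRight_apply]
    have b0 := hi0.smul ((ContinuousLinearMap.fst ℝ ℝ ℝ) v)
    have b1 := hi1.smul ((ContinuousLinearMap.snd ℝ ℝ ℝ) v)
    simp only [Pi.smul_def] at b0 b1
    rw [integral_add b0 b1, integral_smul, integral_smul]
    rfl
  have key := hasFDerivAt_integral_of_dominated_of_fderiv_le (𝕜 := ℝ) (μ := gam)
    (F := fun p κ => W κ * wave κ p) (F' := fun p κ => (W κ * wave κ p) • waveExponent κ)
    (x₀ := p) (s := Set.univ) (bound := fun κ => ‖dsym 0 κ * W κ‖ + ‖dsym 1 κ * W κ‖) univ_mem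
    (Eventually.of_forall fun q => (integrable_mul_wave hW q).aestronglyMeasurable)
    (integrable_mul_wave hW p) hint.aestronglyMeasurable
    (Eventually.of_forall fun κ q _ => hn κ q) hb
    (Eventually.of_forall fun κ q _ => ?_)
  · rw [← hval]; exact key
  · have := (hasFDerivAt_wave κ q).const_mul (W κ)
    rwa [smul_smul] at this

theorem d1_synth (hW : Integrable W gam) (h : ∀ i, Integrable (fun κ => dsym i κ * W κ) gam)
    (p : ℝ × ℝ) : d1 (synth W) p = synth (fun κ => dsym 0 κ * W κ) p := by
  rw [d1, (hasFDerivAt_synth hW h p).fderiv]; simp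

theorem d2_synth (hW : Integrable W gam) (h : ∀ i, Integrable (fun κ => dsym i κ * W κ) gam)
    (p : ℝ × ℝ) : d2 (synth W) p = synth (fun κ => dsym 1 κ * W κ) p := by
  rw [d2, (hasFDerivAt_synth hW h p).fderiv]; simp

end derivative

section byParts

variable {u v : ℝ × ℝ → ℂ}

theorem hasDerivAt_fst (hu : Differentiable ℝ u) (x y : ℝ) :
    HasDerivAt (fun x => u (x, y)) (d1 u (x, y)) x :=
  (hu (x, y)).hasFDerivAt.comp_hasDerivAt x ((hasDerivAt_id x).prodMk (hasDerivAt_const x y))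

theorem hasDerivAt_snd (hu : Differentiable ℝ u) (x y : ℝ) :
    HasDerivAt (fun y => u (x, y)) (d2 u (x, y)) y :=
  (hu (x, y)).hasFDerivAt.comp_hasDerivAt y ((hasDerivAt_const y x).prodMk (hasDerivAt_id y))

theorem integral_conj_mul_d1 (hv : Differentiable ℝ v) (hvc : Continuous (d1 v))
    (hvp : ∀ x y, v (x + 1, y) = v (x, y)) (hv2 : MemLp v 2 muOmega) (hdv : MemLp (d1 v) 2 muOmega)
    (hu : Differentiable ℝ u) (huc : Continuous (d1 u))
    (hup : ∀ x y, u (x + 1, y) = u (x, y)) (hu2 : MemLp u 2 muOmega)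
    (hdu : MemLp (d1 u) 2 muOmega) :
    ∫ p, conj (v p) * d1 u p ∂muOmega = -∫ p, conj (d1 v p) * u p ∂muOmega := by
  have i1 := integrable_conj_mul hv2 hdu
  have i2 := integrable_conj_mul hdv hu2
  rw [muOmega_eq_prod] at i1 i2 ⊢
  rw [integral_prod_symm _ i1, integral_prod_symm _ i2, ← integral_neg]
  refine integral_congr_ae (Eventually.of_forall fun y => ?_)
  simp only [← intervalIntegral.integral_of_le (zero_le_one' ℝ)]
  have c1 : Continuous fun x : ℝ => ((x, y) : ℝ × ℝ) := by fun_prop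
  rw [intervalIntegral.integral_mul_deriv_eq_deriv_mul
    (u := fun x => conj (v (x, y))) (u' := fun x => conj (d1 v (x, y)))
    (v := fun x => u (x, y)) (v' := fun x => d1 u (x, y))
    (fun x _ => (hasDerivAt_fst hv x y).star) (fun x _ => hasDerivAt_fst hu x y)
    ((Complex.continuous_conj.comp (hvc.comp c1)).intervalIntegrable _ _)
    ((huc.comp c1).intervalIntegrable _ _)]
  have e1 := hup 0 y
  have e2 := hvp 0 y
  rw [zero_add] at e1 e2
  rw [e1, e2]; ring

/-- For almost every `x` the product and both parts of its derivative are integrable in `y`, so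
infinity contributes nothing. -/
theorem integral_conj_mul_d2 (hv : Differentiable ℝ v)
    (hv2 : MemLp v 2 muOmega) (hdv : MemLp (d2 v) 2 muOmega)
    (hu : Differentiable ℝ u) (hu2 : MemLp u 2 muOmega) (hdu : MemLp (d2 u) 2 muOmega) :
    ∫ p, conj (v p) * d2 u p ∂muOmega = -∫ p, conj (d2 v p) * u p ∂muOmega := by
  have i1 := integrable_conj_mul hv2 hdu
  have i2 := integrable_conj_mul hdv hu2
  have i3 := integrable_conj_mul hv2 hu2
  rw [muOmega_eq_prod] at i1 i2 i3 ⊢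
  rw [integral_prod _ i1, integral_prod _ i2, ← integral_neg]
  refine integral_congr_ae ?_
  filter_upwards [i1.prod_right_ae, i2.prod_right_ae, i3.prod_right_ae] with x h1 h2 h3
  exact integral_mul_deriv_eq_deriv_mul_of_integrable
    (u := fun y => conj (v (x, y))) (u' := fun y => conj (d2 v (x, y)))
    (v := fun y => u (x, y)) (v' := fun y => d2 u (x, y))
    (fun y _ => (hasDerivAt_snd hv x y).star) (fun y _ => hasDerivAt_snd hu x y) h1 h2 h3

end byParts

/-- A weight that makes a function of the frequency decay. -/
def wt (κ : Freq) : ℝ := (1 + ‖dsym 0 κ‖ + ‖dsym 1 κ‖)⁻¹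

theorem measurable_wt : Measurable wt :=
  ((measurable_const.add (measurable_dsym 0).norm).add (measurable_dsym 1).norm).inv

theorem norm_wt_le (κ : Freq) : ‖(wt κ : ℂ)‖ ≤ 1 := by
  have : 0 < 1 + ‖dsym 0 κ‖ + ‖dsym 1 κ‖ := by positivity
  rw [Complex.norm_real, wt, norm_inv, Real.norm_of_nonneg this.le]
  exact inv_le_one_of_one_le₀ (by linarith [norm_nonneg (dsym 0 κ), norm_nonneg (dsym 1 κ)])

theorem norm_dsym_mul_wt_le (i : Fin 2) (κ : Freq) : ‖dsym i κ * (wt κ : ℂ)‖ ≤ 1 := by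
  have : 0 < 1 + ‖dsym 0 κ‖ + ‖dsym 1 κ‖ := by positivity
  rw [norm_mul, Complex.norm_real, wt, norm_inv, Real.norm_of_nonneg this.le,
    ← div_eq_mul_inv, div_le_one this]
  fin_cases i <;> simp <;> linarith [norm_nonneg (dsym 0 κ), norm_nonneg (dsym 1 κ)]

theorem integrable_bdd_mul_left {c W : Freq → ℂ} (hc : Measurable c) {M : ℝ} (hb : ∀ κ, ‖c κ‖ ≤ M)
    (hW : Integrable W gam) : Integrable (fun κ => c κ * W κ) gam :=
  hW.bdd_mul hc.aestronglyMeasurable (Eventually.of_forall hb)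

theorem memLp_bdd_mul_left {c W : Freq → ℂ} (hc : Measurable c) {M : ℝ} (hb : ∀ κ, ‖c κ‖ ≤ M)
    (hW : MemLp W 2 gam) : MemLp (fun κ => c κ * W κ) 2 gam :=
  MemLp.of_le_mul hW (hc.aestronglyMeasurable.mul hW.1)
    (Eventually.of_forall fun κ => by
      rw [norm_mul]; exact mul_le_mul_of_nonneg_right (hb κ) (norm_nonneg _))

/-- The product `dsym i * U` is not known to be square integrable in advance. Multiplying by the
weight `wt` makes both sides square integrable and every `wt * Z` an admissible test function; the
weight is positive and cancels at the end. -/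
theorem ae_eq_dsym_mul {U U' : Freq → ℂ} (i : Fin 2) (hU : MemLp U 2 gam) (hU' : MemLp U' 2 gam)
    (h : ∀ W : Freq → ℂ, Integrable W gam → MemLp W 2 gam →
      (∀ i, Integrable (fun κ => dsym i κ * W κ) gam) →
      (∀ i, MemLp (fun κ => dsym i κ * W κ) 2 gam) →
      ∫ κ, conj (W κ) * U' κ ∂gam = -∫ κ, conj (dsym i κ * W κ) * U κ ∂gam) :
    U' =ᵐ[gam] fun κ => dsym i κ * U κ := by
  have hwm : Measurable fun κ => (wt κ : ℂ) := Complex.measurable_ofReal.comp measurable_wt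
  have key : (fun κ => (wt κ : ℂ) * U' κ) =ᵐ[gam] fun κ => (dsym i κ * wt κ) * U κ := by
    refine ae_eq_of_pairing_eq (memLp_bdd_mul_left hwm norm_wt_le hU')
      (memLp_bdd_mul_left ((measurable_dsym i).mul hwm) (norm_dsym_mul_wt_le i) hU)
      fun Z hZ1 hZ2 => ?_
    have := h (fun κ => wt κ * Z κ) (integrable_bdd_mul_left hwm norm_wt_le hZ1)
      (memLp_bdd_mul_left hwm norm_wt_le hZ2)
      (fun i => by
        simp only [← mul_assoc]
        exact integrable_bdd_mul_left ((measurable_dsym i).mul hwm) (norm_dsym_mul_wt_le i) hZ1)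
      (fun i => by
        simp only [← mul_assoc]
        exact memLp_bdd_mul_left ((measurable_dsym i).mul hwm) (norm_dsym_mul_wt_le i) hZ2)
    rw [← integral_neg] at this
    convert this using 3 with κ κ
    · rw [map_mul, Complex.conj_ofReal]; ring
    · rw [map_mul, map_mul, Complex.conj_ofReal, conj_dsym]; ring
  filter_upwards [key] with κ hκ
  have hpos : (wt κ : ℂ) ≠ 0 := by
    have : 0 < 1 + ‖dsym 0 κ‖ + ‖dsym 1 κ‖ := by positivity
    exact_mod_cast (inv_pos.2 this).ne'
  refine mul_left_cancel₀ hpos ?_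
  rw [hκ]; ring

namespace IsFT

variable {u : ℝ × ℝ → ℂ} {U U' : Freq → ℂ}

theorem d1_ae_eq (hu : ContDiff ℝ 1 u) (hup : ∀ x y, u (x + 1, y) = u (x, y)) (hU : IsFT u U)
    (hU' : IsFT (d1 u) U') : U' =ᵐ[gam] fun κ => dsym 0 κ * U κ := by
  refine ae_eq_dsym_mul 0 hU.memLp_right hU'.memLp_right fun W h1 h2 h3 h4 => ?_
  have e : d1 (synth W) = synth fun κ => dsym 0 κ * W κ := funext (d1_synth h1 h3)
  rw [← hU'.pairing W h1 h2, ← hU.pairing _ (h3 0) (h4 0), ← e]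
  refine integral_conj_mul_d1 (fun p => (hasFDerivAt_synth h1 h3 p).differentiableAt)
    (by rw [e]; exact continuous_synth (h3 0)) (synth_periodic W) (memLp_synth h1 h2)
    (by rw [e]; exact memLp_synth (h3 0) (h4 0)) (hu.differentiable (by norm_num)) ?_ hup
    hU.memLp_left hU'.memLp_left
  exact (hu.continuous_fderiv (by norm_num)).clm_apply continuous_const

theorem d2_ae_eq (hu : ContDiff ℝ 1 u) (hU : IsFT u U)
    (hU' : IsFT (d2 u) U') : U' =ᵐ[gam] fun κ => dsym 1 κ * U κ := by
  refine ae_eq_dsym_mul 1 hU.memLp_right hU'.memLp_right fun W h1 h2 h3 h4 => ?_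
  have e : d2 (synth W) = synth fun κ => dsym 1 κ * W κ := funext (d2_synth h1 h3)
  rw [← hU'.pairing W h1 h2, ← hU.pairing _ (h3 1) (h4 1), ← e]
  exact integral_conj_mul_d2 (fun p => (hasFDerivAt_synth h1 h3 p).differentiableAt)
    (memLp_synth h1 h2) (by rw [e]; exact memLp_synth (h3 1) (h4 1))
    (hu.differentiable (by norm_num)) hU.memLp_left hU'.memLp_left

theorem d1 (hu : ContDiff ℝ 1 u) (hup : ∀ x y, u (x + 1, y) = u (x, y)) (hU : IsFT u U)
    (h : MemLp (d1 u) 2 muOmega) : IsFT (d1 u) fun κ => dsym 0 κ * U κ := by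
  obtain ⟨U', hU', -⟩ := exists_isFT h
  exact hU'.congr_right ((measurable_dsym 0).mul hU.measurable) (hU.d1_ae_eq hu hup hU')

theorem d2 (hu : ContDiff ℝ 1 u) (hU : IsFT u U)
    (h : MemLp (d2 u) 2 muOmega) : IsFT (d2 u) fun κ => dsym 1 κ * U κ := by
  obtain ⟨U', hU', -⟩ := exists_isFT h
  exact hU'.congr_right ((measurable_dsym 1).mul hU.measurable) (hU.d2_ae_eq hu hU')

end IsFT

/-! ### Products as convolutions of the transforms. -/

theorem synth_shift (W : Freq → ℂ) (ν : Freq) (p : ℝ × ℝ) :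
    synth (fun κ => W (κ + ν)) p = synth W p * wave (-ν) p := by
  have := integral_add_right_eq_self (μ := gam) (fun κ => W κ * wave (κ - ν) p) ν
  simp only [add_sub_cancel_right] at this
  rw [synth, this, synth, ← integral_mul_const]
  refine integral_congr_ae (Eventually.of_forall fun κ => ?_)
  simp only [sub_eq_add_neg, wave_add_left, mul_assoc]

/-- The Fourier transform turns products into convolutions. -/
theorem IsFT.integral_conj_synth_mul_synth_mul {W A B : Freq → ℂ} {b : ℝ × ℝ → ℂ}
    (hW1 : Integrable W gam) (hW2 : MemLp W 2 gam) (hA : Integrable A gam) (hB : IsFT b B) :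
    ∫ p, conj (synth W p) * (synth A p * b p) ∂muOmega
      = ∫ ν, A ν * ∫ κ, conj (W (κ + ν)) * B κ ∂gam ∂gam := by
  have hS := integrable_conj_mul (memLp_synth hW1 hW2) hB.memLp_left
  have hwm : Continuous fun z : (ℝ × ℝ) × Freq => wave z.2 z.1 :=
    continuous_wave.comp continuous_swap
  have hint : Integrable (fun z : (ℝ × ℝ) × Freq =>
      wave z.2 z.1 * ((conj (synth W z.1) * b z.1) * A z.2)) (muOmega.prod gam) :=
    (hS.mul_prod hA).bdd_mul (c := 1) hwm.aestronglyMeasurable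
      (Eventually.of_forall fun z => (norm_wave _ _).le)
  calc _ = ∫ p, ∫ ν, wave ν p * ((conj (synth W p) * b p) * A ν) ∂gam ∂muOmega := by
        refine integral_congr_ae (Eventually.of_forall fun p => ?_)
        have e : ∀ ν, wave ν p * ((conj (synth W p) * b p) * A ν)
            = (conj (synth W p) * b p) * (A ν * wave ν p) := fun ν => by ring
        simp only [e, integral_const_mul]
        rw [synth.eq_def A]; ring
    _ = ∫ ν, ∫ p, wave ν p * ((conj (synth W p) * b p) * A ν) ∂muOmega ∂gam :=
        integral_integral_swap hint
    _ = _ := by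
        refine integral_congr_ae (Eventually.of_forall fun ν => ?_)
        have h1 : Integrable (fun κ => W (κ + ν)) gam := hW1.comp_add_right ν
        have h2 : MemLp (fun κ => W (κ + ν)) 2 gam :=
          hW2.comp_measurePreserving (measurePreserving_add_right gam ν)
        simp only
        rw [← hB.pairing _ h1 h2, ← integral_const_mul]
        refine integral_congr_ae (Eventually.of_forall fun p => ?_)
        simp only [synth_shift, map_mul, conj_wave, wave_neg_left, neg_neg]
        ring

/-! ### Convolution over the period cell, kernels and Fourier multipliers. -/

section translation

theorem integral_Ioc_sub_left {E : Type*} [NormedAddCommGroup E] [NormedSpace ℝ E] {a : ℝ → E}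
    (ha : Function.Periodic a 1) (c : ℝ) :
    ∫ x in Set.Ioc (0 : ℝ) 1, a (c - x) = ∫ x in Set.Ioc (0 : ℝ) 1, a x := by
  rw [← intervalIntegral.integral_of_le zero_le_one, ← intervalIntegral.integral_of_le zero_le_one,
    intervalIntegral.integral_comp_sub_left]
  have := ha.intervalIntegral_add_eq (c - 1) 0
  simpa using this

variable {Ψ : ℝ × ℝ → ℂ}

theorem integrable_muOmega_sub_left (hc : Continuous Ψ) (hp : ∀ x y, Ψ (x + 1, y) = Ψ (x, y))
    (hi : Integrable Ψ muOmega) (p : ℝ × ℝ) : Integrable (fun z => Ψ (p - z)) muOmega := by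
  have hc' : Continuous fun z => Ψ (p - z) := hc.comp (by fun_prop)
  refine ⟨hc'.aestronglyMeasurable, ?_⟩
  have e : ∀ a : ℝ → ℂ, Continuous a →
      ∫⁻ x in Set.Ioc (0 : ℝ) 1, ‖a x‖ₑ = ENNReal.ofReal (∫ x in Set.Ioc (0 : ℝ) 1, ‖a x‖) :=
    fun a ha => (ofReal_integral_norm_eq_lintegral_enorm
      ((ha.integrableOn_Icc).mono_set Set.Ioc_subset_Icc_self)).symm
  have h := hi.2
  rw [HasFiniteIntegral, lintegral_muOmega hc.enorm.measurable.aemeasurable] at h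
  rw [HasFiniteIntegral, lintegral_muOmega hc'.enorm.measurable.aemeasurable]
  refine lt_of_eq_of_lt ?_ h
  rw [← lintegral_sub_left_eq_self (μ := volume)
    (fun y => ∫⁻ x in Set.Ioc (0 : ℝ) 1, ‖Ψ (x, y)‖ₑ) p.2]
  refine lintegral_congr fun y => ?_
  have e1 := e _ (hc'.comp (by fun_prop : Continuous fun x : ℝ => ((x, y) : ℝ × ℝ)))
  have e2 := e _ (hc.comp (by fun_prop : Continuous fun x : ℝ => ((x, p.2 - y) : ℝ × ℝ)))
  refine e1.trans (Eq.trans ?_ e2.symm)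
  congr 1
  exact integral_Ioc_sub_left (a := fun x => ‖Ψ (x, p.2 - y)‖)
    (fun x => by simp only [hp]) p.1

theorem integral_muOmega_sub_left (hc : Continuous Ψ) (hp : ∀ x y, Ψ (x + 1, y) = Ψ (x, y))
    (hi : Integrable Ψ muOmega) (p : ℝ × ℝ) :
    ∫ z, Ψ (p - z) ∂muOmega = ∫ z, Ψ z ∂muOmega := by
  have hi' := integrable_muOmega_sub_left hc hp hi p
  rw [muOmega_eq_prod] at hi hi' ⊢
  rw [integral_prod_symm _ hi, integral_prod_symm _ hi',
    ← integral_sub_left_eq_self (μ := volume)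
      (fun y => ∫ x in Set.Ioc (0 : ℝ) 1, Ψ (x, y)) p.2]
  refine integral_congr_ae (Eventually.of_forall fun y => ?_)
  exact integral_Ioc_sub_left (a := fun x => Ψ (x, p.2 - y)) (fun x => by simp only [hp]) p.1

end translation

/-- The symbol `m`, sampled on the frequencies of `Ω`. -/
def symb (m : ℝ × ℝ → ℝ) (κ : Freq) : ℝ := m (2 * Real.pi * κ.1, 2 * Real.pi * κ.2)

/-- Continuous even symbols of compact support. -/
structure IsNiceSymbol (m : ℝ × ℝ → ℝ) : Prop where
  continuous : Continuous m
  even : ∀ ζ, m (-ζ) = m ζ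
  bounded : ∃ R : ℝ, ∀ ζ, m ζ ≠ 0 → |ζ.1| ≤ R ∧ |ζ.2| ≤ R

namespace IsNiceSymbol

variable {m : ℝ × ℝ → ℝ}

theorem continuous_symb (hm : IsNiceSymbol m) : Continuous (symb m) := by
  have : Continuous fun k : ℤ => (k : ℝ) := continuous_of_discreteTopology
  exact hm.continuous.comp (by fun_prop)

theorem hasCompactSupport_symb (hm : IsNiceSymbol m) : HasCompactSupport (symb m) := by
  obtain ⟨R, hR⟩ := hm.bounded
  refine HasCompactSupport.of_support_subset_isCompact (K := Metric.closedBall (0 : Freq) R)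
    (isCompact_closedBall _ _) fun κ hκ => ?_
  obtain ⟨h1, h2⟩ := hR _ hκ
  have hpi : (1 : ℝ) ≤ 2 * Real.pi := by linarith [Real.pi_gt_three]
  have aux : ∀ t : ℝ, |t| ≤ |2 * Real.pi * t| := fun t => by
    rw [abs_mul, abs_of_nonneg (by linarith : (0 : ℝ) ≤ 2 * Real.pi)]
    exact le_mul_of_one_le_left (abs_nonneg _) hpi
  rw [mem_closedBall_zero_iff, Prod.norm_def, max_le_iff]
  refine ⟨?_, (aux _).trans h2⟩
  rw [Int.norm_eq_abs]
  exact (aux _).trans h1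

theorem integrable_symb (hm : IsNiceSymbol m) : Integrable (fun κ => (symb m κ : ℂ)) gam :=
  (hm.continuous_symb.integrable_of_hasCompactSupport hm.hasCompactSupport_symb).ofReal

theorem exists_bound (hm : IsNiceSymbol m) : ∃ M, ∀ κ, ‖(symb m κ : ℂ)‖ ≤ M := by
  obtain ⟨M, hM⟩ := hm.hasCompactSupport_symb.exists_bound_of_continuous hm.continuous_symb
  exact ⟨M, fun κ => by rw [Complex.norm_real]; exact hM κ⟩

theorem measurable_symb (hm : IsNiceSymbol m) : Measurable (symb m) :=
  hm.continuous_symb.measurable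

theorem measurable_symb_complex (hm : IsNiceSymbol m) : Measurable fun κ => (symb m κ : ℂ) :=
  Complex.measurable_ofReal.comp hm.measurable_symb

theorem memLp_symb (hm : IsNiceSymbol m) : MemLp (fun κ => (symb m κ : ℂ)) 2 gam :=
  (hm.continuous_symb.memLp_of_hasCompactSupport hm.hasCompactSupport_symb).ofReal

theorem integrable_symb_mul (hm : IsNiceSymbol m) {U : Freq → ℂ} (hU : MemLp U 2 gam) :
    Integrable (fun κ => symb m κ * U κ) gam :=
  hm.memLp_symb.integrable_mul hU

theorem memLp_symb_mul (hm : IsNiceSymbol m) {U : Freq → ℂ} (hU : MemLp U 2 gam) :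
    MemLp (fun κ => symb m κ * U κ) 2 gam := by
  obtain ⟨M, hM⟩ := hm.exists_bound
  exact memLp_bdd_mul_left hm.measurable_symb_complex hM hU

/-- The substitution `ξ = 2πη` absorbs the factor `1 / (2π)`. Evenness of the symbol makes the sum
real, so taking the real part in `kernel` loses nothing. -/
theorem kernel_eq_synth (hm : IsNiceSymbol m) (p : ℝ × ℝ) :
    (kernel m p : ℂ) = synth (fun κ => (symb m κ : ℂ)) p := by
  have hpi := Real.pi_pos
  have hreal : conj (synth (fun κ => (symb m κ : ℂ)) p) = synth (fun κ => (symb m κ : ℂ)) p := by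
    have := integral_neg_eq_self (fun κ : Freq => (symb m κ : ℂ) * wave κ p) gam
    rw [synth, ← integral_conj, ← this]
    refine integral_congr_ae (Eventually.of_forall fun κ => ?_)
    have e : symb m (-κ) = symb m κ := by
      rw [symb, ← hm.even, symb]
      congr 1
      simp
    simp only [map_mul, Complex.conj_ofReal, conj_wave, e, wave_neg_left]
  have hint := integrable_mul_wave hm.integrable_symb p
  have hsum : synth (fun κ => (symb m κ : ℂ)) p = (1 / (2 * Real.pi) : ℝ) *
      ∑' k : ℤ, ∫ ξ : ℝ, (m (2 * Real.pi * k, ξ) : ℂ) *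
      Complex.exp (Complex.I * ((2 * Real.pi * k * p.1 + ξ * p.2 : ℝ) : ℂ)) := by
    rw [synth]
    unfold gam at hint ⊢
    rw [integral_prod _ hint, integral_countable hint.integral_prod_left, ← tsum_mul_left]
    refine tsum_congr fun k => ?_
    simp only [Measure.real, Measure.count_singleton, ENNReal.toReal_one, one_smul]
    have := Measure.integral_comp_mul_left (fun ξ : ℝ => (m (2 * Real.pi * k, ξ) : ℂ) *
      Complex.exp (Complex.I * ((2 * Real.pi * k * p.1 + ξ * p.2 : ℝ) : ℂ))) (2 * Real.pi)
    rw [abs_of_pos (by positivity), Complex.real_smul, ← one_div] at this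
    rw [← this]
    refine integral_congr_ae (Eventually.of_forall fun η => ?_)
    simp only [symb, wave]
    congr 2
    push_cast; ring
  rw [kernel, Complex.ofReal_mul]
  rw [hsum, map_mul, Complex.conj_ofReal] at hreal
  have h0 : ((1 / (2 * Real.pi) : ℝ) : ℂ) ≠ 0 := by
    exact_mod_cast (by positivity : (1 / (2 * Real.pi) : ℝ) ≠ 0)
  rw [hsum, Complex.conj_eq_iff_re.1 (mul_left_cancel₀ h0 hreal)]

theorem continuous_kernel (hm : IsNiceSymbol m) : Continuous (kernel m) := by
  have : Continuous fun p => (kernel m p : ℂ).re := by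
    simp only [hm.kernel_eq_synth]
    exact Complex.continuous_re.comp (continuous_synth hm.integrable_symb)
  simpa using this

theorem kernel_periodic (hm : IsNiceSymbol m) (x y : ℝ) : kernel m (x + 1, y) = kernel m (x, y) := by
  have := synth_periodic (fun κ => (symb m κ : ℂ)) x y
  rw [← hm.kernel_eq_synth, ← hm.kernel_eq_synth] at this
  exact_mod_cast this

/-- As a function of `z` the translated kernel is the conjugate of a synthesis, the form in which
the pairing identity evaluates a convolution. -/
theorem kernel_sub_eq (hm : IsNiceSymbol m) (p z : ℝ × ℝ) :
    (kernel m (p - z) : ℂ) = conj (synth (fun κ => symb m κ * conj (wave κ p)) z) := by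
  rw [hm.kernel_eq_synth, synth, synth, ← integral_conj]
  refine integral_congr_ae (Eventually.of_forall fun κ => ?_)
  simp only [map_mul, Complex.conj_ofReal, Complex.conj_conj, sub_eq_add_neg, wave_add_right,
    conj_wave κ z]
  ring

variable {u : ℝ × ℝ → ℝ}

theorem integrable_conj_wave (hm : IsNiceSymbol m) (p : ℝ × ℝ) :
    Integrable (fun κ => (symb m κ : ℂ) * conj (wave κ p)) gam := by
  simp only [conj_wave]
  exact integrable_mul_wave hm.integrable_symb _

theorem memLp_conj_wave (hm : IsNiceSymbol m) (p : ℝ × ℝ) :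
    MemLp (fun κ => (symb m κ : ℂ) * conj (wave κ p)) 2 gam := by
  simp only [conj_wave, mul_comm (symb m _ : ℂ)]
  exact memLp_bdd_mul_left (continuous_wave_left _).measurable (fun κ => (norm_wave _ _).le)
    hm.memLp_symb

theorem integrable_kernel_sub_mul (hm : IsNiceSymbol m)
    (hU : MemLp (fun p => (u p : ℂ)) 2 muOmega) (p : ℝ × ℝ) :
    Integrable (fun z => (kernel m (p - z) : ℂ) * u z) muOmega := by
  simp only [hm.kernel_sub_eq]
  exact integrable_conj_mul (memLp_synth (hm.integrable_conj_wave p) (hm.memLp_conj_wave p)) hU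

theorem continuous_kernel_sub_mul (hm : IsNiceSymbol m) (hu : Continuous u) (p : ℝ × ℝ) :
    Continuous fun z => (kernel m (p - z) : ℂ) * u z :=
  (Complex.continuous_ofReal.comp (hm.continuous_kernel.comp (by fun_prop))).mul
    (Complex.continuous_ofReal.comp hu)

theorem kernel_sub_mul_periodic (hm : IsNiceSymbol m) (hp : ∀ x y, u (x + 1, y) = u (x, y))
    (p : ℝ × ℝ) (x y : ℝ) :
    (kernel m (p - (x + 1, y)) : ℂ) * u (x + 1, y) = kernel m (p - (x, y)) * u (x, y) := by
  have := hm.kernel_periodic (p.1 - (x + 1)) (p.2 - y)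
  rw [show p.1 - (x + 1) + 1 = p.1 - x by ring] at this
  rw [hp]
  have e1 : p - (x + 1, y) = (p.1 - (x + 1), p.2 - y) := rfl
  have e2 : p - (x, y) = (p.1 - x, p.2 - y) := rfl
  rw [e1, e2, this]

theorem integrable_kernel_mul (hm : IsNiceSymbol m) (hu : Continuous u)
    (hp : ∀ x y, u (x + 1, y) = u (x, y)) (hU : MemLp (fun p => (u p : ℂ)) 2 muOmega)
    (p : ℝ × ℝ) : Integrable (fun z => kernel m z * u (p - z)) muOmega := by
  have := integrable_muOmega_sub_left (hm.continuous_kernel_sub_mul hu p)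
    (hm.kernel_sub_mul_periodic hp p) (hm.integrable_kernel_sub_mul hU p) p
  simp only [sub_sub_cancel] at this
  simpa using this.re

theorem multiplier_eq_synth (hm : IsNiceSymbol m) (hu : Continuous u)
    (hp : ∀ x y, u (x + 1, y) = u (x, y)) {U : Freq → ℂ} (hU : IsFT (fun p => (u p : ℂ)) U)
    (p : ℝ × ℝ) : ((multiplier m u p : ℝ) : ℂ) = synth (fun κ => symb m κ * U κ) p := by
  have := integral_muOmega_sub_left (hm.continuous_kernel_sub_mul hu p)
    (hm.kernel_sub_mul_periodic hp p) (hm.integrable_kernel_sub_mul hU.memLp_left p) p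
  simp only [sub_sub_cancel] at this
  rw [multiplier, ← integral_complex_ofReal]
  simp only [smul_eq_mul, Complex.ofReal_mul]
  rw [this]
  simp only [hm.kernel_sub_eq]
  rw [hU.pairing _ (hm.integrable_conj_wave p) (hm.memLp_conj_wave p), synth]
  refine integral_congr_ae (Eventually.of_forall fun κ => ?_)
  simp only [map_mul, Complex.conj_ofReal, Complex.conj_conj]
  ring

theorem multiplier_apply (hm : IsNiceSymbol m) {u : ℝ × ℝ → Vec} (hu : Continuous u)
    (hp : ∀ x y, u (x + 1, y) = u (x, y)) (hU : MemLp u 2 muOmega) (p : ℝ × ℝ) (i : Fin 2) :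
    multiplier m u p i = multiplier m (fun p => u p i) p := by
  have hc : ∀ i, Continuous fun p => u p i := fun i => by fun_prop
  have hint : ∀ i, Integrable (fun z => kernel m z * u (p - z) i) muOmega := fun i =>
    hm.integrable_kernel_mul (hc i) (fun x y => by rw [hp])
      (((EuclideanSpace.proj (𝕜 := ℝ) i).comp_memLp' hU).ofReal) p
  rw [multiplier, multiplier]
  have hi : Integrable (fun z => kernel m z • u (p - z)) muOmega := by
    refine Integrable.of_eval_piLp fun i => ?_
    exact hint i
  exact ((EuclideanSpace.proj (𝕜 := ℝ) i).integral_comp_comm hi).symm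

end IsNiceSymbol

/-! ### Trilinear convolution estimates in mixed norms. -/

section CauchySchwarz

variable {α : Type*} [MeasurableSpace α]

/-- The `L²` norm of a nonnegative function. -/
def nrm (μ : Measure α) (a : α → ℝ≥0∞) : ℝ≥0∞ := (∫⁻ x, a x ^ 2 ∂μ) ^ (1 / 2 : ℝ)

theorem nrm_sq (μ : Measure α) (a : α → ℝ≥0∞) : nrm μ a ^ 2 = ∫⁻ x, a x ^ 2 ∂μ := by
  rw [nrm, ← ENNReal.rpow_natCast, ← ENNReal.rpow_mul]
  norm_num

theorem nrm_mono {μ : Measure α} {a b : α → ℝ≥0∞} (h : ∀ x, a x ≤ b x) : nrm μ a ≤ nrm μ b := by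
  unfold nrm
  gcongr with x
  exact h x

theorem nrm_const_mul {μ : Measure α} {c : ℝ≥0∞} {a : α → ℝ≥0∞} (ha : Measurable a) :
    nrm μ (fun x => c * a x) = c * nrm μ a := by
  unfold nrm
  simp only [mul_pow]
  rw [lintegral_const_mul _ (ha.pow_const 2), ENNReal.mul_rpow_of_nonneg _ _ (by norm_num),
    ← ENNReal.rpow_natCast, ← ENNReal.rpow_mul]
  norm_num

theorem nrm_enorm {E : Type*} [NormedAddCommGroup E] (μ : Measure α) (f : α → E) :
    nrm μ (fun x => ‖f x‖ₑ) = eLpNorm f 2 μ := by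
  rw [nrm, ← eLpNorm_two_sq, ← ENNReal.rpow_natCast, ← ENNReal.rpow_mul]
  norm_num

theorem lintegral_mul_le_nrm_mul {μ : Measure α} {a b : α → ℝ≥0∞} (ha : Measurable a)
    (hb : Measurable b) : ∫⁻ x, a x * b x ∂μ ≤ nrm μ a * nrm μ b := by
  have := ENNReal.lintegral_mul_le_Lp_mul_Lq μ (Real.HolderConjugate.two_two) ha.aemeasurable
    hb.aemeasurable
  simpa [nrm] using this

theorem tsum_mul_le_sqrt_mul_sqrt (a b : ℤ → ℝ≥0∞) :
    ∑' k, a k * b k ≤ (∑' k, a k ^ 2) ^ (1 / 2 : ℝ) * (∑' k, b k ^ 2) ^ (1 / 2 : ℝ) := by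
  have := lintegral_mul_le_nrm_mul (μ := (Measure.count : Measure ℤ)) (a := a) (b := b)
    (measurable_from_top) (measurable_from_top)
  simpa only [nrm, lintegral_count] using this

end CauchySchwarz

section mixed

/-- The norm of `ℓ²(ℤ; L¹(ℝ))`. -/
def nrm21 (a : Freq → ℝ≥0∞) : ℝ≥0∞ := (∑' k : ℤ, (∫⁻ η, a (k, η)) ^ 2) ^ (1 / 2 : ℝ)

/-- The norm of `ℓ¹(ℤ; L²(ℝ))`. -/
def nrm12 (a : Freq → ℝ≥0∞) : ℝ≥0∞ := ∑' k : ℤ, nrm volume fun η => a (k, η)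

/-- The trilinear convolution form. -/
def tri (a b c : Freq → ℝ≥0∞) : ℝ≥0∞ := ∫⁻ ν, a ν * ∫⁻ κ, b κ * c (κ + ν) ∂gam ∂gam

variable {a b c : Freq → ℝ≥0∞}

theorem measurable_slice (ha : Measurable a) (k : ℤ) : Measurable fun η => a (k, η) :=
  ha.comp measurable_prodMk_left

theorem nrm_gam_eq (ha : Measurable a) :
    nrm gam a = (∑' k : ℤ, nrm volume (fun η => a (k, η)) ^ 2) ^ (1 / 2 : ℝ) := by
  simp only [nrm_sq]
  rw [nrm, lintegral_gam (ha.pow_const 2).aemeasurable]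

/-- The Fourier side of Hölder's inequality `L^∞ · L² · L²`: Cauchy–Schwarz in `κ` and translation
invariance, uniformly in `ν`. -/
theorem tri_le_of_integrable (ha : Measurable a) (hb : Measurable b) (hc : Measurable c) :
    tri a b c ≤ (∫⁻ ν, a ν ∂gam) * (nrm gam b * nrm gam c) := by
  rw [tri]
  calc _ ≤ ∫⁻ ν, a ν * (nrm gam b * nrm gam c) ∂gam := by
        refine lintegral_mono fun ν => ?_
        gcongr
        refine (lintegral_mul_le_nrm_mul hb (hc.comp (measurable_add_const ν))).trans_eq ?_
        congr 1
        rw [nrm, nrm]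
        congr 1
        exact lintegral_add_right_eq_self (μ := gam) (fun κ => c κ ^ 2) ν
    _ = _ := lintegral_mul_const _ ha

theorem measurable_tri_inner (hb : Measurable b) (hc : Measurable c) :
    Measurable fun ν => ∫⁻ κ, b κ * c (κ + ν) ∂gam := by
  have : Measurable fun z : Freq × Freq => b z.2 * c (z.2 + z.1) :=
    (hb.comp measurable_snd).mul (hc.comp (measurable_snd.add measurable_fst))
  exact this.lintegral_prod_right'

theorem tri_swap (ha : Measurable a) (hb : Measurable b) (hc : Measurable c) :
    tri a b c = tri b a c := by
  have h1 : ∀ {a b : Freq → ℝ≥0∞}, Measurable b →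
      tri a b c = ∫⁻ ν, ∫⁻ κ, a ν * (b κ * c (κ + ν)) ∂gam ∂gam := fun hb => by
    refine lintegral_congr fun ν => ?_
    exact (lintegral_const_mul _ (hb.mul (hc.comp (measurable_add_const ν)))).symm
  rw [h1 hb, h1 ha, lintegral_lintegral_swap]
  · refine lintegral_congr fun κ => lintegral_congr fun ν => ?_
    rw [add_comm]; ring
  · refine Measurable.aemeasurable ?_
    exact (ha.comp measurable_fst).mul ((hb.comp measurable_snd).mul
      (hc.comp (measurable_snd.add measurable_fst)))

/-- The Fourier side of Hölder's inequality with `a` in `L²_x L^∞_y`, `b` in `L^∞_x L²_y` and `c` in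
`L²`. Cauchy–Schwarz is used in the vertical frequency of `b` and `c`, then in the horizontal modes
of `a` and `c`. -/
theorem tri_le_mixed (ha : Measurable a) (hb : Measurable b) (hc : Measurable c) :
    tri a b c ≤ nrm21 a * (nrm12 b * nrm gam c) := by
  have hcs : ∀ k : ℤ, Measurable fun η => c (k, η) := measurable_slice hc
  have h1 : tri a b c ≤ ∑' j : ℤ, ∑' k : ℤ, (∫⁻ s, a (j, s)) *
      (nrm volume (fun t => b (k, t)) * nrm volume (fun t => c (k + j, t))) := by
    have hm : Measurable fun ν => a ν * ∫⁻ κ, b κ * c (κ + ν) ∂gam :=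
      ha.mul (measurable_tri_inner hb hc)
    rw [tri, lintegral_gam hm.aemeasurable]
    refine ENNReal.tsum_le_tsum fun j => ?_
    rw [ENNReal.tsum_mul_left, ← lintegral_mul_const _ (measurable_slice ha j)]
    refine lintegral_mono fun s => ?_
    gcongr
    have hm' : Measurable fun κ => b κ * c (κ + (j, s)) :=
      hb.mul (hc.comp (measurable_add_const _))
    rw [lintegral_gam hm'.aemeasurable]
    refine ENNReal.tsum_le_tsum fun k => ?_
    refine (lintegral_mul_le_nrm_mul (measurable_slice hb k)
      ((hcs (k + j)).comp (measurable_add_const s))).trans_eq ?_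
    congr 1
    rw [nrm, nrm]
    congr 1
    exact lintegral_add_right_eq_self (μ := volume) (fun t => c (k + j, t) ^ 2) s
  refine h1.trans ?_
  rw [ENNReal.tsum_comm]
  have h2 : ∀ k : ℤ, ∑' j : ℤ, (∫⁻ s, a (j, s)) *
      (nrm volume (fun t => b (k, t)) * nrm volume (fun t => c (k + j, t)))
      ≤ nrm volume (fun t => b (k, t)) * (nrm21 a * nrm gam c) := fun k => by
    have e : ∀ j : ℤ, (∫⁻ s, a (j, s)) *
      (nrm volume (fun t => b (k, t)) * nrm volume (fun t => c (k + j, t)))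
      = nrm volume (fun t => b (k, t)) * ((∫⁻ s, a (j, s)) *
        nrm volume (fun t => c (k + j, t))) := fun j => by ring
    simp only [e, ENNReal.tsum_mul_left]
    gcongr
    refine (tsum_mul_le_sqrt_mul_sqrt _ _).trans_eq ?_
    rw [nrm21, nrm_gam_eq hc]
    congr 2
    exact (Equiv.addLeft k).tsum_eq fun j => nrm volume (fun t => c (j, t)) ^ 2
  refine (ENNReal.tsum_le_tsum h2).trans_eq ?_
  rw [ENNReal.tsum_mul_right, nrm12]
  ring

end mixed

/-! ### Agmon's inequality in the vertical variable. -/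

section vertical

/-- The symbols of `|∂₁|` and `|∂₂|` acting on nonnegative functions. -/
def dmul (i : Fin 2) (a : Freq → ℝ≥0∞) (κ : Freq) : ℝ≥0∞ := ‖dsym i κ‖ₑ * a κ

theorem measurable_dmul (i : Fin 2) {a : Freq → ℝ≥0∞} (ha : Measurable a) :
    Measurable (dmul i a) := (measurable_dsym i).enorm.mul ha

theorem lintegral_inv_one_add_sq {l : ℝ} (hl : 0 < l) :
    ∫⁻ η : ℝ, ENNReal.ofReal ((1 + (2 * Real.pi / l * η) ^ 2)⁻¹) = ENNReal.ofReal (l / 2) := by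
  have hpi := Real.pi_pos
  have hc : 2 * Real.pi / l ≠ 0 := by positivity
  rw [← ofReal_integral_eq_lintegral_ofReal
    (integrable_inv_one_add_sq.comp_mul_left' hc)
    (Eventually.of_forall fun η => by positivity)]
  rw [Measure.integral_comp_mul_left (fun x : ℝ => (1 + x ^ 2)⁻¹), integral_univ_inv_one_add_sq,
    abs_of_pos (by positivity), smul_eq_mul]
  congr 1
  field_simp

/-- Cauchy–Schwarz with the weight `1 + (2πη / l)²`, whose inverse has integral `l / 2`. The scale
`l` is left free for later optimization; `dsym 1 (k, η)` does not depend on `k`. -/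
theorem sq_lintegral_le {w : ℝ → ℝ≥0∞} (hw : Measurable w) {l : ℝ} (hl : 0 < l) (k : ℤ) :
    (∫⁻ η, w η) ^ 2 ≤ ENNReal.ofReal (l / 2) *
      ((∫⁻ η, w η ^ 2) + ENNReal.ofReal (l⁻¹ ^ 2) * ∫⁻ η, (‖dsym 1 (k, η)‖ₑ * w η) ^ 2) := by
  have hpi := Real.pi_pos
  set g : ℝ → ℝ := fun η => 1 + (2 * Real.pi / l * η) ^ 2 with hg
  have hgpos : ∀ η, 0 < g η := fun η => by positivity
  have hgm : Measurable g := by fun_prop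
  have hgs : Measurable fun η => ENNReal.ofReal (√(g η)) := hgm.sqrt.ennreal_ofReal
  have hgi : Measurable fun η => ENNReal.ofReal (√(g η))⁻¹ := hgm.sqrt.inv.ennreal_ofReal
  have e1 : ∫⁻ η, w η = ∫⁻ η, ENNReal.ofReal (√(g η))⁻¹ * (ENNReal.ofReal (√(g η)) * w η) := by
    refine lintegral_congr fun η => ?_
    rw [← mul_assoc, ← ENNReal.ofReal_mul (by positivity),
      inv_mul_cancel₀ (Real.sqrt_pos.2 (hgpos η)).ne', ENNReal.ofReal_one, one_mul]
  have e2 : (∫⁻ η, w η) ^ 2 ≤ (∫⁻ η, ENNReal.ofReal (√(g η))⁻¹ ^ 2) *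
      ∫⁻ η, (ENNReal.ofReal (√(g η)) * w η) ^ 2 := by
    rw [e1, ← nrm_sq, ← nrm_sq, ← mul_pow]
    gcongr
    exact lintegral_mul_le_nrm_mul hgi (hgs.mul hw)
  refine e2.trans (le_of_eq ?_)
  congr 1
  · rw [← lintegral_inv_one_add_sq hl]
    refine lintegral_congr fun η => ?_
    rw [← ENNReal.ofReal_pow (by positivity), inv_pow, Real.sq_sqrt (hgpos η).le]
  · have hm : Measurable fun η => (‖dsym 1 (k, η)‖ₑ * w η) ^ 2 :=
      (((measurable_dsym 1).enorm.comp measurable_prodMk_left).mul hw).pow_const 2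
    rw [← lintegral_const_mul _ hm, ← lintegral_add_left (hw.pow_const 2)]
    refine lintegral_congr fun η => ?_
    have e3 : ‖dsym 1 (k, η)‖ₑ = ENNReal.ofReal (2 * Real.pi * |η|) := by
      rw [← ofReal_norm, dsym_one]
      simp only [norm_mul, Complex.norm_I, Complex.norm_real, RCLike.norm_ofNat, mul_one,
        Real.norm_of_nonneg hpi.le, Real.norm_eq_abs]
    rw [mul_pow, mul_pow, ← ENNReal.ofReal_pow (by positivity), Real.sq_sqrt (hgpos η).le, e3,
      ← ENNReal.ofReal_pow (by positivity), ← mul_assoc, ← ENNReal.ofReal_mul (by positivity), hg,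
      ENNReal.ofReal_add zero_le_one (by positivity), ENNReal.ofReal_one, add_mul, one_mul]
    congr 3
    rw [mul_pow, mul_pow, sq_abs]
    field_simp

theorem nrm21_sq (a : Freq → ℝ≥0∞) : nrm21 a ^ 2 = ∑' k : ℤ, (∫⁻ η, a (k, η)) ^ 2 := by
  rw [nrm21, ← ENNReal.rpow_natCast, ← ENNReal.rpow_mul]
  norm_num

/-- The one-dimensional Agmon inequality, on the Fourier side. -/
theorem nrm21_le {a : Freq → ℝ≥0∞} (ha : Measurable a) {A B : ℝ} (hA : 0 ≤ A) (hB : 0 ≤ B)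
    (h1 : nrm gam a ≤ ENNReal.ofReal A) (h2 : nrm gam (dmul 1 a) ≤ ENNReal.ofReal B) :
    nrm21 a ≤ ENNReal.ofReal √(A * B) := by
  have hl : ∀ l : ℝ, 0 < l → nrm21 a ^ 2 ≤ ENNReal.ofReal (l / 2 * (A ^ 2 + l⁻¹ ^ 2 * B ^ 2)) := by
    intro l hl
    have hs : nrm21 a ^ 2 ≤ ENNReal.ofReal (l / 2) *
        (nrm gam a ^ 2 + ENNReal.ofReal (l⁻¹ ^ 2) * nrm gam (dmul 1 a) ^ 2) := by
      rw [nrm21_sq, nrm_sq, nrm_sq, lintegral_gam (ha.pow_const 2).aemeasurable,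
        lintegral_gam ((measurable_dmul 1 ha).pow_const 2).aemeasurable, ← ENNReal.tsum_mul_left,
        ← ENNReal.tsum_add, ← ENNReal.tsum_mul_left]
      exact ENNReal.tsum_le_tsum fun k => sq_lintegral_le (measurable_slice ha k) hl k
    refine hs.trans ?_
    rw [ENNReal.ofReal_mul (by positivity), ENNReal.ofReal_add (by positivity) (by positivity),
      ENNReal.ofReal_mul (by positivity), ENNReal.ofReal_pow hA, ENNReal.ofReal_pow hB]
    gcongr
  have hfin : nrm21 a ^ 2 ≠ ⊤ := ne_top_of_le_ne_top ENNReal.ofReal_ne_top (hl 1 one_pos)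
  have hlim : (nrm21 a ^ 2).toReal ≤ A * B := by
    -- The optimal scale is `l = B / A`. Adding `d` to both keeps it positive and finite when `A` or
    -- `B` vanishes, and `d` then tends to zero.
    have hd : ∀ d : ℝ, 0 < d →
        (nrm21 a ^ 2).toReal ≤ 1 / 2 * (A * (B + d) + (A + d) * B) := by
      intro d hd
      have hAd : 0 < A + d := by linarith
      have hBd : 0 < B + d := by linarith
      refine (ENNReal.toReal_le_of_le_ofReal (by positivity) (hl ((B + d) / (A + d))
        (by positivity))).trans ?_
      have e : (B + d) / (A + d) / 2 * (A ^ 2 + ((B + d) / (A + d))⁻¹ ^ 2 * B ^ 2)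
          = 1 / 2 * (A * (B + d) * (A / (A + d)) + (A + d) * B * (B / (B + d))) := by
        field_simp
      rw [e]
      have e1 : A / (A + d) ≤ 1 := by rw [div_le_one hAd]; linarith
      have e2 : B / (B + d) ≤ 1 := by rw [div_le_one hBd]; linarith
      have e3 : A * (B + d) * (A / (A + d)) ≤ A * (B + d) :=
        mul_le_of_le_one_right (by positivity) e1
      have e4 : (A + d) * B * (B / (B + d)) ≤ (A + d) * B :=
        mul_le_of_le_one_right (by positivity) e2
      linarith
    refine le_of_forall_pos_le_add fun ε hε => ?_
    refine (hd (2 * ε / (A + B + 1)) (by positivity)).trans ?_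
    have : 2 * ε / (A + B + 1) * (A + B) ≤ 2 * ε := by
      rw [div_mul_eq_mul_div, div_le_iff₀ (by positivity)]
      nlinarith
    nlinarith
  have h3 : nrm21 a ^ 2 ≤ ENNReal.ofReal √(A * B) ^ 2 := by
    rw [← ENNReal.ofReal_pow (Real.sqrt_nonneg _), Real.sq_sqrt (by positivity),
      ← ENNReal.ofReal_toReal hfin]
    exact ENNReal.ofReal_le_ofReal hlim
  rw [← ENNReal.rpow_natCast, ← ENNReal.rpow_natCast] at h3
  exact (ENNReal.rpow_le_rpow_iff (by norm_num)).1 h3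

end vertical

/-! ### Zero and nonzero horizontal modes. -/

section horizontal

/-- The constant of the embedding of `H¹(𝕋)` in the Wiener algebra. -/
def sqrtSum : ℝ≥0∞ := (∑' k : ℤ, ENNReal.ofReal |1 / (k : ℝ)| ^ 2) ^ (1 / 2 : ℝ)

theorem sqrtSum_ne_top : sqrtSum ≠ ⊤ := by
  have h : Summable fun k : ℤ => 1 / (k : ℝ) ^ 2 := Real.summable_one_div_int_pow.2 one_lt_two
  have e : ∀ k : ℤ, ENNReal.ofReal |1 / (k : ℝ)| ^ 2 = ENNReal.ofReal (1 / (k : ℝ) ^ 2) := by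
    intro k
    rw [← ENNReal.ofReal_pow (abs_nonneg _), sq_abs, div_pow, one_pow]
  rw [sqrtSum]
  simp only [e]
  rw [← ENNReal.ofReal_tsum_of_nonneg (fun k => by positivity) h]
  exact ENNReal.rpow_ne_top_of_nonneg (by norm_num) ENNReal.ofReal_ne_top

theorem enorm_dsym_zero (κ : Freq) : ‖dsym 0 κ‖ₑ = ENNReal.ofReal (2 * Real.pi * |(κ.1 : ℝ)|) := by
  rw [← ofReal_norm, dsym_zero]
  simp only [norm_mul, Complex.norm_I, Complex.norm_real, RCLike.norm_ofNat, mul_one,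
    Real.norm_of_nonneg Real.pi_pos.le, Complex.norm_intCast]

theorem one_le_enorm_dsym_zero {κ : Freq} (h : κ.1 ≠ 0) : 1 ≤ ‖dsym 0 κ‖ₑ := by
  rw [enorm_dsym_zero, ENNReal.one_le_ofReal]
  have h1 : (1 : ℝ) ≤ |(κ.1 : ℝ)| := by exact_mod_cast Int.one_le_abs h
  nlinarith [Real.pi_gt_three]

/-- Cauchy–Schwarz against `1 / |k|`. The mode `k = 0` is harmless since `A 0 = 0`, and `1 / 0 = 0`
in `sqrtSum`. -/
theorem tsum_le_sqrtSum_mul {A B : ℤ → ℝ≥0∞} (h0 : A 0 = 0)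
    (hB : ∀ k : ℤ, ENNReal.ofReal |(k : ℝ)| * A k ≤ B k) :
    ∑' k, A k ≤ sqrtSum * (∑' k, B k ^ 2) ^ (1 / 2 : ℝ) := by
  calc ∑' k, A k ≤ ∑' k : ℤ, ENNReal.ofReal |1 / (k : ℝ)| * B k := by
        refine ENNReal.tsum_le_tsum fun k => ?_
        by_cases hk : k = 0
        · rw [hk, h0]; exact zero_le
        · have hk' : (k : ℝ) ≠ 0 := by exact_mod_cast hk
          calc A k = ENNReal.ofReal |1 / (k : ℝ)| * (ENNReal.ofReal |(k : ℝ)| * A k) := by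
                rw [← mul_assoc, ← ENNReal.ofReal_mul (abs_nonneg _), ← abs_mul,
                  one_div_mul_cancel hk', abs_one, ENNReal.ofReal_one, one_mul]
            _ ≤ _ := by gcongr; exact hB k
    _ ≤ _ := tsum_mul_le_sqrt_mul_sqrt _ _

/-- The nonzero horizontal frequencies. -/
def tilF (a : Freq → ℝ≥0∞) (κ : Freq) : ℝ≥0∞ := if κ.1 = 0 then 0 else a κ

/-- The zero horizontal frequency. -/
def barF (a : Freq → ℝ≥0∞) (κ : Freq) : ℝ≥0∞ := if κ.1 = 0 then a κ else 0

variable {a b c : Freq → ℝ≥0∞}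

theorem measurableSet_fst_eq_zero : MeasurableSet {κ : Freq | κ.1 = 0} :=
  measurable_fst (measurableSet_singleton 0)

theorem measurable_tilF (ha : Measurable a) : Measurable (tilF a) :=
  Measurable.ite measurableSet_fst_eq_zero measurable_const ha

theorem measurable_barF (ha : Measurable a) : Measurable (barF a) :=
  Measurable.ite measurableSet_fst_eq_zero ha measurable_const

theorem barF_add_tilF (a : Freq → ℝ≥0∞) (κ : Freq) : barF a κ + tilF a κ = a κ := by
  unfold barF tilF; split_ifs <;> simp

theorem tilF_le_dmul (a : Freq → ℝ≥0∞) (κ : Freq) : tilF a κ ≤ dmul 0 a κ := by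
  unfold tilF dmul
  split_ifs with h
  · exact zero_le
  · exact le_mul_of_one_le_left zero_le (one_le_enorm_dsym_zero h)

theorem ofReal_abs_le_enorm_dsym_zero (κ : Freq) : ENNReal.ofReal |(κ.1 : ℝ)| ≤ ‖dsym 0 κ‖ₑ := by
  rw [enorm_dsym_zero]
  refine ENNReal.ofReal_le_ofReal (le_mul_of_one_le_left (abs_nonneg _) ?_)
  linarith [Real.pi_gt_three]

theorem nrm12_tilF_le (ha : Measurable a) : nrm12 (tilF a) ≤ sqrtSum * nrm gam (dmul 0 a) := by
  rw [nrm_gam_eq (measurable_dmul 0 ha), nrm12]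
  refine tsum_le_sqrtSum_mul ?_ fun k => ?_
  · simp [tilF, nrm]
  · rw [← nrm_const_mul (measurable_slice (measurable_tilF ha) k)]
    refine nrm_mono fun η => ?_
    unfold tilF dmul
    split_ifs
    · simp
    · gcongr; exact ofReal_abs_le_enorm_dsym_zero (k, η)

theorem lintegral_tilF_le (ha : Measurable a) :
    ∫⁻ κ, tilF a κ ∂gam ≤ sqrtSum * nrm21 (dmul 0 a) := by
  rw [lintegral_gam (measurable_tilF ha).aemeasurable, nrm21]
  refine tsum_le_sqrtSum_mul ?_ fun k => ?_
  · simp [tilF]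
  · rw [← lintegral_const_mul _ (measurable_slice (measurable_tilF ha) k)]
    refine lintegral_mono fun η => ?_
    unfold tilF dmul
    dsimp only
    split_ifs
    · simp
    · gcongr; exact ofReal_abs_le_enorm_dsym_zero (k, η)

theorem nrm12_barF_le (ha : Measurable a) : nrm12 (barF a) ≤ nrm gam a := by
  rw [nrm12, tsum_eq_single 0 fun k hk => by simp [barF, hk, nrm], nrm_gam_eq ha]
  calc nrm volume (fun η => barF a (0, η)) = (nrm volume (fun η => a (0, η)) ^ 2) ^ (1 / 2 : ℝ) := by
        rw [← ENNReal.rpow_natCast, ← ENNReal.rpow_mul]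
        simp [barF]
    _ ≤ _ := by
        gcongr
        exact ENNReal.le_tsum (f := fun k : ℤ => nrm volume (fun η => a (k, η)) ^ 2) 0

theorem lintegral_barF_le (ha : Measurable a) : ∫⁻ κ, barF a κ ∂gam ≤ nrm21 a := by
  rw [lintegral_gam (measurable_barF ha).aemeasurable,
    tsum_eq_single 0 fun k hk => by simp [barF, hk], nrm21]
  calc ∫⁻ η, barF a (0, η) = ((∫⁻ η, a (0, η)) ^ 2) ^ (1 / 2 : ℝ) := by
        rw [← ENNReal.rpow_natCast, ← ENNReal.rpow_mul]
        simp [barF]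
    _ ≤ _ := by
        gcongr
        exact ENNReal.le_tsum (f := fun k : ℤ => (∫⁻ η, a (k, η)) ^ 2) 0

theorem tri_add_middle (hb : Measurable b) (ha : Measurable a) (hc : Measurable c) :
    tri a b c = tri a (barF b) c + tri a (tilF b) c := by
  have hm : Measurable fun ν => a ν * ∫⁻ κ, barF b κ * c (κ + ν) ∂gam :=
    ha.mul (measurable_tri_inner (measurable_barF hb) hc)
  rw [tri, tri, tri, ← lintegral_add_left hm]
  refine lintegral_congr fun ν => ?_
  have hm' : Measurable fun κ => barF b κ * c (κ + ν) :=
    (measurable_barF hb).mul (hc.comp (measurable_add_const ν))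
  rw [← mul_add, ← lintegral_add_left hm']
  congr 1
  refine lintegral_congr fun κ => ?_
  rw [← add_mul, barF_add_tilF]

/-- The horizontal modes add up: a nonzero mode plus the zero mode is nonzero, so only the
oscillating part of `c` is seen. -/
theorem tri_bar_eq (h : ∀ κ, κ.1 = 0 → a κ = 0) (b c : Freq → ℝ≥0∞) :
    tri a (barF b) c = tri a (barF b) (tilF c) := by
  refine lintegral_congr fun ν => ?_
  by_cases hν : ν.1 = 0
  · rw [h ν hν, zero_mul, zero_mul]
  · congr 1
    refine lintegral_congr fun κ => ?_
    by_cases hκ : κ.1 = 0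
    · simp [tilF, hκ, hν]
    · simp [barF, hκ]

/-- The trilinear estimate with the vertical supremum norm on the first factor. -/
theorem tri_le_nrm21 (ha : Measurable a) (hb : Measurable b) (hc : Measurable c)
    (h : ∀ κ, κ.1 = 0 → a κ = 0) :
    tri a b c ≤ nrm21 a * (sqrtSum * nrm gam (dmul 0 b) * nrm gam c
      + nrm gam b * nrm gam (dmul 0 c)) := by
  -- The oscillating part of `b` is placed in `L^∞_x L²_y` at the cost of `∂₁b`. Its mean needs no
  -- derivative, but forces `c` to oscillate, so that `∂₁` falls on `c`.
  rw [tri_add_middle hb ha hc, tri_bar_eq h, mul_add, add_comm]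
  refine add_le_add ?_ ?_
  · refine (tri_le_mixed ha (measurable_tilF hb) hc).trans ?_
    gcongr
    exact nrm12_tilF_le hb
  · refine (tri_le_mixed ha (measurable_barF hb) (measurable_tilF hc)).trans ?_
    gcongr
    · exact nrm12_barF_le hb
    · exact nrm_mono (tilF_le_dmul c)

/-- The trilinear estimate with the supremum norm on the first factor. -/
theorem tri_le_sup (ha : Measurable a) (hb : Measurable b) (hc : Measurable c)
    (h : ∀ κ, κ.1 = 0 → b κ = 0) :
    tri a b c ≤ sqrtSum * nrm21 (dmul 0 a) * (nrm gam b * nrm gam c)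
      + nrm21 a * (nrm gam b * nrm gam (dmul 0 c)) := by
  -- Here the oscillating factor is `b`, and it is `a` that is split. Both parts of `a` have an
  -- integrable transform, that is, they are placed in `L^∞`.
  rw [tri_swap ha hb hc, tri_add_middle ha hb hc, tri_bar_eq h, add_comm]
  refine add_le_add ?_ ?_
  · rw [tri_swap hb (measurable_tilF ha) hc]
    refine (tri_le_of_integrable (measurable_tilF ha) hb hc).trans ?_
    gcongr
    exact lintegral_tilF_le ha
  · rw [tri_swap hb (measurable_barF ha) (measurable_tilF hc)]
    refine (tri_le_of_integrable (measurable_barF ha) hb (measurable_tilF hc)).trans ?_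
    gcongr
    · exact lintegral_barF_le ha
    · exact nrm_mono (tilF_le_dmul c)

/-- Used to show that the transform of `f` is integrable, so that `f` is bounded and `f · ∇g` lies
in `L²`. -/
theorem lintegral_gam_le (ha : Measurable a) :
    ∫⁻ κ, a κ ∂gam ≤ nrm21 a + sqrtSum * nrm21 (dmul 0 a) := by
  calc _ = ∫⁻ κ, barF a κ + tilF a κ ∂gam := by simp only [barF_add_tilF]
    _ = _ := lintegral_add_left (measurable_barF ha) _
    _ ≤ _ := add_le_add (lintegral_barF_le ha) (lintegral_tilF_le ha)

end horizontal

/-! ### Littlewood–Paley symbols and the pointwise commutator bound. -/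

section symbols

/-- The Euclidean length of a wave vector. -/
def rad (ζ : ℝ × ℝ) : ℝ := √(ζ.1 ^ 2 + ζ.2 ^ 2)

theorem rad_nonneg (ζ : ℝ × ℝ) : 0 ≤ rad ζ := Real.sqrt_nonneg _

theorem rad_eq_norm (ζ : ℝ × ℝ) : rad ζ = ‖(⟨ζ.1, ζ.2⟩ : ℂ)‖ := by
  rw [Complex.norm_eq_sqrt_sq_add_sq, rad]

theorem rad_add_le (ζ ξ : ℝ × ℝ) : rad (ζ + ξ) ≤ rad ζ + rad ξ := by
  simp only [rad_eq_norm]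
  exact norm_add_le (⟨ζ.1, ζ.2⟩ : ℂ) ⟨ξ.1, ξ.2⟩

theorem rad_neg (ζ : ℝ × ℝ) : rad (-ζ) = rad ζ := by simp [rad]

theorem rad_smul {t : ℝ} (ht : 0 ≤ t) (ζ : ℝ × ℝ) : rad (t • ζ) = t * rad ζ := by
  rw [rad, rad, ← Real.sqrt_sq ht, ← Real.sqrt_mul (sq_nonneg t), Real.sqrt_sq ht]
  congr 1; simp; ring

theorem abs_fst_le_rad (ζ : ℝ × ℝ) : |ζ.1| ≤ rad ζ := Real.abs_le_sqrt (by nlinarith)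

theorem abs_snd_le_rad (ζ : ℝ × ℝ) : |ζ.2| ≤ rad ζ := Real.abs_le_sqrt (by nlinarith)

theorem norm_le_rad (ζ : ℝ × ℝ) : ‖ζ‖ ≤ rad ζ :=
  max_le (abs_fst_le_rad ζ) (abs_snd_le_rad ζ)

variable {χ φ : ℝ × ℝ → ℝ}

theorem lpSymbol_of_le {q : ℤ} (hq : q ≤ -2) (ζ : ℝ × ℝ) : lpSymbol χ φ q ζ = 0 := by
  simp [lpSymbol, hq]

theorem lpSymbol_neg_one (ζ : ℝ × ℝ) : lpSymbol χ φ (-1) ζ = χ ζ := by simp [lpSymbol]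

theorem lpSymbol_of_nonneg {q : ℤ} (hq : 0 ≤ q) (ζ : ℝ × ℝ) :
    lpSymbol χ φ q ζ = φ ((2 : ℝ) ^ (-q) • ζ) := by
  rw [lpSymbol, if_neg (by omega), if_neg (by omega)]

namespace IsDyadicPartition

theorem neg_one_le (_ : IsDyadicPartition χ φ) {q : ℤ} {ζ : ℝ × ℝ} (hz : lpSymbol χ φ q ζ ≠ 0) : -1 ≤ q := by
  by_contra hq
  exact hz (lpSymbol_of_le (by omega) ζ)

theorem rad_le (h : IsDyadicPartition χ φ) {q : ℤ} {ζ : ℝ × ℝ} (hz : lpSymbol χ φ q ζ ≠ 0) : rad ζ ≤ 8 / 3 * (2 : ℝ) ^ q := by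
  have hq := h.neg_one_le hz
  rcases hq.eq_or_lt with rfl | hq
  · rw [lpSymbol_neg_one] at hz
    have : rad ζ ≤ 4 / 3 := h.support_low hz
    norm_num; linarith
  · rw [lpSymbol_of_nonneg (by omega)] at hz
    have h1 : rad ((2 : ℝ) ^ (-q) • ζ) ≤ 8 / 3 := (h.support_ring hz).2
    rw [rad_smul (by positivity), zpow_neg, inv_mul_le_iff₀ (by positivity)] at h1
    linarith

theorem le_rad (h : IsDyadicPartition χ φ) {q : ℤ} (hq : 0 ≤ q) {ζ : ℝ × ℝ} (hz : lpSymbol χ φ q ζ ≠ 0) :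
    3 / 4 * (2 : ℝ) ^ q ≤ rad ζ := by
  rw [lpSymbol_of_nonneg hq] at hz
  have h1 : 3 / 4 ≤ rad ((2 : ℝ) ^ (-q) • ζ) := (h.support_ring hz).1
  rw [rad_smul (by positivity), zpow_neg, le_inv_mul_iff₀ (by positivity)] at h1
  linarith

theorem hasCompactSupport_low (h : IsDyadicPartition χ φ) : HasCompactSupport χ :=
  HasCompactSupport.of_support_subset_isCompact (isCompact_closedBall (0 : ℝ × ℝ) (4 / 3))
    fun ζ hζ => by
      rw [mem_closedBall_zero_iff]; exact (norm_le_rad ζ).trans (h.support_low hζ)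

theorem hasCompactSupport_ring (h : IsDyadicPartition χ φ) : HasCompactSupport φ :=
  HasCompactSupport.of_support_subset_isCompact (isCompact_closedBall (0 : ℝ × ℝ) (8 / 3))
    fun ζ hζ => by
      rw [mem_closedBall_zero_iff]; exact (norm_le_rad ζ).trans (h.support_ring hζ).2

theorem isNiceSymbol (h : IsDyadicPartition χ φ) (q : ℤ) : IsNiceSymbol (lpSymbol χ φ q) := by
  refine ⟨?_, fun ζ => ?_, ⟨8 / 3 * (2 : ℝ) ^ q, fun ζ hz =>
    ⟨(abs_fst_le_rad ζ).trans (h.rad_le hz), (abs_snd_le_rad ζ).trans (h.rad_le hz)⟩⟩⟩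
  · unfold lpSymbol
    split_ifs
    · exact continuous_const
    · exact h.smooth_low.continuous
    · exact h.smooth_ring.continuous.comp (continuous_const_smul _)
  · unfold lpSymbol
    split_ifs
    · rfl
    · exact h.even_low ζ
    · rw [smul_neg, h.even_ring]

theorem exists_bound_lpSymbol (h : IsDyadicPartition χ φ) : ∃ M : ℝ, 0 ≤ M ∧ ∀ q ζ, |lpSymbol χ φ q ζ| ≤ M := by
  obtain ⟨M1, h1⟩ := h.hasCompactSupport_low.exists_bound_of_continuous h.smooth_low.continuous
  obtain ⟨M2, h2⟩ := h.hasCompactSupport_ring.exists_bound_of_continuous h.smooth_ring.continuous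
  have p1 : 0 ≤ M1 := (norm_nonneg _).trans (h1 0)
  have p2 : 0 ≤ M2 := (norm_nonneg _).trans (h2 0)
  refine ⟨M1 + M2, by positivity, fun q ζ => ?_⟩
  unfold lpSymbol
  split_ifs
  · simp; positivity
  · exact (h1 _).trans (by linarith)
  · exact (h2 _).trans (by linarith)

theorem exists_lipschitz_lpSymbol (h : IsDyadicPartition χ φ) : ∃ L : ℝ, 0 ≤ L ∧ ∀ q ζ ξ,
    |lpSymbol χ φ q ζ - lpSymbol χ φ q ξ| ≤ L * ((2 : ℝ) ^ (-q) * rad (ζ - ξ)) := by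
  obtain ⟨L1, h1⟩ := h.smooth_low.lipschitzWith_of_hasCompactSupport h.hasCompactSupport_low
    (by simp)
  obtain ⟨L2, h2⟩ := h.smooth_ring.lipschitzWith_of_hasCompactSupport h.hasCompactSupport_ring
    (by simp)
  refine ⟨L1 + L2, by positivity, fun q ζ ξ => ?_⟩
  have hr := rad_nonneg (ζ - ξ)
  unfold lpSymbol
  split_ifs with hq hq'
  · simp; positivity
  · have := h1.dist_le_mul ζ ξ
    rw [Real.dist_eq, dist_eq_norm] at this
    refine this.trans ?_
    gcongr
    · exact le_add_of_nonneg_right L2.2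
    -- For `q = -1` the factor `2^{-q}` is `2`, more than the Lipschitz bound of `χ` requires.
    · rw [hq']; norm_num
      linarith [norm_le_rad (ζ - ξ)]
  · have := h2.dist_le_mul ((2 : ℝ) ^ (-q) • ζ) ((2 : ℝ) ^ (-q) • ξ)
    rw [Real.dist_eq, dist_eq_norm, ← smul_sub, norm_smul, Real.norm_of_nonneg (by positivity)]
      at this
    refine this.trans ?_
    gcongr
    · exact le_add_of_nonneg_left L1.2
    · exact norm_le_rad _

theorem sum_Ico_eq (n : ℕ) (ζ : ℝ × ℝ) : ∑ j ∈ Finset.Ico (-1 : ℤ) n, lpSymbol χ φ j ζ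
    = χ ζ + ∑ j ∈ Finset.range n, φ ((2 : ℝ) ^ (-(j : ℤ)) • ζ) := by
  induction n with
  | zero =>
    have : Finset.Ico (-1 : ℤ) (0 : ℕ) = {-1} := by rfl
    rw [this]; simp [lpSymbol_neg_one]
  | succ n ih =>
    have : Finset.Ico (-1 : ℤ) (n + 1 : ℕ) = insert (n : ℤ) (Finset.Ico (-1 : ℤ) n) := by
      ext j; simp only [Finset.mem_Ico, Finset.mem_insert]; push_cast; omega
    rw [this, Finset.sum_insert (by simp), ih, Finset.sum_range_succ,
      lpSymbol_of_nonneg (Int.natCast_nonneg n)]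
    ring

/-- The omitted symbols, those with `j ≥ q`, vanish for `|ζ| < (3/4) 2^q`, so the truncated sum is
the full partition of unity. -/
theorem sum_Ico_eq_one (h : IsDyadicPartition χ φ) {q : ℤ} (hq : 0 ≤ q) {ζ : ℝ × ℝ} (hz : rad ζ < 3 / 4 * (2 : ℝ) ^ q) :
    ∑ j ∈ Finset.Ico (-1 : ℤ) q, lpSymbol χ φ j ζ = 1 := by
  lift q to ℕ using hq
  rw [sum_Ico_eq, ← h.sum_inhomogeneous ζ, tsum_eq_sum]
  intro j hj
  by_contra hne
  rw [← lpSymbol_of_nonneg (χ := χ) (φ := φ) (Int.natCast_nonneg j)] at hne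
  have h1 := h.le_rad (Int.natCast_nonneg j) hne
  have h2 : (2 : ℝ) ^ (q : ℤ) ≤ (2 : ℝ) ^ (j : ℤ) := by
    apply zpow_le_zpow_right₀ one_le_two
    simpa using hj
  linarith

/-- Rings whose indices differ by at least two are disjoint, because `8/3 < (3/4) · 4`. The index
`-1` of the low block is always kept. -/
theorem exists_overlap (h : IsDyadicPartition χ φ) (ζ : ℝ × ℝ) : ∃ t : Finset ℤ, t.card ≤ 4 ∧
    ∀ j ∉ t, lpSymbol χ φ j ζ = 0 := by
  by_cases hex : ∃ i : ℤ, 0 ≤ i ∧ lpSymbol χ φ i ζ ≠ 0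
  · obtain ⟨i, hi, hzi⟩ := hex
    refine ⟨{-1, i - 1, i, i + 1}, Finset.card_le_four, fun j hj => ?_⟩
    by_contra hzj
    have hj1 := h.neg_one_le hzj
    simp only [Finset.mem_insert, Finset.mem_singleton, not_or] at hj
    have hj0 : 0 ≤ j := by omega
    have a1 := h.le_rad hi hzi
    have a2 := h.rad_le hzi
    have a3 := h.le_rad hj0 hzj
    have a4 := h.rad_le hzj
    rcases lt_or_gt_of_ne hj.2.2.1 with hlt | hlt
    · have : (2 : ℝ) ^ (j + 2) ≤ (2 : ℝ) ^ i := zpow_le_zpow_right₀ one_le_two (by omega)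
      rw [zpow_add₀ two_ne_zero] at this
      have p : (0 : ℝ) < (2 : ℝ) ^ j := by positivity
      norm_num at this
      linarith
    · have : (2 : ℝ) ^ (i + 2) ≤ (2 : ℝ) ^ j := zpow_le_zpow_right₀ one_le_two (by omega)
      rw [zpow_add₀ two_ne_zero] at this
      have p : (0 : ℝ) < (2 : ℝ) ^ i := by positivity
      norm_num at this
      linarith
  · refine ⟨{-1}, by simp, fun j hj => ?_⟩
    by_contra hzj
    have := h.neg_one_le hzj
    rw [Finset.mem_singleton] at hj
    exact hex ⟨j, by omega, hzj⟩

theorem abs_sum_le (h : IsDyadicPartition χ φ) {M : ℝ} (hM0 : 0 ≤ M) (ζ : ℝ × ℝ) (hM : ∀ q, |lpSymbol χ φ q ζ| ≤ M)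
    (s : Finset ℤ) : |∑ j ∈ s, lpSymbol χ φ j ζ| ≤ 4 * M := by
  obtain ⟨t, ht, h0⟩ := h.exists_overlap ζ
  have e : ∑ j ∈ s, lpSymbol χ φ j ζ = ∑ j ∈ s ∩ t, lpSymbol χ φ j ζ := by
    refine (Finset.sum_subset Finset.inter_subset_left fun j hj hj' => h0 j fun hjt => ?_).symm
    exact hj' (Finset.mem_inter.2 ⟨hj, hjt⟩)
  rw [e]
  refine (Finset.abs_sum_le_sum_abs _ _).trans ((Finset.sum_le_card_nsmul _ _ M
    fun j _ => hM j).trans ?_)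
  rw [nsmul_eq_mul]
  gcongr
  exact_mod_cast (Finset.card_le_card Finset.inter_subset_right).trans ht

/-- At most four symbols are nonzero at `ζ` and they sum to one, so they cannot all be below `1/8`.
-/
theorem exists_large (h : IsDyadicPartition χ φ) (ζ : ℝ × ℝ) : ∃ q, 1 / 8 ≤ |lpSymbol χ φ q ζ| := by
  by_contra! hlt
  obtain ⟨n, hn⟩ := pow_unbounded_of_one_lt (2 * rad ζ) one_lt_two
  have h1 := h.sum_Ico_eq_one (q := n) (Int.natCast_nonneg n) (ζ := ζ) (by
    rw [zpow_natCast]; linarith [rad_nonneg ζ])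
  have h2 := h.abs_sum_le (M := 1 / 8) (by norm_num) ζ (fun q => (hlt q).le)
    (Finset.Ico (-1 : ℤ) n)
  rw [h1] at h2
  norm_num at h2

end IsDyadicPartition

/-- The wave vector of a frequency. -/
def wvec (κ : Freq) : ℝ × ℝ := (2 * Real.pi * κ.1, 2 * Real.pi * κ.2)

theorem symb_eq (m : ℝ × ℝ → ℝ) (κ : Freq) : symb m κ = m (wvec κ) := rfl

theorem wvec_add (κ ν : Freq) : wvec (κ + ν) = wvec κ + wvec ν := by
  simp [wvec, mul_add]

theorem norm_dsym_zero (κ : Freq) : ‖dsym 0 κ‖ = |(wvec κ).1| := by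
  rw [dsym_zero, wvec, abs_mul, abs_of_pos (by positivity)]
  simp [abs_of_pos Real.pi_pos]

theorem norm_dsym_one (κ : Freq) : ‖dsym 1 κ‖ = |(wvec κ).2| := by
  rw [dsym_one, wvec, abs_mul, abs_of_pos (by positivity)]
  simp [abs_of_pos Real.pi_pos]

theorem rad_wvec_le (κ : Freq) : rad (wvec κ) ≤ ‖dsym 0 κ‖ + ‖dsym 1 κ‖ := by
  rw [norm_dsym_zero, norm_dsym_one, rad]
  refine Real.sqrt_le_iff.2 ⟨by positivity, ?_⟩
  have := mul_nonneg (abs_nonneg (wvec κ).1) (abs_nonneg (wvec κ).2)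
  nlinarith [sq_abs (wvec κ).1, sq_abs (wvec κ).2]

theorem measurable_rad_wvec : Measurable fun κ => rad (wvec κ) := by
  have h : Continuous fun k : ℤ => (k : ℝ) := continuous_of_discreteTopology
  unfold rad wvec
  exact (by fun_prop : Continuous _).measurable

/-- The frequencies that are not much smaller than `2^q`. -/
def hi (q : ℤ) : Set Freq := {κ | (2 : ℝ) ^ q ≤ 8 * (1 + rad (wvec κ))}

theorem measurableSet_hi (q : ℤ) : MeasurableSet (hi q) :=
  measurableSet_le measurable_const ((measurable_const.add measurable_rad_wvec).const_mul 8)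

namespace IsDyadicPartition

theorem mem_hi (h : IsDyadicPartition χ φ) {q : ℤ} {κ : Freq} (hz : symb (lpSymbol χ φ q) κ ≠ 0) : κ ∈ hi q := by
  have hr := rad_nonneg (wvec κ)
  have hq := h.neg_one_le hz
  rw [hi, Set.mem_ofPred_eq]
  rcases hq.eq_or_lt with rfl | hq
  · norm_num; linarith
  · have : _ ≤ rad (wvec κ) := h.le_rad (by omega) hz
    linarith

/-- If `|κ + ν| ≥ (3/4) 2^q`, one of the two lengths is at least `(3/8) 2^q`. The summand `1` in
`hi` covers `q = -1`. -/
theorem mem_hi_or (h : IsDyadicPartition χ φ) {q : ℤ} {κ ν : Freq} (hz : symb (lpSymbol χ φ q) (κ + ν) ≠ 0) :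
    κ ∈ hi q ∨ ν ∈ hi q := by
  have h1 := rad_nonneg (wvec κ)
  have h2 := rad_nonneg (wvec ν)
  have hq := h.neg_one_le hz
  simp only [hi, Set.mem_ofPred_eq]
  rcases hq.eq_or_lt with rfl | hq
  · left; norm_num; linarith
  · have : _ ≤ rad (wvec (κ + ν)) := h.le_rad (by omega) hz
    rw [wvec_add] at this
    have h3 := rad_add_le (wvec κ) (wvec ν)
    by_contra! hc
    linarith [hc.1, hc.2]

/-- The pointwise bound behind the commutator estimate. -/
theorem exists_commutator_bound (h : IsDyadicPartition χ φ) : ∃ K : ℝ, 0 ≤ K ∧ ∀ (q : ℤ) (κ ν : Freq),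
    symb (lpSymbol χ φ q) (κ + ν) ≠ 0 →
    (κ ∈ hi q ∧ |symb (lpSymbol χ φ q) (κ + ν) - (∑ j ∈ Finset.Ico (-1) q, symb (lpSymbol χ φ j) ν)
      * symb (lpSymbol χ φ q) κ| * ‖dsym 1 κ‖ ≤ K * (‖dsym 0 ν‖ + ‖dsym 1 ν‖)) ∨
    (ν ∈ hi q ∧ |symb (lpSymbol χ φ q) (κ + ν) - (∑ j ∈ Finset.Ico (-1) q, symb (lpSymbol χ φ j) ν)
      * symb (lpSymbol χ φ q) κ| ≤ K) := by
  obtain ⟨M, hM0, hM⟩ := h.exists_bound_lpSymbol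
  obtain ⟨L, hL0, hL⟩ := h.exists_lipschitz_lpSymbol
  refine ⟨4 * L + (M + 4 * M * M), by positivity, fun q κ ν hz => ?_⟩
  have hκ := rad_nonneg (wvec κ)
  have hν := rad_nonneg (wvec ν)
  have hq := h.neg_one_le hz
  simp only [symb_eq, wvec_add]
  have hz' : lpSymbol χ φ q (wvec κ + wvec ν) ≠ 0 := by rwa [← wvec_add]
  -- Below the threshold `3/8` the symbol of `S_q` equals one at `ν`, and `κ` has length at least
  -- `(3/8) 2^q`.
  by_cases hA : 0 ≤ q ∧ rad (wvec ν) ≤ 3 / 8 * (2 : ℝ) ^ q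
  · left
    obtain ⟨hq0, hA⟩ := hA
    have p : (0 : ℝ) < (2 : ℝ) ^ q := by positivity
    have hlow := h.le_rad hq0 hz'
    have hup := h.rad_le hz'
    have htri := rad_add_le (wvec κ) (wvec ν)
    have htri2 : rad (wvec κ) ≤ rad (wvec κ + wvec ν) + rad (wvec ν) := by
      have := rad_add_le (wvec κ + wvec ν) (-wvec ν)
      rwa [rad_neg, add_neg_cancel_right] at this
    refine ⟨?_, ?_⟩
    · rw [hi, Set.mem_ofPred_eq]; linarith
    · rw [h.sum_Ico_eq_one hq0 (by linarith), one_mul]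
      have h1 := hL q (wvec κ + wvec ν) (wvec κ)
      rw [add_sub_cancel_left] at h1
      -- Here `|κ| ≤ (8/3 + 3/8) 2^q`. This power of `2^q` is cancelled by the `2^{-q}` of the
      -- Lipschitz bound, leaving the length of `ν`, a derivative of `f`.
      have h2 : ‖dsym 1 κ‖ ≤ 4 * (2 : ℝ) ^ q := by
        rw [norm_dsym_one]
        refine (abs_snd_le_rad _).trans ?_
        linarith
      calc _ ≤ L * ((2 : ℝ) ^ (-q) * rad (wvec ν)) * (4 * (2 : ℝ) ^ q) :=
            mul_le_mul h1 h2 (norm_nonneg _) (by positivity)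
        _ = 4 * L * rad (wvec ν) := by rw [zpow_neg]; field_simp
        _ ≤ _ := mul_le_mul (le_add_of_nonneg_right (by positivity)) (rad_wvec_le ν) hν
            (by positivity)
  · right
    refine ⟨?_, ?_⟩
    · rw [hi, Set.mem_ofPred_eq]
      rcases hq.eq_or_lt with rfl | hq
      · norm_num; linarith
      · have : ¬ rad (wvec ν) ≤ 3 / 8 * (2 : ℝ) ^ q := fun hc => hA ⟨by omega, hc⟩
        linarith
    · refine (abs_sub _ _).trans ?_
      rw [abs_mul]
      have a1 := hM q (wvec κ + wvec ν)
      have a2 := h.abs_sum_le hM0 (wvec ν) (fun j => hM j _) (Finset.Ico (-1 : ℤ) q)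
      have a3 := hM q (wvec κ)
      have a4 := mul_le_mul a2 a3 (abs_nonneg _) (by positivity)
      linarith

/-- The weights of `H^s` control those of the high frequencies. -/
theorem exists_weight_bound (h : IsDyadicPartition χ φ) {s : ℝ} (hs : 0 < s) : ∃ K : ℝ, 0 ≤ K ∧ ∀ κ : Freq,
    ∑' q : ℤ, ENNReal.ofReal ((2 : ℝ) ^ (2 * (q : ℝ) * s)) * (hi q).indicator 1 κ ≤
    ENNReal.ofReal K * ∑' q : ℤ, ENNReal.ofReal ((2 : ℝ) ^ (2 * (q : ℝ) * s)) *
      ‖symb (lpSymbol χ φ q) κ‖ₑ ^ 2 := by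
  have hr : (2 : ℝ) ^ (-(2 * s)) < 1 := Real.rpow_lt_one_of_one_lt_of_neg one_lt_two (by linarith)
  have hr0 : (0 : ℝ) ≤ (2 : ℝ) ^ (-(2 * s)) := by positivity
  set G : ℝ := ∑' n : ℕ, ((2 : ℝ) ^ (-(2 * s))) ^ n with hG
  have hGs := summable_geometric_of_lt_one hr0 hr
  have hG0 : 0 ≤ G := tsum_nonneg fun n => by positivity
  -- The factor `64` makes up for the square of the lower bound `1/8`, `2^{12s}` for the shift by
  -- six indices below, and `G` sums the geometric series over smaller `q`, which converges as `s >
  -- 0`.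
  refine ⟨64 * (2 : ℝ) ^ (12 * s) * G, by positivity, fun κ => ?_⟩
  obtain ⟨i, hi'⟩ := h.exists_large (wvec κ)
  have hzi : lpSymbol χ φ i (wvec κ) ≠ 0 := by
    intro h0; rw [h0, abs_zero] at hi'; norm_num at hi'
  -- Since `|κ| ≤ (8/3) 2^i` and `1 ≤ 2 · 2^i`, membership gives `2^q ≤ 8 (2 + 8/3) 2^i < 2^{i+6}`.
  have hle : ∀ q : ℤ, κ ∈ hi q → q ≤ i + 6 := by
    intro q hq
    rw [hi, Set.mem_ofPred_eq] at hq
    have h1 := h.rad_le hzi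
    have h2 : (2 : ℝ) ^ (-1 : ℤ) ≤ (2 : ℝ) ^ i := zpow_le_zpow_right₀ one_le_two (h.neg_one_le hzi)
    have h3 : (2 : ℝ) ^ q ≤ (2 : ℝ) ^ (i + 6) := by
      rw [zpow_add₀ two_ne_zero]
      norm_num at h2 ⊢
      linarith
    exact (zpow_le_zpow_iff_right₀ one_lt_two).1 h3
  calc ∑' q : ℤ, ENNReal.ofReal ((2 : ℝ) ^ (2 * (q : ℝ) * s)) * (hi q).indicator 1 κ
      = ∑' n : ℕ, ENNReal.ofReal ((2 : ℝ) ^ (2 * (((i + 6 - n : ℤ)) : ℝ) * s)) *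
          (hi (i + 6 - n)).indicator 1 κ := by
        have hinj : Function.Injective fun n : ℕ => i + 6 - (n : ℤ) := fun a b hab => by
          simp only at hab; omega
        refine (hinj.tsum_eq (f := fun q : ℤ => ENNReal.ofReal ((2 : ℝ) ^ (2 * (q : ℝ) * s)) *
          (hi q).indicator 1 κ) fun q hq => ?_).symm
        have hmem : κ ∈ hi q := by
          by_contra hc
          exact hq (by simp [hc])
        exact ⟨(i + 6 - q).toNat, by have := hle q hmem; simp only; omega⟩
    _ ≤ ∑' n : ℕ, ENNReal.ofReal ((2 : ℝ) ^ (12 * s) * (2 : ℝ) ^ (2 * (i : ℝ) * s) *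
          ((2 : ℝ) ^ (-(2 * s))) ^ n) := by
        refine ENNReal.tsum_le_tsum fun n => ?_
        refine (mul_le_of_le_one_right zero_le (Set.indicator_le_self' (by simp) κ)).trans_eq ?_
        congr 1
        rw [← Real.rpow_natCast, ← Real.rpow_mul zero_le_two, ← Real.rpow_add two_pos,
          ← Real.rpow_add two_pos]
        congr 1
        push_cast; ring
    _ = ENNReal.ofReal ((2 : ℝ) ^ (12 * s) * (2 : ℝ) ^ (2 * (i : ℝ) * s) * G) := by
        rw [hG, ← tsum_mul_left, ENNReal.ofReal_tsum_of_nonneg (fun n => by positivity)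
          (hGs.mul_left _)]
    _ ≤ ENNReal.ofReal (64 * (2 : ℝ) ^ (12 * s) * G) *
          (ENNReal.ofReal ((2 : ℝ) ^ (2 * (i : ℝ) * s)) * ‖symb (lpSymbol χ φ i) κ‖ₑ ^ 2) := by
        have h1 : (1 : ℝ) ≤ 64 * |lpSymbol χ φ i (wvec κ)| ^ 2 := by nlinarith
        rw [symb_eq, ← ofReal_norm, ← ENNReal.ofReal_pow (norm_nonneg _), Real.norm_eq_abs,
          ← ENNReal.ofReal_mul (by positivity), ← ENNReal.ofReal_mul (by positivity)]
        refine ENNReal.ofReal_le_ofReal ?_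
        have p : (0 : ℝ) ≤ (2 : ℝ) ^ (12 * s) * (2 : ℝ) ^ (2 * (i : ℝ) * s) * G := by positivity
        nlinarith [mul_le_mul_of_nonneg_left h1 p]
    _ ≤ _ := by
        gcongr
        exact ENNReal.le_tsum (f := fun q : ℤ => ENNReal.ofReal ((2 : ℝ) ^ (2 * (q : ℝ) * s)) *
          ‖symb (lpSymbol χ φ q) κ‖ₑ ^ 2) i

end IsDyadicPartition

end symbols

/-! ### The estimate of the difference on the frequency side. -/

section frequency

variable {χ φ : ℝ × ℝ → ℝ}

/-- The symbol of `S_q`. -/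
def lowSymb (χ φ : ℝ × ℝ → ℝ) (q : ℤ) (ν : Freq) : ℝ :=
  ∑ j ∈ Finset.Ico (-1 : ℤ) q, symb (lpSymbol χ φ j) ν

/-- The integrand, on the Fourier side, of the difference of the trilinear term and of the
remainder. -/
def difKernel (χ φ : ℝ × ℝ → ℝ) (q : ℤ) (F : Fin 2 → Freq → ℂ) (Γ H : Freq → ℂ) (ν κ : Freq) : ℂ :=
  F 0 ν * (conj (symb (lpSymbol χ φ q) (κ + ν) * (symb (lpSymbol χ φ q) (κ + ν) * H (κ + ν))) *
      (dsym 0 κ * Γ κ)) +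
    F 1 ν * (conj (symb (lpSymbol χ φ q) (κ + ν) * (symb (lpSymbol χ φ q) (κ + ν) * H (κ + ν))) *
      (dsym 1 κ * Γ κ)) -
    lowSymb χ φ q ν * F 1 ν * (conj (symb (lpSymbol χ φ q) (κ + ν) * H (κ + ν)) *
      (dsym 1 κ * (symb (lpSymbol χ φ q) κ * Γ κ)))

/-- Taking out the common factor from `h` exposes the commutator symbol multiplying `f² ∂₂g`. -/
theorem difKernel_eq (q : ℤ) (F : Fin 2 → Freq → ℂ) (Γ H : Freq → ℂ) (ν κ : Freq) :
    difKernel χ φ q F Γ H ν κ = conj (symb (lpSymbol χ φ q) (κ + ν) * H (κ + ν)) *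
      (F 0 ν * symb (lpSymbol χ φ q) (κ + ν) * (dsym 0 κ * Γ κ) +
      F 1 ν * (((symb (lpSymbol χ φ q) (κ + ν) - lowSymb χ φ q ν * symb (lpSymbol χ φ q) κ : ℝ) : ℂ)
        * dsym 1 κ) * Γ κ) := by
  rw [difKernel]
  simp only [map_mul, Complex.conj_ofReal]
  push_cast; ring

theorem enorm_le_ofReal_of_norm_le {E : Type*} [NormedAddCommGroup E] {x : E} {r : ℝ}
    (h : ‖x‖ ≤ r) : ‖x‖ₑ ≤ ENNReal.ofReal r := by
  rw [← ofReal_norm]; exact ENNReal.ofReal_le_ofReal h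

/-- The part of a function carried by the frequencies that are not much smaller than `2^q`. -/
def hiF (q : ℤ) (U : Freq → ℂ) : Freq → ℝ≥0∞ := (hi q).indicator fun κ => ‖U κ‖ₑ

theorem measurable_hiF (q : ℤ) {U : Freq → ℂ} (hU : Measurable U) : Measurable (hiF q U) :=
  hU.enorm.indicator (measurableSet_hi q)

theorem hiF_of_mem {q : ℤ} {U : Freq → ℂ} {κ : Freq} (h : κ ∈ hi q) : hiF q U κ = ‖U κ‖ₑ :=
  Set.indicator_of_mem h _

theorem dmul_hiF (i : Fin 2) (q : ℤ) (U : Freq → ℂ) :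
    dmul i (hiF q U) = hiF q (fun κ => dsym i κ * U κ) := by
  funext κ
  unfold dmul hiF
  by_cases h : κ ∈ hi q <;> simp [h, enorm_mul]

theorem dmul_enorm (i : Fin 2) (U : Freq → ℂ) :
    dmul i (fun κ => ‖U κ‖ₑ) = fun κ => ‖dsym i κ * U κ‖ₑ := by
  funext κ
  rw [dmul, enorm_mul]

/-- The part with `f¹ ∂₁g` needs only that `κ` or `ν` is high: two terms. The part with `f² ∂₂g`
follows the two cases of the commutator bound: for `κ` in `hi q` a full gradient falls on `f²`, and
`|∂₂f²| = |∂₁f¹|` makes it two terms with horizontal derivatives; for `ν` in `hi q` the derivative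
stays on `g`. -/
theorem IsDyadicPartition.exists_difKernel_bound (h : IsDyadicPartition χ φ) :
    ∃ K : ℝ≥0∞, K ≠ ⊤ ∧ (∀ q κ, ‖symb (lpSymbol χ φ q) κ‖ₑ ≤ K) ∧
    ∀ (q : ℤ) (F : Fin 2 → Freq → ℂ) (Γ H : Freq → ℂ),
      (∀ κ, dsym 0 κ * F 0 κ + dsym 1 κ * F 1 κ = 0) → ∀ ν κ,
      ‖difKernel χ φ q F Γ H ν κ‖ₑ ≤ K *
        (‖F 0 ν‖ₑ * (hiF q (fun κ => dsym 0 κ * Γ κ) κ *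
            ‖symb (lpSymbol χ φ q) (κ + ν) * H (κ + ν)‖ₑ) +
          hiF q (F 0) ν * (‖dsym 0 κ * Γ κ‖ₑ * ‖symb (lpSymbol χ φ q) (κ + ν) * H (κ + ν)‖ₑ) +
          ‖dsym 0 ν * F 0 ν‖ₑ * (hiF q Γ κ * ‖symb (lpSymbol χ φ q) (κ + ν) * H (κ + ν)‖ₑ) +
          ‖dsym 0 ν * F 1 ν‖ₑ * (hiF q Γ κ * ‖symb (lpSymbol χ φ q) (κ + ν) * H (κ + ν)‖ₑ) +
          hiF q (F 1) ν * (‖dsym 1 κ * Γ κ‖ₑ *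
            ‖symb (lpSymbol χ φ q) (κ + ν) * H (κ + ν)‖ₑ)) := by
  obtain ⟨M, hM0, hM⟩ := h.exists_bound_lpSymbol
  obtain ⟨K, hK0, hK⟩ := h.exists_commutator_bound
  have hMK : ENNReal.ofReal M ≤ ENNReal.ofReal (M + K) := ENNReal.ofReal_le_ofReal (by linarith)
  have hKK : ENNReal.ofReal K ≤ ENNReal.ofReal (M + K) := ENNReal.ofReal_le_ofReal (by linarith)
  have hsM : ∀ q κ, ‖symb (lpSymbol χ φ q) κ‖ₑ ≤ ENNReal.ofReal (M + K) := fun q κ =>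
    (enorm_le_ofReal_of_norm_le (hM q _)).trans hMK
  refine ⟨ENNReal.ofReal (M + K), ENNReal.ofReal_ne_top, hsM, fun q F Γ H hdiv ν κ => ?_⟩
  rw [difKernel_eq]
  set c : ℂ := symb (lpSymbol χ φ q) (κ + ν) * H (κ + ν) with hc
  set K' := ENNReal.ofReal (M + K)
  by_cases hz : symb (lpSymbol χ φ q) (κ + ν) = 0
  · simp [hc, hz]
  rw [enorm_mul, RCLike.enorm_conj]
  have hm : ‖((symb (lpSymbol χ φ q) (κ + ν) : ℝ) : ℂ)‖ₑ ≤ K' := by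
    rw [← ofReal_norm, Complex.norm_real, ofReal_norm]; exact hsM q _
  have hF1 : ‖dsym 1 ν * F 1 ν‖ₑ = ‖dsym 0 ν * F 0 ν‖ₑ := by
    rw [eq_neg_of_add_eq_zero_right (hdiv ν), enorm_neg]
  have p1 : ‖F 0 ν * symb (lpSymbol χ φ q) (κ + ν) * (dsym 0 κ * Γ κ)‖ₑ ≤
      K' * (‖F 0 ν‖ₑ * hiF q (fun κ => dsym 0 κ * Γ κ) κ + hiF q (F 0) ν * ‖dsym 0 κ * Γ κ‖ₑ) := by
    rw [enorm_mul, enorm_mul, mul_comm ‖F 0 ν‖ₑ, mul_assoc]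
    refine mul_le_mul' hm ?_
    rcases h.mem_hi_or hz with hk | hk
    · rw [hiF_of_mem hk]; exact le_self_add
    · rw [hiF_of_mem hk]; exact le_add_self
  have p2 : ‖F 1 ν * (((symb (lpSymbol χ φ q) (κ + ν) -
      lowSymb χ φ q ν * symb (lpSymbol χ φ q) κ : ℝ) : ℂ) * dsym 1 κ) * Γ κ‖ₑ ≤
      K' * (‖dsym 0 ν * F 0 ν‖ₑ * hiF q Γ κ + ‖dsym 0 ν * F 1 ν‖ₑ * hiF q Γ κ +
        hiF q (F 1) ν * ‖dsym 1 κ * Γ κ‖ₑ) := by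
    rcases hK q κ ν hz with ⟨hk, hb⟩ | ⟨hk, hb⟩
    · have hb' : ‖((symb (lpSymbol χ φ q) (κ + ν) -
          lowSymb χ φ q ν * symb (lpSymbol χ φ q) κ : ℝ) : ℂ) * dsym 1 κ‖ₑ ≤
          K' * (‖dsym 0 ν‖ₑ + ‖dsym 1 ν‖ₑ) := by
        refine (enorm_le_ofReal_of_norm_le (r := K * (‖dsym 0 ν‖ + ‖dsym 1 ν‖)) ?_).trans ?_
        · rw [norm_mul, Complex.norm_real]; exact hb
        · rw [ENNReal.ofReal_mul hK0, ENNReal.ofReal_add (norm_nonneg _) (norm_nonneg _),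
            ofReal_norm, ofReal_norm]
          gcongr
      rw [hiF_of_mem hk, enorm_mul, enorm_mul, ← hF1]
      calc _ ≤ ‖F 1 ν‖ₑ * (K' * (‖dsym 0 ν‖ₑ + ‖dsym 1 ν‖ₑ)) * ‖Γ κ‖ₑ := by gcongr
        _ = K' * (‖dsym 1 ν * F 1 ν‖ₑ * ‖Γ κ‖ₑ + ‖dsym 0 ν * F 1 ν‖ₑ * ‖Γ κ‖ₑ) := by
            simp only [enorm_mul]; ring
        _ ≤ _ := mul_le_mul' le_rfl le_self_add
    · have hb' : ‖((symb (lpSymbol χ φ q) (κ + ν) -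
          lowSymb χ φ q ν * symb (lpSymbol χ φ q) κ : ℝ) : ℂ)‖ₑ ≤ K' := by
        refine (enorm_le_ofReal_of_norm_le (r := K) ?_).trans hKK
        rw [Complex.norm_real]; exact hb
      rw [hiF_of_mem hk, enorm_mul, enorm_mul, enorm_mul]
      calc _ ≤ ‖F 1 ν‖ₑ * (K' * ‖dsym 1 κ‖ₑ) * ‖Γ κ‖ₑ := by gcongr
        _ = K' * (‖F 1 ν‖ₑ * ‖dsym 1 κ * Γ κ‖ₑ) := by
            simp only [enorm_mul]; ring
        _ ≤ _ := mul_le_mul' le_rfl le_add_self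
  refine (mul_le_mul_right ((enorm_add_le _ _).trans (add_le_add p1 p2)) _).trans_eq ?_
  ring

/-- The frequency form of the trilinear estimate. -/
theorem IsDyadicPartition.exists_lintegral_difKernel_bound (h : IsDyadicPartition χ φ) :
    ∃ C : ℝ≥0∞, C ≠ ⊤ ∧ ∀ (q : ℤ) (F : Fin 2 → Freq → ℂ) (Γ H : Freq → ℂ),
      (∀ i, Measurable (F i)) → Measurable Γ → Measurable H →
      (∀ κ, dsym 0 κ * F 0 κ + dsym 1 κ * F 1 κ = 0) → (∀ κ, κ.1 = 0 → F 1 κ = 0) →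
      ∀ X Y Z G12 G2 pf pf' pg pg' ph ph' : ℝ≥0∞,
      (∀ i, nrm21 (fun κ => ‖dsym 0 κ * F i κ‖ₑ) ≤ X) → nrm21 (fun κ => ‖dsym 0 κ * Γ κ‖ₑ) ≤ Y →
      nrm21 (fun κ => ‖F 0 κ‖ₑ) ≤ Z →
      nrm gam (fun κ => ‖dsym 0 κ * (dsym 1 κ * Γ κ)‖ₑ) ≤ G12 →
      nrm gam (fun κ => ‖dsym 1 κ * Γ κ‖ₑ) ≤ G2 →
      nrm gam (hiF q (F 0)) ≤ pf → (∀ i, nrm gam (hiF q fun κ => dsym 0 κ * F i κ) ≤ pf') →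
      nrm gam (hiF q Γ) ≤ pg → nrm gam (hiF q fun κ => dsym 0 κ * Γ κ) ≤ pg' →
      nrm gam (hiF q H) ≤ ph → nrm gam (hiF q fun κ => dsym 0 κ * H κ) ≤ ph' →
      ∫⁻ ν, ∫⁻ κ, ‖difKernel χ φ q F Γ H ν κ‖ₑ ∂gam ∂gam ≤ C *
        (X * (pg' * ph) + Z * (pg' * ph') + Y * (pf' * ph) + Y * (pf * ph') + X * (pg * ph') +
          G12 * (pf' * ph) + G2 * (pf' * ph')) := by
  obtain ⟨K, hK, hsK, hb⟩ := h.exists_difKernel_bound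
  -- One `K` comes from the pointwise bound and one from the symbol in front of `h`. The product `X
  -- * (pg' * ph)` occurs three times, once in `t1` and twice through `t3`.
  refine ⟨K * K * (3 * (sqrtSum + 1)), ENNReal.mul_ne_top (ENNReal.mul_ne_top hK hK)
    (ENNReal.mul_ne_top (by norm_num) (ENNReal.add_ne_top.2 ⟨sqrtSum_ne_top, ENNReal.one_ne_top⟩)),
    fun q F Γ H hF hΓ hH hdiv hF1 X Y Z G12 G2 pf pf' pg pg' ph ph'
    hX hY hZ hG12 hG2 hpf hpf' hpg hpg' hph hph' => ?_⟩
  have hdm : ∀ (i : Fin 2) {U : Freq → ℂ}, Measurable U → Measurable fun κ => dsym i κ * U κ :=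
    fun i _ hU => (measurable_dsym i).mul hU
  have hd0 : ∀ {U : Freq → ℂ}, Measurable U → Measurable fun κ => ‖dsym 0 κ * U κ‖ₑ :=
    fun hU => (hdm 0 hU).enorm
  have hmm : Measurable fun κ => (symb (lpSymbol χ φ q) κ : ℂ) :=
    (h.isNiceSymbol q).measurable_symb_complex
  set c : Freq → ℝ≥0∞ := fun κ => ‖symb (lpSymbol χ φ q) κ * H κ‖ₑ with hc
  have hcm : Measurable c := (hmm.mul hH).enorm
  have hsC : ∀ κ, ‖(symb (lpSymbol χ φ q) κ : ℂ)‖ₑ ≤ K := fun κ => by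
    rw [← ofReal_norm, Complex.norm_real, ofReal_norm]; exact hsK q κ
  have hcle : ∀ U : Freq → ℂ, ∀ κ, ‖symb (lpSymbol χ φ q) κ * U κ‖ₑ ≤ K * hiF q U κ := by
    intro U κ
    by_cases hz : symb (lpSymbol χ φ q) κ = 0
    · simp [hz]
    · rw [hiF_of_mem (h.mem_hi hz), enorm_mul]
      gcongr
      exact hsC κ
  have hnc : nrm gam c ≤ K * ph :=
    (nrm_mono (hcle H)).trans (by rw [nrm_const_mul (measurable_hiF q hH)]; gcongr)
  have hnc' : nrm gam (dmul 0 c) ≤ K * ph' := by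
    have e : dmul 0 c = fun κ => ‖symb (lpSymbol χ φ q) κ * (dsym 0 κ * H κ)‖ₑ := by
      funext κ
      simp only [dmul, hc, enorm_mul]; ring
    rw [e]
    refine (nrm_mono (hcle _)).trans ?_
    rw [nrm_const_mul (measurable_hiF q (hdm 0 hH))]
    gcongr
  have hz0 : ∀ (U : Freq → ℂ) (κ : Freq), κ.1 = 0 → ‖dsym 0 κ * U κ‖ₑ = 0 := fun U κ hκ => by
    simp [dsym_zero, hκ]
  have t1 : tri (fun κ => ‖F 0 κ‖ₑ) (hiF q fun κ => dsym 0 κ * Γ κ) c ≤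
      sqrtSum * X * (pg' * (K * ph)) + Z * (pg' * (K * ph')) := by
    refine (tri_le_sup (hF 0).enorm (measurable_hiF q (hdm 0 hΓ)) hcm
      fun κ hκ => ?_).trans ?_
    · by_cases hk : κ ∈ hi q
      · rw [hiF_of_mem hk, hz0 _ _ hκ]
      · exact Set.indicator_of_notMem hk _
    · rw [dmul_enorm]
      gcongr
      exact hX 0
  have t2 : tri (hiF q (F 0)) (fun κ => ‖dsym 0 κ * Γ κ‖ₑ) c ≤
      Y * (sqrtSum * pf' * (K * ph) + pf * (K * ph')) := by
    rw [tri_swap (measurable_hiF q (hF 0)) (hd0 hΓ) hcm]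
    refine (tri_le_nrm21 (hd0 hΓ) (measurable_hiF q (hF 0)) hcm (hz0 _)).trans ?_
    rw [dmul_hiF]
    gcongr
    exact hpf' 0
  have t3 : ∀ i, tri (fun κ => ‖dsym 0 κ * F i κ‖ₑ) (hiF q Γ) c ≤
      X * (sqrtSum * pg' * (K * ph) + pg * (K * ph')) := by
    intro i
    refine (tri_le_nrm21 (hd0 (hF i)) (measurable_hiF q hΓ) hcm (hz0 _)).trans ?_
    rw [dmul_hiF]
    gcongr
    exact hX i
  -- Agmon's inequality for the high frequencies of `f²`: without zero mode, `f²` is controlled by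
  -- `∂₁f²`, and `|∂₂f²| = |∂₁f¹|`, so horizontal derivatives of `f` bound both factors.
  have hf1 : nrm21 (hiF q (F 1)) ≤ pf' := by
    by_cases htop : pf' = ⊤
    · rw [htop]; exact le_top
    have e1 : nrm gam (hiF q (F 1)) ≤ pf' := by
      refine (nrm_mono fun κ => ?_).trans (hpf' 1)
      by_cases hk : κ ∈ hi q
      · rw [hiF_of_mem hk, hiF_of_mem hk]
        by_cases h0 : κ.1 = 0
        · simp [hF1 κ h0]
        · rw [enorm_mul]
          exact le_mul_of_one_le_left zero_le (one_le_enorm_dsym_zero h0)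
      · simp [hiF, hk]
    have e2 : nrm gam (dmul 1 (hiF q (F 1))) ≤ pf' := by
      refine le_trans (le_of_eq ?_) (hpf' 0)
      rw [dmul_hiF]
      congr 1
      funext κ
      have : ‖dsym 1 κ * F 1 κ‖ₑ = ‖dsym 0 κ * F 0 κ‖ₑ := by
        rw [eq_neg_of_add_eq_zero_right (hdiv κ), enorm_neg]
      unfold hiF
      by_cases hk : κ ∈ hi q
      · simp only [Set.indicator_of_mem hk, this]
      · simp only [Set.indicator_of_notMem hk]
    rw [← ENNReal.ofReal_toReal htop] at e1 e2
    have := nrm21_le (measurable_hiF q (hF 1)) ENNReal.toReal_nonneg ENNReal.toReal_nonneg e1 e2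
    rwa [Real.sqrt_mul_self ENNReal.toReal_nonneg, ENNReal.ofReal_toReal htop] at this
  have t5 : tri (hiF q (F 1)) (fun κ => ‖dsym 1 κ * Γ κ‖ₑ) c ≤
      pf' * (sqrtSum * G12 * (K * ph) + G2 * (K * ph')) := by
    refine (tri_le_nrm21 (measurable_hiF q (hF 1)) (hdm 1 hΓ).enorm hcm
      fun κ hκ => ?_).trans ?_
    · by_cases hk : κ ∈ hi q
      · rw [hiF_of_mem hk, hF1 κ hκ, enorm_zero]
      · exact Set.indicator_of_notMem hk _
    · rw [dmul_enorm]
      gcongr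
  have hsplit : ∫⁻ ν, ∫⁻ κ, ‖difKernel χ φ q F Γ H ν κ‖ₑ ∂gam ∂gam ≤ K *
      (tri (fun κ => ‖F 0 κ‖ₑ) (hiF q fun κ => dsym 0 κ * Γ κ) c +
        tri (hiF q (F 0)) (fun κ => ‖dsym 0 κ * Γ κ‖ₑ) c +
        tri (fun κ => ‖dsym 0 κ * F 0 κ‖ₑ) (hiF q Γ) c +
        tri (fun κ => ‖dsym 0 κ * F 1 κ‖ₑ) (hiF q Γ) c +
        tri (hiF q (F 1)) (fun κ => ‖dsym 1 κ * Γ κ‖ₑ) c) := by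
    have hin : ∀ {b : Freq → ℝ≥0∞} (ν : Freq), Measurable b →
        Measurable fun κ => b κ * c (κ + ν) := fun ν hb =>
      hb.mul (hcm.comp (measurable_add_const ν))
    have hout : ∀ {a b : Freq → ℝ≥0∞}, Measurable a → Measurable b →
        Measurable fun ν => a ν * ∫⁻ κ, b κ * c (κ + ν) ∂gam := fun ha hb =>
      ha.mul (measurable_tri_inner hb hcm)
    have m1 := measurable_hiF q (hdm 0 hΓ)
    have m2 := hd0 hΓ
    have m3 := measurable_hiF q hΓ
    have m5 := (hdm 1 hΓ).enorm
    have n1 := (hF 0).enorm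
    have n2 := measurable_hiF q (hF 0)
    have n3 := hd0 (hF 0)
    have n4 := hd0 (hF 1)
    have n5 := measurable_hiF q (hF 1)
    simp only [tri]
    rw [← lintegral_add_right _ (hout n2 m2), ← lintegral_add_right _ (hout n3 m3),
      ← lintegral_add_right _ (hout n4 m3), ← lintegral_add_right _ (hout n5 m5),
      ← lintegral_const_mul' _ _ hK]
    refine lintegral_mono fun ν => ?_
    refine (lintegral_mono fun κ => hb q F Γ H hdiv ν κ).trans (le_of_eq ?_)
    rw [lintegral_const_mul' _ _ hK]
    congr 1
    rw [lintegral_add_right _ ((hin ν m5).const_mul _),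
      lintegral_add_right _ ((hin ν m3).const_mul _),
      lintegral_add_right _ ((hin ν m3).const_mul _),
      lintegral_add_right _ ((hin ν m2).const_mul _), lintegral_const_mul _ (hin ν m1),
      lintegral_const_mul _ (hin ν m2), lintegral_const_mul _ (hin ν m3),
      lintegral_const_mul _ (hin ν m3), lintegral_const_mul _ (hin ν m5)]
  refine hsplit.trans ?_
  have hs1 : sqrtSum ≤ sqrtSum + 1 := le_self_add
  have hs2 : 1 ≤ sqrtSum + 1 := le_add_self
  calc _ ≤ K * ((sqrtSum * X * (pg' * (K * ph)) + Z * (pg' * (K * ph'))) +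
        Y * (sqrtSum * pf' * (K * ph) + pf * (K * ph')) +
        X * (sqrtSum * pg' * (K * ph) + pg * (K * ph')) +
        X * (sqrtSum * pg' * (K * ph) + pg * (K * ph')) +
        pf' * (sqrtSum * G12 * (K * ph) + G2 * (K * ph'))) := by
        gcongr
        · exact t3 0
        · exact t3 1
    _ = K * K * (sqrtSum * (3 * (X * (pg' * ph)) + Y * (pf' * ph) + G12 * (pf' * ph)) +
          (Z * (pg' * ph') + Y * (pf * ph') + 2 * (X * (pg * ph')) + G2 * (pf' * ph'))) := by ring
    _ ≤ K * K * ((sqrtSum + 1) * (3 * (X * (pg' * ph)) + 3 * (Y * (pf' * ph)) +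
          3 * (G12 * (pf' * ph))) +
          (sqrtSum + 1) * (3 * (Z * (pg' * ph')) + 3 * (Y * (pf * ph')) + 3 * (X * (pg * ph')) +
            3 * (G2 * (pf' * ph')))) := by
        have h3 : ∀ x : ℝ≥0∞, x ≤ 3 * x := fun x =>
          le_mul_of_one_le_left zero_le (by norm_num)
        have h2 : ∀ x : ℝ≥0∞, 2 * x ≤ 3 * x := fun x => mul_le_mul' (by norm_num) le_rfl
        exact mul_le_mul' le_rfl (add_le_add
          (mul_le_mul' hs1 (add_le_add (add_le_add le_rfl (h3 _)) (h3 _)))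
          ((add_le_add (add_le_add (add_le_add (h3 _) (h3 _)) (h2 _)) (h3 _)).trans
            (le_mul_of_one_le_left zero_le hs2)))
    _ = _ := by ring

end frequency

/-! ### Passage from integrals over `Ω` to the frequency side. -/

section pairing

theorem integral_add_sub {α : Type*} [MeasurableSpace α] {μ : Measure α} {a b c : α → ℂ}
    (ha : Integrable a μ) (hb : Integrable b μ) (hc : Integrable c μ) :
    (∫ x, a x ∂μ) + (∫ x, b x ∂μ) - ∫ x, c x ∂μ = ∫ x, (a x + b x - c x) ∂μ := by
  have hab : Integrable (fun x => a x + b x) μ := ha.add hb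
  rw [integral_sub hab hc, integral_add ha hb]

theorem memLp_synth_mul {A : Freq → ℂ} (hA : Integrable A gam) {u : ℝ × ℝ → ℂ}
    (hu : MemLp u 2 muOmega) : MemLp (fun p => synth A p * u p) 2 muOmega :=
  (hu.const_mul ((∫ κ, ‖A κ‖ ∂gam : ℝ) : ℂ)).mono
    ((continuous_synth hA).aestronglyMeasurable.mul hu.1) (Eventually.of_forall fun p => by
      rw [norm_mul, norm_mul]
      gcongr
      exact (norm_synth_le A p).trans (by rw [Complex.norm_real]; exact le_abs_self _))

theorem memLp_comp_add {W : Freq → ℂ} (hW : MemLp W 2 gam) (ν : Freq) :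
    MemLp (fun κ => W (κ + ν)) 2 gam :=
  hW.comp_measurePreserving (measurePreserving_add_right gam ν)

theorem integrable_shift_mul {W B : Freq → ℂ} (hW : MemLp W 2 gam) (hB : MemLp B 2 gam)
    (ν : Freq) : Integrable (fun κ => conj (W (κ + ν)) * B κ) gam :=
  integrable_conj_mul (memLp_comp_add hW ν) hB

theorem integrable_mul_shift_integral {W B A : Freq → ℂ} (hWm : Measurable W) (hBm : Measurable B)
    (hW : MemLp W 2 gam) (hB : MemLp B 2 gam) (hA : Integrable A gam) :
    Integrable (fun ν => A ν * ∫ κ, conj (W (κ + ν)) * B κ ∂gam) gam := by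
  have hm : StronglyMeasurable fun ν => ∫ κ, conj (W (κ + ν)) * B κ ∂gam := by
    refine StronglyMeasurable.integral_prod_right (f := fun ν κ => conj (W (κ + ν)) * B κ)
      (Measurable.stronglyMeasurable ?_)
    exact (Complex.continuous_conj.measurable.comp
      (hWm.comp (measurable_snd.add measurable_fst))).mul (hBm.comp measurable_snd)
  refine hA.mul_bdd (c := (eLpNorm W 2 gam * eLpNorm B 2 gam).toReal) hm.aestronglyMeasurable
    (Eventually.of_forall fun ν => ?_)
  rw [← toReal_enorm]
  refine ENNReal.toReal_mono (ENNReal.mul_ne_top hW.2.ne hB.2.ne) ?_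
  refine (enorm_integral_le_lintegral_enorm _).trans ?_
  calc ∫⁻ κ, ‖conj (W (κ + ν)) * B κ‖ₑ ∂gam = ∫⁻ κ, ‖W (κ + ν)‖ₑ * ‖B κ‖ₑ ∂gam := by
        simp only [enorm_mul, RCLike.enorm_conj]
    _ ≤ _ := lintegral_mul_le_nrm_mul (hWm.comp (measurable_add_const ν)).enorm hBm.enorm
    _ = _ := by
        rw [nrm_enorm gam fun κ => W (κ + ν), nrm_enorm,
          eLpNorm_comp_measurePreserving hW.1 (measurePreserving_add_right gam ν) |>.symm]
        rfl

variable {χ φ : ℝ × ℝ → ℝ}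

theorem IsDyadicPartition.measurable_lowSymb (h : IsDyadicPartition χ φ) (q : ℤ) :
    Measurable fun κ => (lowSymb χ φ q κ : ℂ) :=
  Complex.measurable_ofReal.comp
    (Finset.measurable_sum _ fun j _ => (h.isNiceSymbol j).measurable_symb)

theorem IsDyadicPartition.exists_bound_lowSymb (h : IsDyadicPartition χ φ) (q : ℤ) :
    ∃ M : ℝ, ∀ κ, ‖(lowSymb χ φ q κ : ℂ)‖ ≤ M := by
  obtain ⟨M, hM0, hM⟩ := h.exists_bound_lpSymbol
  exact ⟨4 * M, fun κ => by
    rw [Complex.norm_real]; exact h.abs_sum_le hM0 _ (fun q => hM q _) _⟩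

theorem IsDyadicPartition.integrable_lowSymb_mul (h : IsDyadicPartition χ φ) (q : ℤ) {A : Freq → ℂ}
    (hA : Integrable A gam) : Integrable (fun κ => lowSymb χ φ q κ * A κ) gam := by
  obtain ⟨M, hM⟩ := h.exists_bound_lowSymb q
  exact integrable_bdd_mul_left (h.measurable_lowSymb q) hM hA

/-- The symbol `dsym i * m` is bounded when `m` has bounded support. -/
theorem IsNiceSymbol.exists_bound_dsym_mul {m : ℝ × ℝ → ℝ} (hm : IsNiceSymbol m) (i : Fin 2) :
    ∃ M : ℝ, ∀ κ, ‖dsym i κ * symb m κ‖ ≤ M := by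
  obtain ⟨M, hM⟩ := hm.exists_bound
  obtain ⟨R, hR⟩ := hm.bounded
  have hM0 : 0 ≤ M := (norm_nonneg _).trans (hM 0)
  refine ⟨|R| * M, fun κ => ?_⟩
  by_cases hz : symb m κ = 0
  · rw [hz]; simpa using mul_nonneg (abs_nonneg R) hM0
  · rw [norm_mul]
    refine mul_le_mul ?_ (hM κ) (norm_nonneg _) (abs_nonneg _)
    fin_cases i
    · exact (norm_dsym_zero κ).trans_le ((hR _ hz).1.trans (le_abs_self R))
    · exact (norm_dsym_one κ).trans_le ((hR _ hz).2.trans (le_abs_self R))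

theorem IsNiceSymbol.memLp_dsym_mul {m : ℝ × ℝ → ℝ} (hm : IsNiceSymbol m) (i : Fin 2)
    {U : Freq → ℂ} (hU : MemLp U 2 gam) :
    MemLp (fun κ => dsym i κ * (symb m κ * U κ)) 2 gam := by
  obtain ⟨M, hM⟩ := hm.exists_bound_dsym_mul i
  simpa only [Pi.mul_apply, mul_assoc] using
    memLp_bdd_mul_left ((measurable_dsym i).mul hm.measurable_symb_complex) hM hU

theorem IsNiceSymbol.integrable_dsym_mul {m : ℝ × ℝ → ℝ} (hm : IsNiceSymbol m) (i : Fin 2)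
    {U : Freq → ℂ} (hU : MemLp U 2 gam) :
    Integrable (fun κ => dsym i κ * (symb m κ * U κ)) gam := by
  obtain ⟨M, hM⟩ := hm.exists_bound
  obtain ⟨R, hR⟩ := hm.bounded
  -- Cutting `dsym i` off to the support of the symbol makes it bounded and leaves the product
  -- unchanged.
  have hc : Measurable fun κ => dsym i κ * {κ | symb m κ ≠ 0}.indicator (1 : Freq → ℂ) κ :=
    (measurable_dsym i).mul (measurable_one.indicator
      (hm.measurable_symb (measurableSet_singleton 0).compl))
  refine (integrable_bdd_mul_left hc (M := |R|) (fun κ => ?_) (hm.integrable_symb_mul hU)).congr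
    (Eventually.of_forall fun κ => ?_)
  · by_cases hz : symb m κ = 0
    · simp [hz]
    · rw [Set.indicator_of_mem (by exact hz), Pi.one_apply, mul_one]
      fin_cases i
      · exact (norm_dsym_zero κ).trans_le ((hR _ hz).1.trans (le_abs_self R))
      · exact (norm_dsym_one κ).trans_le ((hR _ hz).2.trans (le_abs_self R))
  · by_cases hz : symb m κ = 0
    · simp [hz]
    · simp [hz]

/-- As the symbol is real, the `Δ_q` acting on the product moves onto `h`, which leaves the bare
product `f · ∇g`. Both integrals then become convolution forms over the same pairs `(ν, κ)` and are
subtracted under the integral sign. -/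
theorem IsDyadicPartition.enorm_trilinear_sub_le (h : IsDyadicPartition χ φ) (q : ℤ)
    {v : ℝ × ℝ → ℂ} {f b : Fin 2 → ℝ × ℝ → ℂ} {V Γ H : Freq → ℂ} {F : Fin 2 → Freq → ℂ}
    (hV : IsFT v V) (hv : v = fun p => f 0 p * b 0 p + f 1 p * b 1 p)
    (hF : ∀ i, IsFT (f i) (F i)) (hF1 : ∀ i, Integrable (F i) gam) (hΓm : Measurable Γ)
    (hΓ : MemLp Γ 2 gam) (hB : ∀ i, IsFT (b i) fun κ => dsym i κ * Γ κ) (hHm : Measurable H)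
    (hH : MemLp H 2 gam) :
    ‖(∫ p, conj (synth (fun κ => symb (lpSymbol χ φ q) κ * H κ) p) *
          synth (fun κ => symb (lpSymbol χ φ q) κ * V κ) p ∂muOmega) -
        ∫ p, conj (synth (fun κ => symb (lpSymbol χ φ q) κ * H κ) p) *
          (synth (fun κ => lowSymb χ φ q κ * F 1 κ) p *
            synth (fun κ => dsym 1 κ * (symb (lpSymbol χ φ q) κ * Γ κ)) p) ∂muOmega‖ₑ ≤
      ∫⁻ ν, ∫⁻ κ, ‖difKernel χ φ q F Γ H ν κ‖ₑ ∂gam ∂gam := by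
  have hm := h.isNiceSymbol q
  set m : Freq → ℂ := fun κ => symb (lpSymbol χ φ q) κ with hmdef
  have hmm : Measurable m := hm.measurable_symb_complex
  have hW1 : Integrable (fun κ => m κ * H κ) gam := hm.integrable_symb_mul hH
  have hW2 : MemLp (fun κ => m κ * H κ) 2 gam := hm.memLp_symb_mul hH
  have hWm : Measurable fun κ => m κ * H κ := hmm.mul hHm
  have hX1 : Integrable (fun κ => m κ * (m κ * H κ)) gam := hm.integrable_symb_mul hW2
  have hX2 : MemLp (fun κ => m κ * (m κ * H κ)) 2 gam := hm.memLp_symb_mul hW2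
  have hXm : Measurable fun κ => m κ * (m κ * H κ) := hmm.mul (hmm.mul hHm)
  have e1 : ∫ p, conj (synth (fun κ => m κ * H κ) p) * synth (fun κ => m κ * V κ) p ∂muOmega =
      ∑ i, ∫ ν, F i ν * ∫ κ, conj (m (κ + ν) * (m (κ + ν) * H (κ + ν))) *
        (dsym i κ * Γ κ) ∂gam ∂gam := by
    have a1 := (isFT_synth (hmm.mul hV.measurable) (hm.integrable_symb_mul hV.memLp_right)
      (hm.memLp_symb_mul hV.memLp_right)).pairing _ hW1 hW2
    have a2 := hV.pairing _ hX1 hX2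
    have a3 : ∫ κ, conj (m κ * H κ) * (m κ * V κ) ∂gam =
        ∫ κ, conj (m κ * (m κ * H κ)) * V κ ∂gam := by
      refine integral_congr_ae (Eventually.of_forall fun κ => ?_)
      simp only [hmdef, map_mul, Complex.conj_ofReal]
      ring
    have a4 : ∀ i, f i =ᵐ[muOmega] synth (F i) := fun i => (hF i).ae_eq_synth (hF1 i)
    refine a1.trans (a3.trans (a2.symm.trans ?_))
    have a5 : ∫ p, conj (synth (fun κ => m κ * (m κ * H κ)) p) * v p ∂muOmega =
        ∫ p, (conj (synth (fun κ => m κ * (m κ * H κ)) p) * (synth (F 0) p * b 0 p) +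
          conj (synth (fun κ => m κ * (m κ * H κ)) p) * (synth (F 1) p * b 1 p)) ∂muOmega := by
      refine integral_congr_ae ?_
      filter_upwards [a4 0, a4 1] with p h0 h1
      rw [hv]
      simp only [h0, h1]
      ring
    have hi : ∀ i, Integrable (fun p => conj (synth (fun κ => m κ * (m κ * H κ)) p) *
        (synth (F i) p * b i p)) muOmega := fun i =>
      integrable_conj_mul (memLp_synth hX1 hX2) (memLp_synth_mul (hF1 i) (hB i).memLp_left)
    rw [a5, integral_add (hi 0) (hi 1), Fin.sum_univ_two,
      IsFT.integral_conj_synth_mul_synth_mul hX1 hX2 (hF1 0) (hB 0),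
      IsFT.integral_conj_synth_mul_synth_mul hX1 hX2 (hF1 1) (hB 1)]
  have hL := h.integrable_lowSymb_mul q (hF1 1)
  have hDm : Measurable fun κ => dsym 1 κ * (m κ * Γ κ) := (measurable_dsym 1).mul (hmm.mul hΓm)
  have hD := isFT_synth hDm (hm.integrable_dsym_mul 1 hΓ) (hm.memLp_dsym_mul 1 hΓ)
  rw [e1, IsFT.integral_conj_synth_mul_synth_mul hW1 hW2 hL hD, Fin.sum_univ_two]
  have j0 := integrable_mul_shift_integral hXm (hB 0).measurable hX2 (hB 0).memLp_right (hF1 0)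
  have j1 := integrable_mul_shift_integral hXm (hB 1).measurable hX2 (hB 1).memLp_right (hF1 1)
  have jr := integrable_mul_shift_integral hWm hDm hW2 hD.memLp_right hL
  rw [integral_add_sub j0 j1 jr]
  refine (enorm_integral_le_lintegral_enorm _).trans (lintegral_mono fun ν => ?_)
  have i0 := integrable_shift_mul hX2 (hB 0).memLp_right ν
  have i1 := integrable_shift_mul hX2 (hB 1).memLp_right ν
  have ir := integrable_shift_mul hW2 hD.memLp_right ν
  refine (le_of_eq ?_).trans (enorm_integral_le_lintegral_enorm _)
  congr 1
  rw [← integral_const_mul, ← integral_const_mul, ← integral_const_mul,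
    integral_add_sub (i0.const_mul _) (i1.const_mul _) (ir.const_mul _)]
  rfl

end pairing

/-! ### Components of vector fields and incompressibility. -/

section fields

/-- A component of a vector field, as a complex valued function. -/
def cpt (u : ℝ × ℝ → Vec) (i : Fin 2) (p : ℝ × ℝ) : ℂ := ((u p i : ℝ) : ℂ)

def cptCLM (i : Fin 2) : Vec →L[ℝ] ℂ :=
  Complex.ofRealCLM ∘L (EuclideanSpace.proj i : Vec →L[ℝ] ℝ)

theorem norm_cpt_le (u : ℝ × ℝ → Vec) (i : Fin 2) (p : ℝ × ℝ) : ‖cpt u i p‖ ≤ ‖u p‖ := by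
  rw [cpt, Complex.norm_real]
  exact PiLp.norm_apply_le _ _

theorem memLp_cpt {u : ℝ × ℝ → Vec} (hu : MemLp u 2 muOmega) (i : Fin 2) :
    MemLp (cpt u i) 2 muOmega :=
  (cptCLM i).comp_memLp' hu

theorem eLpNorm_cpt_le (u : ℝ × ℝ → Vec) (i : Fin 2) :
    eLpNorm (cpt u i) 2 muOmega ≤ eLpNorm u 2 muOmega :=
  eLpNorm_mono (norm_cpt_le u i)

theorem sum_enorm_cpt_sq (u : ℝ × ℝ → Vec) (p : ℝ × ℝ) : ∑ i, ‖cpt u i p‖ₑ ^ 2 = ‖u p‖ₑ ^ 2 := by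
  have : ‖u p‖ ^ 2 = ∑ i, ‖cpt u i p‖ ^ 2 := by
    rw [EuclideanSpace.norm_sq_eq]
    simp only [cpt, Complex.norm_real]
  simp only [← ofReal_norm]
  rw [← ENNReal.ofReal_pow (norm_nonneg _), this,
    ENNReal.ofReal_sum_of_nonneg fun i _ => by positivity]
  exact Finset.sum_congr rfl fun i _ => (ENNReal.ofReal_pow (norm_nonneg _) 2).symm

theorem sum_eLpNorm_cpt_sq {u : ℝ × ℝ → Vec} (hu : Continuous u) :
    ∑ i, eLpNorm (cpt u i) 2 muOmega ^ 2 = eLpNorm u 2 muOmega ^ 2 := by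
  simp only [eLpNorm_two_sq]
  rw [← lintegral_finsetSum _ fun i _ => by
    have : Continuous (cpt u i) := (cptCLM i).continuous.comp hu
    exact this.measurable.enorm.pow_const 2]
  exact lintegral_congr fun p => sum_enorm_cpt_sq u p

theorem memLp_of_cpt {u : ℝ × ℝ → Vec} (hu : Continuous u)
    (h : ∀ i, MemLp (cpt u i) 2 muOmega) : MemLp u 2 muOmega := by
  refine ⟨hu.aestronglyMeasurable, ?_⟩
  have : eLpNorm u 2 muOmega ^ 2 < ⊤ := by
    rw [← sum_eLpNorm_cpt_sq hu]
    exact ENNReal.sum_lt_top.2 fun i _ => ENNReal.pow_lt_top (h i).2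
  by_contra hc
  rw [not_lt, top_le_iff] at hc
  simp [hc] at this

theorem d1_cpt {u : ℝ × ℝ → Vec} {p : ℝ × ℝ} (hu : DifferentiableAt ℝ u p) (i : Fin 2) :
    d1 (cpt u i) p = cpt (d1 u) i p := by
  exact congrArg (fun L : ℝ × ℝ →L[ℝ] ℂ => L (1, 0))
    ((cptCLM i).hasFDerivAt.comp p hu.hasFDerivAt).fderiv

theorem d2_cpt {u : ℝ × ℝ → Vec} {p : ℝ × ℝ} (hu : DifferentiableAt ℝ u p) (i : Fin 2) :
    d2 (cpt u i) p = cpt (d2 u) i p := by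
  exact congrArg (fun L : ℝ × ℝ →L[ℝ] ℂ => L (0, 1))
    ((cptCLM i).hasFDerivAt.comp p hu.hasFDerivAt).fderiv

namespace IsSmoothField

variable {u : ℝ × ℝ → Vec}

theorem continuous (hu : IsSmoothField u) : Continuous u := hu.smooth.continuous

theorem differentiable (hu : IsSmoothField u) : Differentiable ℝ u :=
  hu.smooth.differentiable (by simp)

theorem contDiff_cpt (hu : IsSmoothField u) (i : Fin 2) : ContDiff ℝ 1 (cpt u i) :=
  (cptCLM i).contDiff.comp (hu.smooth.of_le (by norm_cast))

theorem cpt_periodic (hu : IsSmoothField u) (i : Fin 2) (x y : ℝ) :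
    cpt u i (x + 1, y) = cpt u i (x, y) := by
  rw [cpt, hu.periodic, cpt]

theorem fderiv_apply (hu : IsSmoothField u) (v : ℝ × ℝ) :
    IsSmoothField fun p => fderiv ℝ u p v := by
  refine ⟨(hu.smooth.fderiv_right (m := ∞) (by simp)).clm_apply contDiff_const, fun x y => ?_⟩
  have : (fun p : ℝ × ℝ => u (p + (1, 0))) = u := by
    funext p
    rw [← hu.periodic p.1 p.2]
    congr 1
    ext <;> simp
  have h2 := fderiv_comp_add_right (𝕜 := ℝ) (f := u) (x := (x, y)) (1, 0)
  rw [this] at h2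
  rw [h2]
  simp

theorem d1 (hu : IsSmoothField u) : IsSmoothField (d1 u) := hu.fderiv_apply _

theorem d2 (hu : IsSmoothField u) : IsSmoothField (d2 u) := hu.fderiv_apply _

theorem isFT_d1 (hu : IsSmoothField u) (h : MemLp (TorusLine.d1 u) 2 muOmega) {i : Fin 2}
    {U : Freq → ℂ} (hU : IsFT (cpt u i) U) :
    IsFT (cpt (TorusLine.d1 u) i) fun κ => dsym 0 κ * U κ := by
  have e : TorusLine.d1 (cpt u i) = cpt (TorusLine.d1 u) i :=
    funext fun p => d1_cpt (hu.differentiable p) i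
  rw [← e]
  exact IsFT.d1 (hu.contDiff_cpt i) (hu.cpt_periodic i) hU (by rw [e]; exact memLp_cpt h i)

theorem isFT_d2 (hu : IsSmoothField u) (h : MemLp (TorusLine.d2 u) 2 muOmega) {i : Fin 2}
    {U : Freq → ℂ} (hU : IsFT (cpt u i) U) :
    IsFT (cpt (TorusLine.d2 u) i) fun κ => dsym 1 κ * U κ := by
  have e : TorusLine.d2 (cpt u i) = cpt (TorusLine.d2 u) i :=
    funext fun p => d2_cpt (hu.differentiable p) i
  rw [← e]
  exact IsFT.d2 (hu.contDiff_cpt i) hU (by rw [e]; exact memLp_cpt h i)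

end IsSmoothField

theorem exists_isFT_cpt {u : ℝ × ℝ → Vec} (hu : MemLp u 2 muOmega) :
    ∃ U : Fin 2 → Freq → ℂ, ∀ i, IsFT (cpt u i) (U i) := by
  choose U hU _ using fun i => exists_isFT (memLp_cpt hu i)
  exact ⟨U, hU⟩

theorem nrm_le_of_isFT {u : ℝ × ℝ → Vec} (hu : MemLp u 2 muOmega) {i : Fin 2} {U : Freq → ℂ}
    (hU : IsFT (cpt u i) U) : nrm gam (fun κ => ‖U κ‖ₑ) ≤ ENNReal.ofReal (normL2 u) := by
  rw [nrm_enorm, normL2, ENNReal.ofReal_toReal hu.2.ne]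
  exact hU.eLpNorm_le.trans (eLpNorm_cpt_le u i)

theorem IsFT.neg {u : ℝ × ℝ → ℂ} {U : Freq → ℂ} (hU : IsFT u U) :
    IsFT (fun p => -u p) fun κ => -U κ where
  memLp_left := hU.memLp_left.neg
  measurable := hU.measurable.neg
  memLp_right := hU.memLp_right.neg
  pairing W h1 h2 := by
    simp only [mul_neg, integral_neg, hU.pairing W h1 h2]

theorem ae_snd_ne_zero : ∀ᵐ κ ∂gam, κ.2 ≠ 0 := by
  rw [ae_iff]
  simp only [not_not]
  have hm : MeasurableSet {κ : Freq | κ.2 = 0} := measurable_snd (measurableSet_singleton 0)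
  rw [← lintegral_indicator_one hm, lintegral_gam (measurable_one.indicator hm).aemeasurable,
    ENNReal.tsum_eq_zero]
  intro k
  have : (fun η : ℝ => {κ : Freq | κ.2 = 0}.indicator (1 : Freq → ℝ≥0∞) (k, η)) =
      ({0} : Set ℝ).indicator 1 := by
    funext η
    by_cases h : η = 0 <;> simp [Set.indicator, h]
  rw [this, lintegral_indicator_one (measurableSet_singleton 0)]
  simp

/-- The Fourier coefficients of a divergence free field can be chosen so that the divergence
relation holds at every frequency. -/
theorem exists_isFT_divergence_free {f : ℝ × ℝ → Vec} (hf : IsSmoothField f)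
    (hdiv : ∀ p, divergence f p = 0) (h0 : MemLp f 2 muOmega) (h1 : MemLp (d1 f) 2 muOmega)
    (h2 : MemLp (d2 f) 2 muOmega) :
    ∃ F : Fin 2 → Freq → ℂ, (∀ i, IsFT (cpt f i) (F i)) ∧
      (∀ κ, dsym 0 κ * F 0 κ + dsym 1 κ * F 1 κ = 0) ∧ ∀ κ : Freq, κ.1 = 0 → F 1 κ = 0 := by
  obtain ⟨U, hU⟩ := exists_isFT_cpt h0
  have e : cpt (d1 f) 0 = fun p => -cpt (d2 f) 1 p := by
    funext p
    have := hdiv p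
    rw [divergence] at this
    simp only [cpt]
    rw [eq_neg_of_add_eq_zero_left this]
    push_cast; ring
  have hae := (hf.isFT_d1 h1 (hU 0)).ae_unique (e ▸ (hf.isFT_d2 h2 (hU 1)).neg)
  -- The set `S` has full measure, so the transforms may be set to zero off it. On `S` with `κ.1 =
  -- 0` the relation reads `2πi κ.2 F¹ = 0` with `κ.2 ≠ 0`, where `F¹` is the transform of the
  -- second component.
  set S : Set Freq := {κ | dsym 0 κ * U 0 κ + dsym 1 κ * U 1 κ = 0} ∩ {κ | κ.2 ≠ 0} with hS
  have hSm : MeasurableSet S := by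
    refine MeasurableSet.inter ?_ (measurable_snd (measurableSet_singleton 0).compl)
    exact (((measurable_dsym 0).mul (hU 0).measurable).add
      ((measurable_dsym 1).mul (hU 1).measurable)) (measurableSet_singleton 0)
  have hSae : ∀ᵐ κ ∂gam, κ ∈ S := by
    filter_upwards [hae, ae_snd_ne_zero] with κ a b
    exact ⟨by simp [a], b⟩
  refine ⟨fun i => S.indicator (U i), fun i => ?_, fun κ => ?_, fun κ hκ => ?_⟩
  · refine (hU i).congr_right ((hU i).measurable.indicator hSm) ?_
    filter_upwards [hSae] with κ hκ
    rw [Set.indicator_of_mem hκ]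
  · by_cases hκ : κ ∈ S
    · simp only [Set.indicator_of_mem hκ]
      exact hκ.1
    · simp [Set.indicator_of_notMem hκ]
  · show S.indicator (U 1) κ = 0
    by_cases hk : κ ∈ S
    · rw [Set.indicator_of_mem hk]
      have h3 := hk.1
      have h4 : (κ.2 : ℂ) ≠ 0 := Complex.ofReal_ne_zero.2 hk.2
      simp only [Set.mem_ofPred_eq, dsym_zero, dsym_one, hκ, Int.cast_zero, mul_zero, zero_mul,
        zero_add] at h3
      simpa [Real.pi_ne_zero, h4] using h3
    · exact Set.indicator_of_notMem hk _

/-- The zero mode is the mean in `x`. It vanishes for almost every `y`, hence for all by continuity,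
so `f²` may replace its oscillating part in the remainder. -/
theorem til_eq_of_isFT {f : ℝ × ℝ → Vec} (hf : Continuous f) {i : Fin 2} {F : Freq → ℂ}
    (hF : IsFT (cpt f i) F) (h : ∀ κ : Freq, κ.1 = 0 → F κ = 0) :
    til (fun p => f p i) = fun p => f p i := by
  have hc : Continuous fun y => ∫ x in (0 : ℝ)..1, f (x, y) i := by
    refine intervalIntegral.continuous_parametric_intervalIntegral_of_continuous' ?_ 0 1
    have : Continuous fun z : ℝ × ℝ => f (z.2, z.1) := hf.comp (by fun_prop)
    exact (EuclideanSpace.proj i : Vec →L[ℝ] ℝ).continuous.comp this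
  have h0 : (fun y => ∫ x in (0 : ℝ)..1, f (x, y) i) =ᵐ[volume] fun _ => 0 := by
    filter_upwards [hF.coeff_eq_zero 0 (Eventually.of_forall h)] with y hy
    have hw : ∀ x : ℝ, wave (0, 0) (x, 0) = 1 := fun x => by simp [wave]
    simp only [hw, map_one, one_mul, cpt, intervalIntegral.integral_ofReal] at hy
    exact Complex.ofReal_eq_zero.1 hy
  have h1 := (Continuous.ae_eq_iff_eq volume hc continuous_const).1 h0
  funext p
  have := congrFun h1 p.2
  simp only at this
  rw [til, bar, this, sub_zero]

end fields

/-! ### Dyadic blocks and the `H^s` norm on the frequency side. -/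

section blocks

variable {χ φ : ℝ × ℝ → ℝ}

namespace IsDyadicPartition

theorem cpt_lpBlock (h : IsDyadicPartition χ φ) (q : ℤ) {u : ℝ × ℝ → Vec} (hu : Continuous u)
    (hp : ∀ x y, u (x + 1, y) = u (x, y)) (hU : MemLp u 2 muOmega) {i : Fin 2} {U : Freq → ℂ}
    (hFT : IsFT (cpt u i) U) :
    cpt (lpBlock χ φ q u) i = synth fun κ => symb (lpSymbol χ φ q) κ * U κ := by
  funext p
  have hc : Continuous fun p => u p i :=
    (EuclideanSpace.proj i : Vec →L[ℝ] ℝ).continuous.comp hu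
  rw [cpt, lpBlock, IsNiceSymbol.multiplier_apply (h.isNiceSymbol q) hu hp hU,
    IsNiceSymbol.multiplier_eq_synth (h.isNiceSymbol q) hc (fun x y => by rw [hp]) hFT]

theorem differentiable_lpBlock (h : IsDyadicPartition χ φ) (q : ℤ) {u : ℝ × ℝ → Vec}
    (hu : Continuous u) (hp : ∀ x y, u (x + 1, y) = u (x, y)) (hU : MemLp u 2 muOmega) :
    Differentiable ℝ (lpBlock χ φ q u) := by
  obtain ⟨U, hFT⟩ := exists_isFT_cpt hU
  refine differentiable_euclidean.2 fun i => ?_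
  have e : (fun p => lpBlock χ φ q u p i) =
      fun p => Complex.reCLM (synth (fun κ => symb (lpSymbol χ φ q) κ * U i κ) p) := by
    funext p
    rw [← h.cpt_lpBlock q hu hp hU (hFT i)]
    simp [cpt]
  rw [e]
  have hm := h.isNiceSymbol q
  exact Complex.reCLM.differentiable.comp fun p => (hasFDerivAt_synth
    (hm.integrable_symb_mul (hFT i).memLp_right)
    (fun j => hm.integrable_dsym_mul j (hFT i).memLp_right) p).differentiableAt

theorem cpt_d2_lpBlock (h : IsDyadicPartition χ φ) (q : ℤ) {u : ℝ × ℝ → Vec} (hu : Continuous u)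
    (hp : ∀ x y, u (x + 1, y) = u (x, y)) (hU : MemLp u 2 muOmega) {i : Fin 2} {U : Freq → ℂ}
    (hFT : IsFT (cpt u i) U) :
    cpt (d2 (lpBlock χ φ q u)) i =
      synth fun κ => dsym 1 κ * (symb (lpSymbol χ φ q) κ * U κ) := by
  funext p
  have hm := h.isNiceSymbol q
  rw [← d2_cpt (h.differentiable_lpBlock q hu hp hU p), h.cpt_lpBlock q hu hp hU hFT,
    d2_synth (hm.integrable_symb_mul hFT.memLp_right)
      (fun j => hm.integrable_dsym_mul j hFT.memLp_right)]

theorem lpLow_eq_synth (h : IsDyadicPartition χ φ) (q : ℤ) {u : ℝ × ℝ → ℝ} (hu : Continuous u)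
    (hp : ∀ x y, u (x + 1, y) = u (x, y)) {U : Freq → ℂ} (hU : IsFT (fun p => (u p : ℂ)) U)
    (p : ℝ × ℝ) :
    ((lpLow χ φ q u p : ℝ) : ℂ) = synth (fun κ => lowSymb χ φ q κ * U κ) p := by
  rw [lpLow, Complex.ofReal_sum]
  simp only [lpBlock]
  rw [Finset.sum_congr rfl fun j _ => IsNiceSymbol.multiplier_eq_synth (h.isNiceSymbol j) hu hp hU p]
  simp only [synth]
  rw [← integral_finsetSum _ fun j _ =>
    integrable_mul_wave ((h.isNiceSymbol j).integrable_symb_mul hU.memLp_right) p]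
  congr 1
  funext κ
  rw [lowSymb, Complex.ofReal_sum, Finset.sum_mul, Finset.sum_mul]

theorem continuous_lpBlock (h : IsDyadicPartition χ φ) (q : ℤ) {u : ℝ × ℝ → Vec}
    (hu : Continuous u) (hp : ∀ x y, u (x + 1, y) = u (x, y)) (hU : MemLp u 2 muOmega) :
    Continuous (lpBlock χ φ q u) := (h.differentiable_lpBlock q hu hp hU).continuous

end IsDyadicPartition

/-- The `L²` norm of the part of a field carried by the frequencies that are not much smaller than
`2^q`. -/
def hiNorm (q : ℤ) (U : Fin 2 → Freq → ℂ) : ℝ≥0∞ := (∑ i, nrm gam (hiF q (U i)) ^ 2) ^ (1 / 2 : ℝ)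

theorem hiNorm_sq (q : ℤ) (U : Fin 2 → Freq → ℂ) :
    hiNorm q U ^ 2 = ∑ i, nrm gam (hiF q (U i)) ^ 2 := by
  rw [hiNorm, ← ENNReal.rpow_natCast, ← ENNReal.rpow_mul]
  norm_num

theorem nrm_hiF_le (q : ℤ) (U : Fin 2 → Freq → ℂ) (i : Fin 2) :
    nrm gam (hiF q (U i)) ≤ hiNorm q U := by
  refine (ENNReal.pow_le_pow_left_iff (n := 2) two_ne_zero).1 ?_
  rw [hiNorm_sq]
  exact Finset.single_le_sum (f := fun i => nrm gam (hiF q (U i)) ^ 2) (fun _ _ => zero_le)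
    (Finset.mem_univ i)

/-- By Plancherel both sides are integrals of `|U|²` against a sum over `q` of weights, so the
pointwise `exists_weight_bound` suffices. -/
theorem IsDyadicPartition.exists_tsum_hiNorm_le (h : IsDyadicPartition χ φ) {s : ℝ} (hs : 0 < s) :
    ∃ K : ℝ, 0 ≤ K ∧ ∀ (u : ℝ × ℝ → Vec) (U : Fin 2 → Freq → ℂ), Continuous u →
      (∀ x y, u (x + 1, y) = u (x, y)) → MemLp u 2 muOmega → (∀ i, IsFT (cpt u i) (U i)) →
      ∑' q : ℤ, ENNReal.ofReal ((2 : ℝ) ^ (2 * (q : ℝ) * s)) * hiNorm q U ^ 2 ≤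
        ENNReal.ofReal K * eNormHs χ φ s u ^ 2 := by
  obtain ⟨K, hK0, hK⟩ := h.exists_weight_bound hs
  refine ⟨K, hK0, fun u U hu hp hU hFT => ?_⟩
  have e1 : eNormHs χ φ s u ^ 2 = ∑' q : ℤ, ENNReal.ofReal ((2 : ℝ) ^ (2 * (q : ℝ) * s)) *
      ∑ i, ∫⁻ κ, ‖symb (lpSymbol χ φ q) κ‖ₑ ^ 2 * ‖U i κ‖ₑ ^ 2 ∂gam := by
    rw [eNormHs, ← ENNReal.rpow_natCast, ← ENNReal.rpow_mul]
    rw [show (1 / 2 : ℝ) * ((2 : ℕ) : ℝ) = 1 by norm_num, ENNReal.rpow_one]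
    refine tsum_congr fun q => ?_
    rw [← sum_eLpNorm_cpt_sq (h.continuous_lpBlock q hu hp hU)]
    refine congrArg _ (Finset.sum_congr rfl fun i _ => ?_)
    have hm := h.isNiceSymbol q
    rw [h.cpt_lpBlock q hu hp hU (hFT i), eLpNorm_synth
      (hm.integrable_symb_mul (hFT i).memLp_right) (hm.memLp_symb_mul (hFT i).memLp_right),
      eLpNorm_two_sq]
    refine lintegral_congr fun κ => ?_
    rw [enorm_mul, mul_pow]
    congr 2
    rw [← ofReal_norm, Complex.norm_real, ofReal_norm]
  have hsm : ∀ q : ℤ, Measurable fun κ => ‖symb (lpSymbol χ φ q) κ‖ₑ ^ 2 := fun q =>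
    (h.isNiceSymbol q).measurable_symb.enorm.pow_const 2
  have hUm : ∀ i, Measurable fun κ => ‖U i κ‖ₑ ^ 2 := fun i =>
    (hFT i).measurable.enorm.pow_const 2
  have hind : ∀ q : ℤ, Measurable ((hi q).indicator (1 : Freq → ℝ≥0∞)) := fun q =>
    measurable_one.indicator (measurableSet_hi q)
  have e2 : ∀ (w : ℤ → ℝ≥0∞) (a : ℤ → Freq → ℝ≥0∞), (∀ q, Measurable (a q)) →
      ∑' q, w q * ∑ i, ∫⁻ κ, a q κ * ‖U i κ‖ₑ ^ 2 ∂gam =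
        ∑ i, ∫⁻ κ, (∑' q, w q * a q κ) * ‖U i κ‖ₑ ^ 2 ∂gam := by
    intro w a ha
    simp only [Finset.mul_sum]
    rw [Summable.tsum_finsetSum fun i _ => ENNReal.summable]
    refine Finset.sum_congr rfl fun i _ => ?_
    simp only [← ENNReal.tsum_mul_right]
    have hm : ∀ q, Measurable fun κ => w q * a q κ * ‖U i κ‖ₑ ^ 2 := fun q =>
      ((ha q).const_mul _).mul (hUm i)
    rw [lintegral_tsum fun q => (hm q).aemeasurable]
    refine tsum_congr fun q => ?_
    have hm' : Measurable fun κ => a q κ * ‖U i κ‖ₑ ^ 2 := (ha q).mul (hUm i)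
    rw [← lintegral_const_mul _ hm']
    simp only [mul_assoc]
  have e3 : ∀ q, hiNorm q U ^ 2 =
      ∑ i, ∫⁻ κ, (hi q).indicator 1 κ * ‖U i κ‖ₑ ^ 2 ∂gam := by
    intro q
    rw [hiNorm_sq]
    refine Finset.sum_congr rfl fun i _ => ?_
    rw [nrm_sq]
    refine lintegral_congr fun κ => ?_
    by_cases hk : κ ∈ hi q <;> simp [hiF, hk]
  simp only [e3]
  rw [e1, e2 _ _ hind, e2 _ _ hsm, Finset.mul_sum]
  refine Finset.sum_le_sum fun i _ => ?_
  rw [← lintegral_const_mul' _ _ ENNReal.ofReal_ne_top]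
  refine lintegral_mono fun κ => ?_
  rw [← mul_assoc]
  exact mul_le_mul' (hK κ) le_rfl

end blocks

/-! ### The bound for the difference in terms of the fields. -/

section physical

variable {χ φ : ℝ × ℝ → ℝ}

theorem ofReal_inner (u v : ℝ × ℝ → Vec) (p : ℝ × ℝ) :
    ((inner ℝ (u p) (v p) : ℝ) : ℂ) = ∑ i, conj (cpt v i p) * cpt u i p := by
  simp [cpt, PiLp.inner_apply]

theorem cpt_convect (f g : ℝ × ℝ → Vec) (j : Fin 2) :
    cpt (convect f g) j = fun p => cpt f 0 p * cpt (d1 g) j p + cpt f 1 p * cpt (d2 g) j p := by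
  funext p
  simp [cpt, convect]

theorem nrm21_le_of_isFT {u v : ℝ × ℝ → Vec} (hu : MemLp u 2 muOmega) (hv : MemLp v 2 muOmega)
    {i : Fin 2} {U V : Freq → ℂ} (hU : IsFT (cpt u i) U) (hV : IsFT (cpt v i) V)
    (e : ∀ κ, dsym 1 κ * U κ = V κ) :
    nrm21 (fun κ => ‖U κ‖ₑ) ≤ ENNReal.ofReal √(normL2 u * normL2 v) := by
  refine nrm21_le hU.measurable.enorm ENNReal.toReal_nonneg ENNReal.toReal_nonneg
    (nrm_le_of_isFT hu hU) ?_
  rw [dmul_enorm]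
  simp only [e]
  exact nrm_le_of_isFT hv hV

theorem integrable_of_ofReal {α : Type*} [MeasurableSpace α] {μ : Measure α} {u : α → ℝ}
    {v : α → ℂ} (h : ∀ x, (u x : ℂ) = v x) (hv : Integrable v μ) : Integrable u μ := by
  refine hv.re.congr (Eventually.of_forall fun x => ?_)
  simp [← h x]

/-- The difference of the trilinear term and of the remainder, in terms of the Fourier
coefficients. -/
theorem IsDyadicPartition.exists_difference_bound (h : IsDyadicPartition χ φ) :
    ∃ C : ℝ≥0∞, C ≠ ⊤ ∧ ∀ f g k : ℝ × ℝ → Vec,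
      IsSmoothField f → IsSmoothField g → IsSmoothField k → (∀ p, divergence f p = 0) →
      MemL2 f → MemL2 g → MemL2 k → MemL2 (d1 f) → MemL2 (d1 g) →
      MemL2 (d2 f) → MemL2 (d2 g) → MemL2 (d1 (d2 f)) → MemL2 (d1 (d2 g)) →
      ∃ F Γ H : Fin 2 → Freq → ℂ, (∀ i, IsFT (cpt f i) (F i)) ∧ (∀ i, IsFT (cpt g i) (Γ i)) ∧
        (∀ i, IsFT (cpt k i) (H i)) ∧ ∀ q : ℤ,
        Integrable (trilinear χ φ q f g k) muOmega ∧ Integrable (remainder χ φ q f g k) muOmega ∧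
        ∀ pf pf' pg pg' ph ph' : ℝ≥0∞, hiNorm q F ≤ pf →
          hiNorm q (fun i κ => dsym 0 κ * F i κ) ≤ pf' → hiNorm q Γ ≤ pg →
          hiNorm q (fun i κ => dsym 0 κ * Γ i κ) ≤ pg' → hiNorm q H ≤ ph →
          hiNorm q (fun i κ => dsym 0 κ * H i κ) ≤ ph' →
          ‖(∫ p, trilinear χ φ q f g k p ∂muOmega) - ∫ p, remainder χ φ q f g k p ∂muOmega‖ₑ ≤
            C * (ENNReal.ofReal √(normL2 (d1 f) * normL2 (d1 (d2 f))) * (pg' * ph) +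
              ENNReal.ofReal √(normL2 f * normL2 (d2 f)) * (pg' * ph') +
              ENNReal.ofReal √(normL2 (d1 g) * normL2 (d1 (d2 g))) * (pf' * ph) +
              ENNReal.ofReal √(normL2 (d1 g) * normL2 (d1 (d2 g))) * (pf * ph') +
              ENNReal.ofReal √(normL2 (d1 f) * normL2 (d1 (d2 f))) * (pg * ph') +
              ENNReal.ofReal (normL2 (d1 (d2 g))) * (pf' * ph) +
              ENNReal.ofReal (normL2 (d2 g)) * (pf' * ph')) := by
  obtain ⟨C, hC, hb⟩ := h.exists_lintegral_difKernel_bound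
  refine ⟨2 * C, ENNReal.mul_ne_top (by norm_num) hC, fun f g k sf sg sk hdiv mf mg mk mf1 mg1
    mf2 mg2 mf12 mg12 => ?_⟩
  obtain ⟨F, hF, hFdiv, hF0⟩ := exists_isFT_divergence_free sf hdiv mf mf1 mf2
  obtain ⟨Γ, hΓ⟩ := exists_isFT_cpt mg
  obtain ⟨H, hH⟩ := exists_isFT_cpt mk
  refine ⟨F, Γ, H, hF, hΓ, hH, fun q => ?_⟩
  have hF1 := fun i => sf.isFT_d1 mf1 (hF i)
  have hF2 := fun i => sf.isFT_d2 mf2 (hF i)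
  have hF12 := fun i => sf.d2.isFT_d1 mf12 (hF2 i)
  have hΓ1 := fun i => sg.isFT_d1 mg1 (hΓ i)
  have hΓ2 := fun i => sg.isFT_d2 mg2 (hΓ i)
  have hΓ12 := fun i => sg.d2.isFT_d1 mg12 (hΓ2 i)
  have nF := fun i => nrm21_le_of_isFT mf mf2 (hF i) (hF2 i) fun _ => rfl
  -- The symbols of `∂₁` and `∂₂` commute, so the norm of `∂₁∂₂f` serves as the vertical derivative
  -- of `∂₁f` in Agmon's inequality.
  have nF1 := fun i => nrm21_le_of_isFT mf1 mf12 (hF1 i) (hF12 i) fun _ => by ring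
  have nΓ1 := fun i => nrm21_le_of_isFT mg1 mg12 (hΓ1 i) (hΓ12 i) fun _ => by ring
  have iF : ∀ i, Integrable (F i) gam := fun i => by
    refine ⟨(hF i).measurable.aestronglyMeasurable, ?_⟩
    refine (lintegral_gam_le (hF i).measurable.enorm).trans_lt ?_
    rw [dmul_enorm]
    exact ENNReal.add_lt_top.2 ⟨(nF i).trans_lt ENNReal.ofReal_lt_top,
      ENNReal.mul_lt_top sqrtSum_ne_top.lt_top ((nF1 i).trans_lt ENNReal.ofReal_lt_top)⟩
  have cv_cont : Continuous (convect f g) := by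
    have e : ∀ i : Fin 2, Continuous fun p => f p i := fun i =>
      (EuclideanSpace.proj i : Vec →L[ℝ] ℝ).continuous.comp sf.continuous
    exact ((e 0).smul sg.d1.continuous).add ((e 1).smul sg.d2.continuous)
  have cv_per : ∀ x y, convect f g (x + 1, y) = convect f g (x, y) := fun x y => by
    simp only [convect, sf.periodic, sg.d1.periodic, sg.d2.periodic]
  let b : Fin 2 → Fin 2 → ℝ × ℝ → ℂ := fun j => ![cpt (d1 g) j, cpt (d2 g) j]
  have hB : ∀ j i, IsFT (b j i) fun κ => dsym i κ * Γ j κ := fun j i => by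
    fin_cases i
    exacts [hΓ1 j, hΓ2 j]
  -- The integrable transform makes `f` bounded, which puts the convection term in `L²` and gives it
  -- a transform.
  have cv_mem : MemLp (convect f g) 2 muOmega := by
    refine memLp_of_cpt cv_cont fun j => ?_
    rw [cpt_convect]
    have e : ∀ i, MemLp (fun p => cpt f i p * b j i p) 2 muOmega := fun i =>
      (memLp_synth_mul (iF i) (hB j i).memLp_left).ae_eq
        (by filter_upwards [(hF i).ae_eq_synth (iF i)] with p hp; rw [hp])
    exact (e 0).add (e 1)
  obtain ⟨V, hV⟩ := exists_isFT_cpt cv_mem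
  have hm := h.isNiceSymbol q
  set m : Freq → ℂ := fun κ => symb (lpSymbol χ φ q) κ with hmdef
  have eT : ∀ p, ((trilinear χ φ q f g k p : ℝ) : ℂ) = ∑ j,
      conj (synth (fun κ => m κ * H j κ) p) * synth (fun κ => m κ * V j κ) p := fun p => by
    rw [trilinear, ofReal_inner]
    refine Finset.sum_congr rfl fun j _ => ?_
    rw [h.cpt_lpBlock q sk.continuous sk.periodic mk (hH j),
      h.cpt_lpBlock q cv_cont cv_per cv_mem (hV j)]
  have hlow : ∀ p, ((lpLow χ φ q (til fun p' => f p' 1) p : ℝ) : ℂ) =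
      synth (fun κ => lowSymb χ φ q κ * F 1 κ) p := fun p => by
    rw [til_eq_of_isFT sf.continuous (hF 1) hF0]
    exact h.lpLow_eq_synth q
      ((EuclideanSpace.proj 1 : Vec →L[ℝ] ℝ).continuous.comp sf.continuous)
      (fun x y => congrArg (EuclideanSpace.proj 1 : Vec →L[ℝ] ℝ) (sf.periodic x y)) (hF 1) p
  have eR : ∀ p, ((remainder χ φ q f g k p : ℝ) : ℂ) = ∑ j,
      conj (synth (fun κ => m κ * H j κ) p) * (synth (fun κ => lowSymb χ φ q κ * F 1 κ) p *
        synth (fun κ => dsym 1 κ * (m κ * Γ j κ)) p) := fun p => by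
    rw [remainder, Complex.ofReal_mul, ofReal_inner, hlow, Finset.mul_sum]
    refine Finset.sum_congr rfl fun j _ => ?_
    rw [h.cpt_lpBlock q sk.continuous sk.periodic mk (hH j),
      h.cpt_d2_lpBlock q sg.continuous sg.periodic mg (hΓ j)]
    ring
  have lH : ∀ j, MemLp (synth fun κ => m κ * H j κ) 2 muOmega := fun j =>
    memLp_synth (hm.integrable_symb_mul (hH j).memLp_right) (hm.memLp_symb_mul (hH j).memLp_right)
  have iT : ∀ j, Integrable (fun p => conj (synth (fun κ => m κ * H j κ) p) *
      synth (fun κ => m κ * V j κ) p) muOmega := fun j => integrable_conj_mul (lH j)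
    (memLp_synth (hm.integrable_symb_mul (hV j).memLp_right) (hm.memLp_symb_mul (hV j).memLp_right))
  have iR : ∀ j, Integrable (fun p => conj (synth (fun κ => m κ * H j κ) p) *
      (synth (fun κ => lowSymb χ φ q κ * F 1 κ) p *
        synth (fun κ => dsym 1 κ * (m κ * Γ j κ)) p)) muOmega := fun j =>
    integrable_conj_mul (lH j) (memLp_synth_mul (h.integrable_lowSymb_mul q (iF 1))
      (memLp_synth (hm.integrable_dsym_mul 1 (hΓ j).memLp_right)
        (hm.memLp_dsym_mul 1 (hΓ j).memLp_right)))
  refine ⟨integrable_of_ofReal eT (integrable_finsetSum _ fun j _ => iT j),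
    integrable_of_ofReal eR (integrable_finsetSum _ fun j _ => iR j),
    fun pf pf' pg pg' ph ph' hpf hpf' hpg hpg' hph hph' => ?_⟩
  have key : (((∫ p, trilinear χ φ q f g k p ∂muOmega) -
      ∫ p, remainder χ φ q f g k p ∂muOmega : ℝ) : ℂ) = ∑ j,
      ((∫ p, conj (synth (fun κ => m κ * H j κ) p) * synth (fun κ => m κ * V j κ) p ∂muOmega) -
        ∫ p, conj (synth (fun κ => m κ * H j κ) p) * (synth (fun κ => lowSymb χ φ q κ * F 1 κ) p *
        synth (fun κ => dsym 1 κ * (m κ * Γ j κ)) p) ∂muOmega) := by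
    rw [Complex.ofReal_sub, ← integral_complex_ofReal, ← integral_complex_ofReal]
    simp only [eT, eR]
    rw [integral_finsetSum _ fun j _ => iT j, integral_finsetSum _ fun j _ => iR j,
      Finset.sum_sub_distrib]
  have e0 : ∀ r : ℝ, ‖r‖ₑ = ‖(r : ℂ)‖ₑ := fun r => by
    rw [← ofReal_norm, ← ofReal_norm, Complex.norm_real]
  rw [e0, key]
  refine (enorm_sum_le _ _).trans ?_
  refine (Finset.sum_le_sum fun j _ => (h.enorm_trilinear_sub_le q (f := cpt f) (b := b j) (hV j)
    (cpt_convect f g j) hF iF (hΓ j).measurable (hΓ j).memLp_right (hB j) (hH j).measurable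
    (hH j).memLp_right).trans (hb q F (Γ j) (H j) (fun i => (hF i).measurable) (hΓ j).measurable
      (hH j).measurable hFdiv hF0 _ _ _ _ _ pf pf' pg pg' ph ph' nF1 (nΓ1 j) (nF 0)
      (?_ : _ ≤ ENNReal.ofReal (normL2 (d1 (d2 g)))) (?_ : _ ≤ ENNReal.ofReal (normL2 (d2 g)))
      ((nrm_hiF_le q F 0).trans hpf)
      (fun i => (nrm_hiF_le q (fun i κ => dsym 0 κ * F i κ) i).trans hpf')
      ((nrm_hiF_le q Γ j).trans hpg)
      ((nrm_hiF_le q (fun i κ => dsym 0 κ * Γ i κ) j).trans hpg')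
      ((nrm_hiF_le q H j).trans hph)
      ((nrm_hiF_le q (fun i κ => dsym 0 κ * H i κ) j).trans hph'))).trans ?_
  · exact nrm_le_of_isFT mg12 (hΓ12 j)
  · exact nrm_le_of_isFT mg2 (hΓ2 j)
  · rw [Finset.sum_const, Finset.card_univ, Fintype.card_fin, nsmul_eq_mul, mul_assoc]
    norm_num

end physical

/-! ### The sequence `b_q`, Young's inequality and the conclusion. -/

section conclusion

/-- A square summable sequence is controlled by a nonnegative sequence with sum at most one. -/
theorem exists_profile {s K : ℝ} (hK : 0 ≤ K) {a : ℤ → ℝ≥0∞} {N : ℝ≥0∞} (hN : N ≠ ⊤)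
    (h : ∑' q : ℤ, ENNReal.ofReal ((2 : ℝ) ^ (2 * (q : ℝ) * s)) * a q ^ 2 ≤
      ENNReal.ofReal K * N ^ 2) :
    ∃ β : ℤ → ℝ, (∀ q, 0 ≤ β q) ∧ Summable β ∧ ∑' q, β q ≤ 1 ∧ ∀ q : ℤ,
      a q ≤ ENNReal.ofReal (√((K + 1) * ((2 : ℝ) ^ (-2 * (q : ℝ) * s) * β q)) * N.toReal) := by
  set w : ℤ → ℝ≥0∞ := fun q => ENNReal.ofReal ((2 : ℝ) ^ (2 * (q : ℝ) * s)) with hw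
  set M : ℝ≥0∞ := ENNReal.ofReal (K + 1) * N ^ 2 with hM
  have hMtop : M ≠ ⊤ := ENNReal.mul_ne_top ENNReal.ofReal_ne_top (ENNReal.pow_ne_top hN)
  have hsum : ∑' q, w q * a q ^ 2 / M ≤ 1 := by
    simp only [div_eq_mul_inv, ENNReal.tsum_mul_right]
    rw [← div_eq_mul_inv]
    refine ENNReal.div_le_of_le_mul ?_
    rw [one_mul]
    exact h.trans (mul_le_mul' (ENNReal.ofReal_le_ofReal (by linarith)) le_rfl)
  have hsum' : ∑' q, w q * a q ^ 2 / M ≠ ⊤ := (hsum.trans_lt ENNReal.one_lt_top).ne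
  have hfin := ENNReal.ne_top_of_tsum_ne_top hsum'
  -- The profile is the share of the term of index `q` in the total bound `M`.
  refine ⟨fun q => (w q * a q ^ 2 / M).toReal, fun q => ENNReal.toReal_nonneg,
    ENNReal.summable_toReal hsum', ?_, fun q => ?_⟩
  · rw [← ENNReal.tsum_toReal_eq hfin]
    exact ENNReal.toReal_mono ENNReal.one_ne_top hsum
  have hp : (0 : ℝ) < (2 : ℝ) ^ (-2 * (q : ℝ) * s) := by positivity
  have hww : ENNReal.ofReal ((2 : ℝ) ^ (-2 * (q : ℝ) * s)) * w q = 1 := by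
    rw [hw, ← ENNReal.ofReal_mul hp.le, ← Real.rpow_add two_pos]
    simp
  have hle : w q * a q ^ 2 ≤ M := (ENNReal.le_tsum q).trans
    (h.trans (mul_le_mul' (ENNReal.ofReal_le_ofReal (by linarith)) le_rfl))
  have hsq : a q ^ 2 ≤
      ENNReal.ofReal (√((K + 1) * ((2 : ℝ) ^ (-2 * (q : ℝ) * s) * (w q * a q ^ 2 / M).toReal)) *
        N.toReal) ^ 2 := by
    rw [← ENNReal.ofReal_pow (by positivity), mul_pow, Real.sq_sqrt (by positivity),
      ENNReal.ofReal_mul (by positivity), ENNReal.ofReal_mul (by positivity),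
      ENNReal.ofReal_mul (by positivity), ENNReal.ofReal_toReal (hfin q),
      ENNReal.ofReal_pow ENNReal.toReal_nonneg, ENNReal.ofReal_toReal hN]
    have e : M * (w q * a q ^ 2 / M) = w q * a q ^ 2 := by
      by_cases hM0 : M = 0
      · rw [hM0, zero_mul]
        exact (le_zero_iff.1 (hM0 ▸ hle)).symm
      · exact ENNReal.mul_div_cancel hM0 hMtop
    calc a q ^ 2 = ENNReal.ofReal ((2 : ℝ) ^ (-2 * (q : ℝ) * s)) * w q * a q ^ 2 := by
          rw [hww, one_mul]
      _ = ENNReal.ofReal ((2 : ℝ) ^ (-2 * (q : ℝ) * s)) * (M * (w q * a q ^ 2 / M)) := by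
          rw [e, mul_assoc]
      _ ≤ _ := le_of_eq (by rw [hM]; ring)
  exact (ENNReal.pow_le_pow_left_iff two_ne_zero).1 hsq

/-- Primed letters stand for norms of `∂₁` of the fields. Five products contain one of them, which
gives `5 * ε` and a squared coefficient; those with `Z` and `P` contain two and keep their
coefficient to the first power. -/
theorem young_terms {ε X Y Z G P a b c a' b' c' : ℝ} (hε : 0 < ε) (hZ : 0 ≤ Z) (hP : 0 ≤ P) :
    X * (b' * c) + Z * (b' * c') + Y * (a' * c) + Y * (a * c') + X * (b * c') + G * (a' * c) +
        P * (a' * c') ≤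
      (2 * ε)⁻¹ * ((X ^ 2 + Y ^ 2 + G ^ 2) * (a ^ 2 + b ^ 2 + c ^ 2)) +
        (Z + P) * (a' ^ 2 + b' ^ 2 + c' ^ 2) + 5 * (ε * (a' ^ 2 + b' ^ 2 + c' ^ 2)) := by
  have y : ∀ x u v : ℝ, x * (u * v) ≤ (4 * ε)⁻¹ * (x ^ 2 * v ^ 2) + ε * u ^ 2 := fun x u v => by
    have e : (4 * ε)⁻¹ * (x ^ 2 * v ^ 2) + ε * u ^ 2 - x * (u * v) =
        ε * (u - (2 * ε)⁻¹ * (x * v)) ^ 2 := by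
      field_simp; ring
    have : 0 ≤ ε * (u - (2 * ε)⁻¹ * (x * v)) ^ 2 := by positivity
    linarith
  have z : ∀ x u v : ℝ, 0 ≤ x → x * (u * v) ≤ x * (u ^ 2 + v ^ 2) := fun x u v hx =>
    mul_le_mul_of_nonneg_left (by nlinarith [sq_nonneg (u - v), sq_nonneg u, sq_nonneg v]) hx
  have e2 : (2 * ε)⁻¹ = 2 * (4 * ε)⁻¹ := by field_simp; norm_num
  set r := (4 * ε)⁻¹
  have hr : 0 ≤ r := by positivity
  have s1 : r * (X ^ 2 * c ^ 2) + r * (X ^ 2 * b ^ 2) ≤ r * (X ^ 2 * (a ^ 2 + b ^ 2 + c ^ 2)) := by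
    have : 0 ≤ r * (X ^ 2 * a ^ 2) := by positivity
    nlinarith
  have s2 : r * (Y ^ 2 * c ^ 2) + r * (Y ^ 2 * a ^ 2) ≤ r * (Y ^ 2 * (a ^ 2 + b ^ 2 + c ^ 2)) := by
    have : 0 ≤ r * (Y ^ 2 * b ^ 2) := by positivity
    nlinarith
  have s3 : r * (G ^ 2 * c ^ 2) ≤ r * (G ^ 2 * (a ^ 2 + b ^ 2 + c ^ 2)) := by
    have : 0 ≤ r * (G ^ 2 * b ^ 2) := by positivity
    have : 0 ≤ r * (G ^ 2 * a ^ 2) := by positivity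
    nlinarith
  have s4 : 0 ≤ r * ((X ^ 2 + Y ^ 2 + G ^ 2) * (a ^ 2 + b ^ 2 + c ^ 2)) := by positivity
  have s5 : 0 ≤ Z * a' ^ 2 := by positivity
  have s6 : 0 ≤ P * b' ^ 2 := by positivity
  have s7 : 0 ≤ ε * a' ^ 2 := by positivity
  have s8 : 0 ≤ ε * b' ^ 2 := by positivity
  have s9 : 0 ≤ ε * c' ^ 2 := by positivity
  have t1 := y X b' c
  have t2 := z Z b' c' hZ
  have t3 := y Y a' c
  have t4 := y Y c' a
  have t5 := y X c' b
  have t6 := y G a' c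
  have t7 := z P a' c' hP
  rw [e2]
  nlinarith

/-- The quantities `m` and `n`, standing for the two quartic terms in `f`, are nonnegative and are
simply added to the upper bound. -/
theorem young_conclusion {ε D w v T R X Y Z G P x y m n a b c a' b' c' : ℝ} (hε : 0 < ε)
    (hD : 0 ≤ D) (hw : 0 ≤ w) (hv : 0 ≤ v) (hZ : 0 ≤ Z) (hP : 0 ≤ P) (hm : 0 ≤ m) (hn : 0 ≤ n)
    (hx : X ^ 2 = x) (hy : Y ^ 2 = y)
    (h : |T - R| ≤ D * (w * v) * (X * (b' * c) + Z * (b' * c') + Y * (a' * c) + Y * (a * c') +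
      X * (b * c') + G * (a' * c) + P * (a' * c'))) :
    -T ≤ (D * (2 * ε)⁻¹ + 1) * w * v * (x + m + n + y + G ^ 2) * (a ^ 2 + b ^ 2 + c ^ 2) +
      (5 * D + 1) * w * v * (Z + P) * (a' ^ 2 + b' ^ 2 + c' ^ 2) +
      (5 * D + 1) * ε * w * v * (a' ^ 2 + b' ^ 2 + c' ^ 2) - R := by
  have hwv : 0 ≤ w * v := mul_nonneg hw hv
  have m1 := h.trans (mul_le_mul_of_nonneg_left
    (young_terms (X := X) (Y := Y) (G := G) (a := a) (b := b) (c := c) (a' := a') (b' := b')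
      (c' := c') hε hZ hP) (mul_nonneg hD hwv))
  have m2 : -T ≤ |T - R| - R := by linarith [neg_abs_le (T - R)]
  have hx0 : 0 ≤ x := hx ▸ sq_nonneg X
  have hy0 : 0 ≤ y := hy ▸ sq_nonneg Y
  rw [hx, hy] at m1
  refine m2.trans (sub_le_sub_right (m1.trans ?_) R)
  have hS : 0 ≤ a ^ 2 + b ^ 2 + c ^ 2 := by positivity
  have hS' : 0 ≤ a' ^ 2 + b' ^ 2 + c' ^ 2 := by positivity
  generalize a ^ 2 + b ^ 2 + c ^ 2 = S at *
  generalize a' ^ 2 + b' ^ 2 + c' ^ 2 = S' at *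
  have r1 : 0 ≤ w * v * (D * (2 * ε)⁻¹ * ((m + n) * S) + (x + m + n + y + G ^ 2) * S) := by
    positivity
  have r2 : 0 ≤ w * v * (S' * (Z + P) + ε * S' + 4 * D * ((Z + P) * S')) := by positivity
  calc _ ≤ D * (w * v) * ((2 * ε)⁻¹ * ((x + y + G ^ 2) * S) + (Z + P) * S' + 5 * (ε * S')) +
        w * v * (D * (2 * ε)⁻¹ * ((m + n) * S) + (x + m + n + y + G ^ 2) * S) +
        w * v * (S' * (Z + P) + ε * S' + 4 * D * ((Z + P) * S')) := by linarith
    _ = _ := by ring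

/-- Each product holds two high-frequency norms, each with one factor `t`, and so carries `t * t`,
which later becomes a multiple of `2^{-2qs} b_q`. -/
theorem abs_le_of_enorm_le {r t X Y Z G P a b c a' b' c' : ℝ} {C : ℝ≥0∞} (hC : C ≠ ⊤)
    (ht : 0 ≤ t) (hX : 0 ≤ X) (hY : 0 ≤ Y) (hZ : 0 ≤ Z) (hG : 0 ≤ G) (hP : 0 ≤ P) (ha : 0 ≤ a)
    (hb : 0 ≤ b) (hc : 0 ≤ c) (ha' : 0 ≤ a') (hb' : 0 ≤ b') (hc' : 0 ≤ c')
    (h : ‖r‖ₑ ≤ C * (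
      ENNReal.ofReal X * (ENNReal.ofReal (t * b') * ENNReal.ofReal (t * c)) +
      ENNReal.ofReal Z * (ENNReal.ofReal (t * b') * ENNReal.ofReal (t * c')) +
      ENNReal.ofReal Y * (ENNReal.ofReal (t * a') * ENNReal.ofReal (t * c)) +
      ENNReal.ofReal Y * (ENNReal.ofReal (t * a) * ENNReal.ofReal (t * c')) +
      ENNReal.ofReal X * (ENNReal.ofReal (t * b) * ENNReal.ofReal (t * c')) +
      ENNReal.ofReal G * (ENNReal.ofReal (t * a') * ENNReal.ofReal (t * c)) +
      ENNReal.ofReal P * (ENNReal.ofReal (t * a') * ENNReal.ofReal (t * c')))) :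
    |r| ≤ C.toReal * (t * t) * (X * (b' * c) + Z * (b' * c') + Y * (a' * c) + Y * (a * c') +
      X * (b * c') + G * (a' * c) + P * (a' * c')) := by
  have e : ∀ {x u v : ℝ}, 0 ≤ x → 0 ≤ u → 0 ≤ v →
      ENNReal.ofReal x * (ENNReal.ofReal (t * u) * ENNReal.ofReal (t * v)) =
        ENNReal.ofReal (t * t * (x * (u * v))) := fun hx hu hv => by
    rw [← ENNReal.ofReal_mul (mul_nonneg ht hu), ← ENNReal.ofReal_mul hx]
    congr 1
    ring
  rw [e hX hb' hc, e hZ hb' hc', e hY ha' hc, e hY ha hc', e hX hb hc', e hG ha' hc,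
    e hP ha' hc'] at h
  have n1 : 0 ≤ t * t * (X * (b' * c)) := by positivity
  have n2 : 0 ≤ t * t * (Z * (b' * c')) := by positivity
  have n3 : 0 ≤ t * t * (Y * (a' * c)) := by positivity
  have n4 : 0 ≤ t * t * (Y * (a * c')) := by positivity
  have n5 : 0 ≤ t * t * (X * (b * c')) := by positivity
  have n6 : 0 ≤ t * t * (G * (a' * c)) := by positivity
  have n7 : 0 ≤ t * t * (P * (a' * c')) := by positivity
  rw [← ENNReal.ofReal_add n1 n2, ← ENNReal.ofReal_add (add_nonneg n1 n2) n3,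
    ← ENNReal.ofReal_add (by positivity) n4, ← ENNReal.ofReal_add (by positivity) n5,
    ← ENNReal.ofReal_add (by positivity) n6, ← ENNReal.ofReal_add (by positivity) n7,
    ← ENNReal.ofReal_toReal hC, ← ENNReal.ofReal_mul ENNReal.toReal_nonneg, ← ofReal_norm,
    ENNReal.ofReal_le_ofReal_iff (mul_nonneg ENNReal.toReal_nonneg (by positivity)),
    Real.norm_eq_abs] at h
  exact h.trans (le_of_eq (by ring))

end conclusion

end TorusLine

end

theorem lemma4p2 (χ φ : ℝ × ℝ → ℝ) (hχφ : IsDyadicPartition χ φ) (s : ℝ) (hs : 0 < s) :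
    ∃ (C₀ : ℝ) (C : ℝ → ℝ), 0 < C₀ ∧ (∀ ε₀ : ℝ, 0 < ε₀ → 0 < C ε₀) ∧
      ∀ f g h : ℝ × ℝ → Vec,
        IsSmoothField f → IsSmoothField g → IsSmoothField h →
        (∀ p, divergence f p = 0) →
        -- the norms on the right-hand side of the estimate are finite
        MemHs χ φ s f → MemHs χ φ s g → MemHs χ φ s h →
        MemHs χ φ s (d1 f) → MemHs χ φ s (d1 g) → MemHs χ φ s (d1 h) →
        MemL2 (d2 f) → MemL2 (d2 g) → MemL2 (d1 (d2 f)) → MemL2 (d1 (d2 g)) →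
        ∃ b : ℤ → ℝ, (∀ q, 0 ≤ b q) ∧ Summable b ∧ (∑' q, b q) ≤ 1 ∧
          ∀ q : ℤ,
            Integrable (trilinear χ φ q f g h) muOmega ∧
            Integrable (remainder χ φ q f g h) muOmega ∧
            ∀ ε₀ : ℝ, 0 < ε₀ →
              -(∫ p, trilinear χ φ q f g h p ∂muOmega) ≤
                C ε₀ * (2 : ℝ) ^ (-2 * (q : ℝ) * s) * b q *
                    (normL2 (d1 f) * normL2 (d1 (d2 f))
                      + normL2 f ^ 2 * normL2 (d1 f) ^ 2
                      + normL2 f ^ 2 * normL2 (d1 (d2 f)) ^ 2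
                      + normL2 (d1 g) * normL2 (d1 (d2 g))
                      + normL2 (d1 (d2 g)) ^ 2) *
                    (normHs χ φ s f ^ 2 + normHs χ φ s g ^ 2 + normHs χ φ s h ^ 2)
                + C₀ * (2 : ℝ) ^ (-2 * (q : ℝ) * s) * b q *
                    (normL2 f ^ (1 / 2 : ℝ) * normL2 (d2 f) ^ (1 / 2 : ℝ) + normL2 (d2 g)) *
                    (normHs χ φ s (d1 f) ^ 2 + normHs χ φ s (d1 g) ^ 2
                      + normHs χ φ s (d1 h) ^ 2)
                + C₀ * ε₀ * (2 : ℝ) ^ (-2 * (q : ℝ) * s) * b q *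
                    (normHs χ φ s (d1 f) ^ 2 + normHs χ φ s (d1 g) ^ 2
                      + normHs χ φ s (d1 h) ^ 2)
                - ∫ p, remainder χ φ q f g h p ∂muOmega := by

  obtain ⟨C, hC, hmain⟩ := hχφ.exists_difference_bound
  obtain ⟨K, hK, hprof⟩ := hχφ.exists_tsum_hiNorm_le hs
  set D : ℝ := C.toReal * (6 * (K + 1)) with hD
  have hD0 : 0 ≤ D := by positivity
  refine ⟨5 * D + 1, fun ε => D * (2 * ε)⁻¹ + 1, by positivity, fun ε hε => by positivity,
    fun f g k sf sg sk hdiv mf mg mk mf1 mg1 mk1 mf2 mg2 mf12 mg12 => ?_⟩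
  obtain ⟨F, Γ, H, hF, hΓ, hH, hq⟩ := hmain f g k sf sg sk hdiv mf.1 mg.1 mk.1 mf1.1 mg1.1
    mf2 mg2 mf12 mg12
  have prof : ∀ {u : ℝ × ℝ → Vec} {U : Fin 2 → Freq → ℂ}, IsSmoothField u → MemHs χ φ s u →
      (∀ i, IsFT (cpt u i) (U i)) → _ := fun su mu hU => exists_profile hK mu.2.ne
        (hprof _ _ su.continuous su.periodic mu.1 hU)
  obtain ⟨βf, f0, fs, f1, fb⟩ := prof sf mf hF
  obtain ⟨βg, g0, gs, g1, gb⟩ := prof sg mg hΓ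
  obtain ⟨βk, k0, ks, k1, kb⟩ := prof sk mk hH
  obtain ⟨βf', f0', fs', f1', fb'⟩ := prof sf.d1 mf1 fun i => sf.isFT_d1 mf1.1 (hF i)
  obtain ⟨βg', g0', gs', g1', gb'⟩ := prof sg.d1 mg1 fun i => sg.isFT_d1 mg1.1 (hΓ i)
  obtain ⟨βk', k0', ks', k1', kb'⟩ := prof sk.d1 mk1 fun i => sk.isFT_d1 mk1.1 (hH i)
  -- Averaging the six profiles keeps the sum at most one while each profile stays below `6 * b q`,
  -- whence the `6` in `D`.
  set b : ℤ → ℝ := fun q => (βf q + βg q + βk q + βf' q + βg' q + βk' q) / 6 with hb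
  have b0 : ∀ q, 0 ≤ b q := fun q => by
    have := f0 q; have := g0 q; have := k0 q; have := f0' q; have := g0' q; have := k0' q
    simp only [hb]; positivity
  have bsum := (((((fs.add gs).add ks).add fs').add gs').add ks').div_const 6
  refine ⟨b, b0, bsum, ?_, fun q => ⟨(hq q).1, (hq q).2.1, fun ε hε => ?_⟩⟩
  · rw [hb, tsum_div_const, (((((fs.add gs).add ks).add fs').add gs')).tsum_add ks',
      ((((fs.add gs).add ks).add fs')).tsum_add gs', (((fs.add gs).add ks)).tsum_add fs',
      ((fs.add gs)).tsum_add ks, fs.tsum_add gs]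
    linarith
  set w : ℝ := (2 : ℝ) ^ (-2 * (q : ℝ) * s) with hw
  have w0 : 0 ≤ w := by positivity
  set t : ℝ := √(6 * (K + 1) * (w * b q)) with ht
  have t0 : 0 ≤ t := Real.sqrt_nonneg _
  have tsq : t * t = 6 * (K + 1) * (w * b q) :=
    Real.mul_self_sqrt (by have := b0 q; positivity)
  have lift : ∀ {β : ℝ} {x : ENNReal} {N : ℝ}, 0 ≤ N → β ≤ 6 * b q →
      x ≤ ENNReal.ofReal (√((K + 1) * (w * β)) * N) → x ≤ ENNReal.ofReal (t * N) := by
    intro β x N hN hβ hx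
    refine hx.trans (ENNReal.ofReal_le_ofReal (mul_le_mul_of_nonneg_right
      (Real.sqrt_le_sqrt ?_) hN))
    calc (K + 1) * (w * β) ≤ (K + 1) * (w * (6 * b q)) := by gcongr
      _ = _ := by ring
  have hβ : βf q ≤ 6 * b q ∧ βg q ≤ 6 * b q ∧ βk q ≤ 6 * b q ∧ βf' q ≤ 6 * b q ∧
      βg' q ≤ 6 * b q ∧ βk' q ≤ 6 * b q := by
    have := f0 q; have := g0 q; have := k0 q; have := f0' q; have := g0' q; have := k0' q
    simp only [hb]
    refine ⟨?_, ?_, ?_, ?_, ?_, ?_⟩ <;> linarith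
  obtain ⟨h1, h2, h3, h4, h5, h6⟩ := hβ
  have N0 : ∀ u : ℝ × ℝ → Vec, 0 ≤ normHs χ φ s u := fun u => ENNReal.toReal_nonneg
  have L0 : ∀ u : ℝ × ℝ → Vec, 0 ≤ normL2 u := fun u => ENNReal.toReal_nonneg
  have est := (hq q).2.2 _ _ _ _ _ _ (lift (N0 f) h1 (fb q)) (lift (N0 (d1 f)) h4 (fb' q))
    (lift (N0 g) h2 (gb q)) (lift (N0 (d1 g)) h5 (gb' q))
    (lift (N0 k) h3 (kb q)) (lift (N0 (d1 k)) h6 (kb' q))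
  rw [← Real.mul_rpow (L0 f) (L0 (d2 f)), ← Real.sqrt_eq_rpow]
  refine young_conclusion hε hD0 w0 (b0 q) (Real.sqrt_nonneg _) (L0 _)
    (mul_nonneg (sq_nonneg _) (sq_nonneg _)) (mul_nonneg (sq_nonneg _) (sq_nonneg _))
    (Real.sq_sqrt (mul_nonneg (L0 (d1 f)) (L0 (d1 (d2 f)))))
    (Real.sq_sqrt (mul_nonneg (L0 (d1 g)) (L0 (d1 (d2 g)))))
    ((abs_le_of_enorm_le hC t0 (Real.sqrt_nonneg _) (Real.sqrt_nonneg _) (Real.sqrt_nonneg _)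
      (L0 _) (L0 _) (N0 f) (N0 g) (N0 k) (N0 (d1 f)) (N0 (d1 g)) (N0 (d1 k)) est).trans_eq ?_)
  rw [tsq, hD, ← mul_assoc C.toReal]
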